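/- Let $\sigma(x)=\max(x,0)$. For $u\in\mathbb R^q$ (the vector of values of an input function at $q$ sensors) and $y\in\mathbb R^d$ consider the shallow neural operator $$G(u)(y)=\frac1{\sqrt m}\sum_{r=1}^m\Big[\frac1{\sqrt p}\sum_{k=1}^p \tilde a_{rk}\,\sigma(\tilde w_{rk}^Tu)\Big]\sigma(w_r^Ty),\qquad m,p\ge 1.$$ Let $u_1,\dots,u_{n_1}\in\mathbb R^q$ and $y_1,\dots,y_{n_2}\in\mathbb R^d$ ($n_1,n_2\ge1$) be nonzero, with no two of the $u_i$ parallel and no two of the $y_j$ parallel, let $z=(z^i_j)\in\mathbb R^{n_1n_2}$ be the targets, and suppose that $\|u_i\|_2\le B$, $\|y_j\|_2\le B$ and $|z^i_j|\le B$ for all $i,j$. With $w\sim\mathcal N(0,I_d)$ and $\tilde w\sim\mathcal N(0,I_q)$ define the matrices $$(H_1^\infty)_{ii'}=\mathbb E[\sigma(\tilde w^Tu_i)\sigma(\tilde w^Tu_{i'})],\qquad (H_2^\infty)_{jj'}=\mathbb E[y_j^Ty_{j'}\mathbf 1\{w^Ty_j\ge0,\,w^Ty_{j'}\ge0\}],$$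 $$(\tilde H_1^\infty)_{ii'}=\mathbb E[u_i^Tu_{i'}\mathbf 1\{\tilde w^Tu_i\ge0,\,\tilde w^Tu_{i'}\ge0\}],\qquad (\tilde H_2^\infty)_{jj'}=\mathbb E[\sigma(w^Ty_j)\sigma(w^Ty_{j'})],$$ and let $\lambda_0$ and $\tilde\lambda_0$ be the least eigenvalues of $H^\infty=H_1^\infty\otimes H_2^\infty$ and of $\tilde H^\infty=\tilde H_1^\infty\otimes\tilde H_2^\infty$. The weights are initialized independently with $w_r(0)\sim\mathcal N(0,I_d)$, $\tilde w_{rk}(0)\sim\mathcal N(0,I_q)$ and $\tilde a_{rk}\sim\mathrm{Unif}\{-1,1\}$. The $\tilde a_{rk}$ stay fixed and $w_r,\tilde w_{rk}$ follow the gradient flow of $L=\frac12\sum_{i,j}(G(u_i)(y_j)-z^i_j)^2$, that is, they are absolutely continuous and for almost every time $t$ $$\frac{dw_r}{dt}=-\frac{\partial L}{\partial w_r},\qquad \frac{d\tilde w_{rk}}{dt}=-\frac{\partial L}{\partial\tilde w_{rk}},$$ where $\sigma'(0)$ may be read as any number in $[0,1]$ (possibly different at each time, neuron and sample). Let $G^t(u)\in\mathbb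 R^{n_1n_2}$ be the vector of the predictions $G(u_i)(y_j)$ at time $t$. Theorem. $\lambda_0>0$ and $\tilde\lambda_0>0$. Moreover, for every $B$ and every $\delta_0<1$ there is a constant $C>0$, depending only on $B$ and $\delta_0$, such that for all data as above, all $m,p\ge1$ and all $\delta\in(0,\delta_0]$ with $$m\ \ge\ C\,\frac{n_1^4n_2^4\,\log\!\big(\frac{n_1n_2}{\delta}\big)\log^3\!\big(\frac m\delta\big)}{\min(\lambda_0,\tilde\lambda_0)^2\,(\lambda_0+\tilde\lambda_0)^2},$$ with probability at least $1-\delta$ over the initialization, every such gradient flow trajectory starting at the initialization satisfies $$\|z-G^t(u)\|_2^2\le e^{-(\lambda_0+\tilde\lambda_0)t}\,\|z-G^0(u)\|_2^2$$ for all times $t\ge0$ up to which it is defined. -/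

import Mathlib

open MeasureTheory ProbabilityTheory
open scoped ENNReal Kronecker

noncomputable section

namespace ShallowOperator

/-- The ReLU activation. -/
def relu (x : ℝ) : ℝ := max x 0

/-- The subdifferential of the ReLU: `{0}` on the negative axis, `{1}` on the positive axis and
`[0, 1]` at the kink. In particular the indicator of `0 ≤ x` is always an element. -/
def reluSubdiff (x : ℝ) : Set ℝ :=
  {s | 0 ≤ s ∧ s ≤ 1 ∧ (x < 0 → s = 0) ∧ (0 < x → s = 1)}

section Network

variable {m p d q n₁ n₂ : ℕ}

/-- The `r`-th branch feature `(1 / √p) ∑ₖ a r k * σ (⟪w' r k, u⟫)`. -/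
def branch (w' : Fin m → Fin p → EuclideanSpace ℝ (Fin q)) (a : Fin m → Fin p → ℝ)
    (r : Fin m) (u : EuclideanSpace ℝ (Fin q)) : ℝ :=
  (1 / √(p : ℝ)) * ∑ k, a r k * relu (inner ℝ (w' r k) u)

/-- The shallow neural operator
`G(u)(y) = (1 / √m) ∑ᵣ [(1 / √p) ∑ₖ a r k * σ (⟪w' r k, u⟫)] * σ (⟪w r, y⟫)`. -/
def net (w : Fin m → EuclideanSpace ℝ (Fin d))
    (w' : Fin m → Fin p → EuclideanSpace ℝ (Fin q)) (a : Fin m → Fin p → ℝ)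
    (u : EuclideanSpace ℝ (Fin q)) (y : EuclideanSpace ℝ (Fin d)) : ℝ :=
  (1 / √(m : ℝ)) * ∑ r, branch w' a r u * relu (inner ℝ (w r) y)

/-- The squared Euclidean norm `‖z - G(u)‖²` of the residual on all the samples, which is twice
the training loss. -/
def sqResidual (u : Fin n₁ → EuclideanSpace ℝ (Fin q)) (y : Fin n₂ → EuclideanSpace ℝ (Fin d))
    (z : Fin n₁ → Fin n₂ → ℝ) (w : Fin m → EuclideanSpace ℝ (Fin d))
    (w' : Fin m → Fin p → EuclideanSpace ℝ (Fin q)) (a : Fin m → Fin p → ℝ) : ℝ :=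
  ∑ i, ∑ j, (z i j - net w w' a (u i) (y j)) ^ 2

/-- The partial gradient with respect to `w r` of the loss
`(1 / 2) ∑ᵢ ∑ⱼ (G(uᵢ)(yⱼ) - z i j) ^ 2`, where `s r j` stands for the derivative of the ReLU at
`⟪w r, yⱼ⟫`. -/
def gradTrunk (u : Fin n₁ → EuclideanSpace ℝ (Fin q)) (y : Fin n₂ → EuclideanSpace ℝ (Fin d))
    (z : Fin n₁ → Fin n₂ → ℝ) (w : Fin m → EuclideanSpace ℝ (Fin d))
    (w' : Fin m → Fin p → EuclideanSpace ℝ (Fin q)) (a : Fin m → Fin p → ℝ)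
    (s : Fin m → Fin n₂ → ℝ) (r : Fin m) : EuclideanSpace ℝ (Fin d) :=
  ∑ i, ∑ j, (net w w' a (u i) (y j) - z i j) •
    ((1 / √(m : ℝ)) * branch w' a r (u i) * s r j) • y j

/-- The partial gradient of the same loss with respect to `w' r k`, where `s' r k i` stands for
the derivative of the ReLU at `⟪w' r k, uᵢ⟫`. -/
def gradBranch (u : Fin n₁ → EuclideanSpace ℝ (Fin q)) (y : Fin n₂ → EuclideanSpace ℝ (Fin d))
    (z : Fin n₁ → Fin n₂ → ℝ) (w : Fin m → EuclideanSpace ℝ (Fin d))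
    (w' : Fin m → Fin p → EuclideanSpace ℝ (Fin q)) (a : Fin m → Fin p → ℝ)
    (s' : Fin m → Fin p → Fin n₁ → ℝ) (r : Fin m) (k : Fin p) : EuclideanSpace ℝ (Fin q) :=
  ∑ i, ∑ j, (net w w' a (u i) (y j) - z i j) •
    ((1 / √(m : ℝ)) * (1 / √(p : ℝ)) * a r k * s' r k i * relu (inner ℝ (w r) (y j))) • u i

/-- `(w, w')` is a trajectory of the gradient flow of the training loss on `[0, T]`, for fixed
output weights `a`: it is absolutely continuous, and at almost every time the velocity of every
weight vector is minus the corresponding partial gradient of the loss. At a time when some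
preactivation vanishes, the derivative of the ReLU there may take any value in its subdifferential
`[0, 1]`; so the solutions for the convention `σ'(x) = 1_{x ≥ 0}` are among these trajectories. -/
structure IsGradientFlow (u : Fin n₁ → EuclideanSpace ℝ (Fin q))
    (y : Fin n₂ → EuclideanSpace ℝ (Fin d)) (z : Fin n₁ → Fin n₂ → ℝ)
    (a : Fin m → Fin p → ℝ) (T : ℝ) (w : ℝ → Fin m → EuclideanSpace ℝ (Fin d))
    (w' : ℝ → Fin m → Fin p → EuclideanSpace ℝ (Fin q)) : Prop where
  absCont_trunk : ∀ r, AbsolutelyContinuousOnInterval (fun t => w t r) 0 T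
  absCont_branch : ∀ r k, AbsolutelyContinuousOnInterval (fun t => w' t r k) 0 T
  flow : ∀ᵐ t : ℝ, t ∈ Set.Ioo 0 T →
    ∃ (s : Fin m → Fin n₂ → ℝ) (s' : Fin m → Fin p → Fin n₁ → ℝ),
      (∀ r j, s r j ∈ reluSubdiff (inner ℝ (w t r) (y j))) ∧
      (∀ r k i, s' r k i ∈ reluSubdiff (inner ℝ (w' t r k) (u i))) ∧
      (∀ r, HasDerivAt (fun τ => w τ r) (-gradTrunk u y z (w t) (w' t) a s r) t) ∧
      (∀ r k, HasDerivAt (fun τ => w' τ r k) (-gradBranch u y z (w t) (w' t) a s' r k) t)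

end Network

/-- The uniform distribution on `{-1, 1}`. -/
def rademacher : Measure ℝ :=
  (1 / 2 : ℝ≥0∞) • Measure.dirac (-1) + (1 / 2 : ℝ≥0∞) • Measure.dirac 1

/-- The law of the random initialization `(w(0), w'(0), a)`: all the coordinates are independent,
the weight vectors are standard Gaussian and the output weights are uniform on `{-1, 1}`. -/
def initLaw (m p d q : ℕ) :
    Measure ((Fin m → EuclideanSpace ℝ (Fin d)) ×
      (Fin m → Fin p → EuclideanSpace ℝ (Fin q)) × (Fin m → Fin p → ℝ)) :=
  (Measure.pi fun _ => stdGaussian (EuclideanSpace ℝ (Fin d))).prod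
    ((Measure.pi fun _ => Measure.pi fun _ => stdGaussian (EuclideanSpace ℝ (Fin q))).prod
      (Measure.pi fun _ => Measure.pi fun _ => rademacher))

section Gram

variable {D n : ℕ}

/-- The matrix with entries `𝔼 [σ (⟪w, vᵢ⟫) σ (⟪w, vⱼ⟫)]`, for `w` standard Gaussian. -/
def valueGram (v : Fin n → EuclideanSpace ℝ (Fin D)) : Matrix (Fin n) (Fin n) ℝ :=
  Matrix.of fun i j => ∫ w, relu (inner ℝ w (v i)) * relu (inner ℝ w (v j))
    ∂(stdGaussian (EuclideanSpace ℝ (Fin D)))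

/-- The matrix with entries `𝔼 [⟪vᵢ, vⱼ⟫ 1{⟪w, vᵢ⟫ ≥ 0, ⟪w, vⱼ⟫ ≥ 0}]`, for `w` standard
Gaussian. -/
def derivGram (v : Fin n → EuclideanSpace ℝ (Fin D)) : Matrix (Fin n) (Fin n) ℝ :=
  Matrix.of fun i j => ∫ w, Set.indicator {w | 0 ≤ inner ℝ w (v i) ∧ 0 ≤ inner ℝ w (v j)}
    (fun _ => inner ℝ (v i) (v j)) w ∂(stdGaussian (EuclideanSpace ℝ (Fin D)))

/-- The least eigenvalue of a real symmetric matrix. -/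
def leastEigenvalue {ι : Type} [Fintype ι] [DecidableEq ι] (A : Matrix ι ι ℝ) : ℝ :=
  sInf (spectrum ℝ A)

end Gram

/-- `λ₀`, the least eigenvalue of the limiting Gram matrix `H^∞` of the trunk weights. -/
def lam {n₁ n₂ d q : ℕ} (u : Fin n₁ → EuclideanSpace ℝ (Fin q))
    (y : Fin n₂ → EuclideanSpace ℝ (Fin d)) : ℝ :=
  leastEigenvalue (valueGram u ⊗ₖ derivGram y)

/-- `λ̃₀`, the least eigenvalue of the limiting Gram matrix `H̃^∞` of the branch weights. -/
def lam' {n₁ n₂ d q : ℕ} (u : Fin n₁ → EuclideanSpace ℝ (Fin q))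
    (y : Fin n₂ → EuclideanSpace ℝ (Fin d)) : ℝ :=
  leastEigenvalue (derivGram u ⊗ₖ valueGram y)

end ShallowOperator

end

open MeasureTheory ProbabilityTheory
open scoped ENNReal Kronecker

noncomputable section

namespace ShallowOperator

/-! ### Absolutely continuous functions: Grönwall's inequality and the chain rule through the ReLU.
-/

section AbsolutelyContinuous

open Set Filter

/-! Write `Λ` for `lam + lam'`, `N` for the number `n₁ * n₂` of samples and `S` for the squared
residual. Along the flow `S` has derivative `-2` times the sum of the squared gradient norms, and
this sum is a quadratic form in the residual vector: its matrix is an empirical Gram matrix of the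
trunk weights plus one of the branch weights. Both are averages over `m` neurons, which are i.i.d.
at initialization, with expectations `H^∞` and `H̃^∞`. If the average matrices stay within `Λ / (4 *
N)` entrywise of these limits, the flow satisfies the Polyak–Łojasiewicz inequality `Λ * S ≤ 2 * ∑
‖grad‖ ^ 2`, whence the rate `Λ`.

Positivity of the eigenvalues (`posDef_derivGram`, `posDef_valueGram`): the limits are Kronecker
products of Gram matrices in `L²`, so it suffices that the functions `step ⟪w, vᵢ⟫ • vᵢ`, resp.
`relu ⟪w, vᵢ⟫`, are linearly independent. For non-parallel `vᵢ` some point lies on exactly one of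
the hyperplanes `vᵢᗮ`, and near it only one function has a jump, resp. a kink.

Initialization (`measure_pi_not_isGoodInit_le`): thanks to the random signs, a branch feature is
sub-Gaussian with a constant that does not depend on `p`. The kernels of a neuron are therefore
subexponential, and Bernstein's inequality with a union bound controls the Gram matrices, the
initial predictions and the fraction of neurons with a small preactivation; a sub-Gaussian tail
bounds all features by `M`, of order `√log (m / δ)`.

Stability (`abs_average_kernel_sub_le`, `IsGoodInit.mul_sqResidual_le`): if trunk weights move by at
most `R` and branch weights by at most `R / √p`, the ReLU derivative changes only where the initial
preactivation is at most `R` times the norm of the sample. This is a fraction at most `2 * R` of the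
weights, so the Gram entries move by `O(M ^ 2 * R)`.

Confinement (`IsGradientFlow.sqResidual_le_exp`): while the weights stay in this ball, `S` decays
exponentially, and the velocities, being bounded by a multiple of `√S`, are integrable. The total
displacement is at most of order `M * N * τ / (√m * Λ)`, with `τ` of order `√log (N / δ)` bounding
the initial predictions. If this is less than `R`, the weights never leave the ball. Compatibility
of this with `N * M ^ 2 * R ≲ Λ` reads `√m * Λ ^ 2 ≳ N ^ 2 * τ * M ^ 3`; its square follows from the
width condition. -/

theorem absCont_lipschitz_comp {X Y : Type*} [PseudoMetricSpace X] [PseudoMetricSpace Y]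
    {g : X → Y} {K : NNReal} (hg : LipschitzWith K g) {f : ℝ → X} {a b : ℝ}
    (hf : AbsolutelyContinuousOnInterval f a b) :
    AbsolutelyContinuousOnInterval (fun t => g (f t)) a b := by
  unfold AbsolutelyContinuousOnInterval at *
  have h0 : Tendsto (fun E : ℕ × (ℕ → ℝ × ℝ) =>
      K * ∑ i ∈ Finset.range E.1, dist (f (E.2 i).1) (f (E.2 i).2))
      (AbsolutelyContinuousOnInterval.totalLengthFilter ⊓
        𝓟 (AbsolutelyContinuousOnInterval.disjWithin a b)) (nhds 0) := by
    simpa using hf.const_mul (K : ℝ)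
  refine squeeze_zero (fun E => Finset.sum_nonneg fun i _ => dist_nonneg) (fun E => ?_) h0
  rw [Finset.mul_sum]
  exact Finset.sum_le_sum fun i _ => hg.dist_le_mul _ _

theorem absCont_const {Y : Type*} [PseudoMetricSpace Y] (c : Y) (a b : ℝ) :
    AbsolutelyContinuousOnInterval (fun _ : ℝ => c) a b :=
  ((LipschitzWith.const c).lipschitzOnWith).absolutelyContinuousOnInterval

theorem absCont_sum {ι : Type*} (s : Finset ι) {f : ι → ℝ → ℝ} {a b : ℝ}
    (hf : ∀ i, AbsolutelyContinuousOnInterval (f i) a b) :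
    AbsolutelyContinuousOnInterval (fun t => ∑ i ∈ s, f i t) a b := by
  classical
  induction s using Finset.induction_on with
  | empty => simpa using absCont_const (0 : ℝ) a b
  | insert i s hi ih =>
    simp only [Finset.sum_insert hi]
    exact (hf i).fun_add ih

theorem absCont_inner_right {E : Type*} [NormedAddCommGroup E] [InnerProductSpace ℝ E]
    {f : ℝ → E} {a b : ℝ} (hf : AbsolutelyContinuousOnInterval f a b) (v : E) :
    AbsolutelyContinuousOnInterval (fun t => inner ℝ (f t) v) a b := by
  simp_rw [real_inner_comm v]
  exact absCont_lipschitz_comp (innerSL ℝ v).lipschitz hf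

theorem absCont_le_of_ae_deriv_nonpos {f : ℝ → ℝ} {T : ℝ} (hT : 0 ≤ T)
    (hf : AbsolutelyContinuousOnInterval f 0 T)
    (h : ∀ᵐ t : ℝ, t ∈ Ioo 0 T → deriv f t ≤ 0) : f T ≤ f 0 := by
  have h1 := hf.integral_deriv_eq_sub
  have h2 : ∫ x in (0:ℝ)..T, deriv f x ≤ 0 := by
    rw [intervalIntegral.integral_of_le hT, integral_Ioc_eq_integral_Ioo]
    refine integral_nonpos_of_ae ?_
    rw [EventuallyLE, ae_restrict_iff' measurableSet_Ioo]
    exact h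
  linarith

/-- Grönwall's inequality for an a.e. differential inequality: `exp (κ * t) * f t` is absolutely
continuous with nonpositive derivative almost everywhere. -/
theorem absCont_le_exp_mul {f : ℝ → ℝ} {T κ : ℝ} (hT : 0 ≤ T)
    (hf : AbsolutelyContinuousOnInterval f 0 T)
    (h : ∀ᵐ t : ℝ, t ∈ Ioo 0 T → deriv f t ≤ -κ * f t) : f T ≤ Real.exp (-κ * T) * f 0 := by
  have hexp : AbsolutelyContinuousOnInterval (fun t => Real.exp (κ * t)) 0 T :=
    ContDiffOn.absolutelyContinuousOnInterval (by fun_prop)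
  have key := absCont_le_of_ae_deriv_nonpos hT (hexp.fun_mul hf) (by
    filter_upwards [h, hf.ae_differentiableAt] with t ht hd hm
    have hd' := (hd (by rw [uIcc_of_le hT]; exact Ioo_subset_Icc_self hm)).hasDerivAt
    have he : HasDerivAt (fun t => Real.exp (κ * t)) (Real.exp (κ * t) * κ) t := by
      simpa using ((hasDerivAt_id t).const_mul κ).exp
    rw [(he.fun_mul hd').deriv]
    have := ht hm
    have h3 := mul_le_mul_of_nonneg_left this (Real.exp_pos (κ * t)).le
    linarith)
  simp only [mul_zero, Real.exp_zero, one_mul] at key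
  have h4 : Real.exp (-κ * T) * Real.exp (κ * T) = 1 := by
    rw [← Real.exp_add]; simp
  calc f T = Real.exp (-κ * T) * (Real.exp (κ * T) * f T) := by rw [← mul_assoc, h4, one_mul]
    _ ≤ _ := by gcongr

theorem lipschitzWith_relu : LipschitzWith 1 relu := by
  refine LipschitzWith.of_dist_le_mul fun x y => ?_
  simp only [relu, NNReal.coe_one, one_mul, Real.dist_eq]
  simpa using abs_max_sub_max_le_abs x y 0

theorem relu_nonneg (x : ℝ) : 0 ≤ relu x := le_max_right _ _

theorem relu_of_nonneg {x : ℝ} (h : 0 ≤ x) : relu x = x := max_eq_left h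

theorem relu_of_nonpos {x : ℝ} (h : x ≤ 0) : relu x = 0 := max_eq_right h

theorem relu_le_abs (x : ℝ) : relu x ≤ |x| := max_le (le_abs_self x) (abs_nonneg x)

theorem abs_relu_sub_relu_le (x y : ℝ) : |relu x - relu y| ≤ |x - y| := by
  simpa [relu] using abs_max_sub_max_le_abs x y 0

/-- This makes the choice of subgradient irrelevant. At a kink, `relu ∘ f` and `relu ∘ f - f` are
both nonnegative and vanish at `t`. If both are differentiable there, both derivatives are zero, so
`f' = 0` and every `s` gives the same product. -/
theorem hasDerivAt_relu_comp {f : ℝ → ℝ} {f' t s : ℝ} (hf : HasDerivAt f f' t)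
    (hd : DifferentiableAt ℝ (fun τ => relu (f τ)) t) (hs : s ∈ reluSubdiff (f t)) :
    HasDerivAt (fun τ => relu (f τ)) (s * f') t := by
  obtain ⟨-, -, hneg, hpos⟩ := hs
  rcases lt_trichotomy (f t) 0 with h | h | h
  · rw [hneg h, zero_mul]
    refine (hasDerivAt_const t (0 : ℝ)).congr_of_eventuallyEq ?_
    filter_upwards [hf.continuousAt.eventually_lt_const h] with τ hτ
    exact relu_of_nonpos hτ.le
  · have hz : HasDerivAt (fun τ => relu (f τ)) 0 t := by
      have hmin : IsLocalMin (fun τ => relu (f τ)) t := by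
        refine Eventually.of_forall fun τ => ?_
        simp only [h, relu_of_nonneg le_rfl]
        exact relu_nonneg _
      have := hmin.deriv_eq_zero
      rw [← this]
      exact hd.hasDerivAt
    have hz' : HasDerivAt (fun τ => relu (f τ) - f τ) (0 - f') t := hz.fun_sub hf
    have hf0 : 0 - f' = 0 := by
      have hmin : IsLocalMin (fun τ => relu (f τ) - f τ) t := by
        refine Eventually.of_forall fun τ => ?_
        simp only [h, relu_of_nonneg le_rfl, sub_zero]
        exact sub_nonneg.2 (le_max_left _ _)
      exact hmin.hasDerivAt_eq_zero hz'
    have : f' = 0 := by linarith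
    rw [this, mul_zero]
    exact hz
  · rw [hpos h, one_mul]
    refine hf.congr_of_eventuallyEq ?_
    filter_upwards [hf.continuousAt.eventually_const_lt h] with τ hτ
    exact relu_of_nonneg hτ.le

end AbsolutelyContinuous

/-! ### Energy identity along the flow and confinement of the trajectory. -/

section Trajectory

open Set Filter

variable {m p d q n₁ n₂ : ℕ} {u : Fin n₁ → EuclideanSpace ℝ (Fin q)}
  {y : Fin n₂ → EuclideanSpace ℝ (Fin d)} {z : Fin n₁ → Fin n₂ → ℝ} {a : Fin m → Fin p → ℝ}

/-- Only one of the two copies of the gradient in `‖g‖ ^ 2` is expanded. The result is the pairing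
of the residual with the rate of change of the predictions, the form in which the chain rule
produces it; the branch version is the same. -/
theorem sum_norm_sq_gradTrunk (w : Fin m → EuclideanSpace ℝ (Fin d))
    (w' : Fin m → Fin p → EuclideanSpace ℝ (Fin q)) (s : Fin m → Fin n₂ → ℝ) :
    ∑ r, ‖gradTrunk u y z w w' a s r‖ ^ 2 = ∑ i, ∑ j, (net w w' a (u i) (y j) - z i j) *
      ((1 / √(m : ℝ)) * ∑ r, branch w' a r (u i) *
        (s r j * inner ℝ (gradTrunk u y z w w' a s r) (y j))) := by
  have h : ∀ r, ‖gradTrunk u y z w w' a s r‖ ^ 2 = ∑ i, ∑ j,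
      (net w w' a (u i) (y j) - z i j) * ((1 / √(m : ℝ)) * (branch w' a r (u i) *
        (s r j * inner ℝ (gradTrunk u y z w w' a s r) (y j)))) := by
    intro r
    rw [← real_inner_self_eq_norm_sq]
    conv_lhs => enter [3]; rw [gradTrunk]
    simp only [inner_sum, inner_smul_right]
    refine Finset.sum_congr rfl fun i _ => Finset.sum_congr rfl fun j _ => ?_
    ring
  simp_rw [h, Finset.mul_sum]
  rw [Finset.sum_comm]
  exact Finset.sum_congr rfl fun i _ => Finset.sum_comm

theorem sum_norm_sq_gradBranch (w : Fin m → EuclideanSpace ℝ (Fin d))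
    (w' : Fin m → Fin p → EuclideanSpace ℝ (Fin q)) (s' : Fin m → Fin p → Fin n₁ → ℝ) :
    ∑ r, ∑ k, ‖gradBranch u y z w w' a s' r k‖ ^ 2 =
      ∑ i, ∑ j, (net w w' a (u i) (y j) - z i j) *
      ((1 / √(m : ℝ)) * ∑ r, ((1 / √(p : ℝ)) * ∑ k, a r k * (s' r k i *
        inner ℝ (gradBranch u y z w w' a s' r k) (u i))) * relu (inner ℝ (w r) (y j))) := by
  have h : ∀ r k, ‖gradBranch u y z w w' a s' r k‖ ^ 2 = ∑ i, ∑ j,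
      (net w w' a (u i) (y j) - z i j) * ((1 / √(m : ℝ)) * (((1 / √(p : ℝ)) * (a r k * (s' r k i *
        inner ℝ (gradBranch u y z w w' a s' r k) (u i)))) * relu (inner ℝ (w r) (y j)))) := by
    intro r k
    rw [← real_inner_self_eq_norm_sq]
    conv_lhs => enter [3]; rw [gradBranch]
    simp only [inner_sum, inner_smul_right]
    refine Finset.sum_congr rfl fun i _ => Finset.sum_congr rfl fun j _ => ?_
    ring
  have h2 : ∀ r, ∑ k, ‖gradBranch u y z w w' a s' r k‖ ^ 2 = ∑ i, ∑ j,
      (net w w' a (u i) (y j) - z i j) * ((1 / √(m : ℝ)) * (((1 / √(p : ℝ)) * ∑ k, (a r k *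
      (s' r k i * inner ℝ (gradBranch u y z w w' a s' r k) (u i)))) *
        relu (inner ℝ (w r) (y j)))) := by
    intro r
    simp_rw [h, Finset.mul_sum, Finset.sum_mul, Finset.mul_sum]
    rw [Finset.sum_comm]
    exact Finset.sum_congr rfl fun i _ => Finset.sum_comm
  simp_rw [h2]
  rw [Finset.sum_comm]
  refine Finset.sum_congr rfl fun i _ => ?_
  rw [Finset.sum_comm]
  refine Finset.sum_congr rfl fun j _ => ?_
  rw [← Finset.mul_sum, ← Finset.mul_sum]

variable {T : ℝ} {w : ℝ → Fin m → EuclideanSpace ℝ (Fin d)}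
  {w' : ℝ → Fin m → Fin p → EuclideanSpace ℝ (Fin q)}

theorem absCont_branch (hw' : ∀ r k, AbsolutelyContinuousOnInterval (fun t => w' t r k) 0 T)
    (r : Fin m) (v : EuclideanSpace ℝ (Fin q)) :
    AbsolutelyContinuousOnInterval (fun t => branch (w' t) a r v) 0 T := by
  unfold branch
  exact AbsolutelyContinuousOnInterval.const_mul _ (absCont_sum _ fun k =>
    AbsolutelyContinuousOnInterval.const_mul _
      (absCont_lipschitz_comp lipschitzWith_relu (absCont_inner_right (hw' r k) v)))

theorem absCont_net (hw : ∀ r, AbsolutelyContinuousOnInterval (fun t => w t r) 0 T)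
    (hw' : ∀ r k, AbsolutelyContinuousOnInterval (fun t => w' t r k) 0 T)
    (v : EuclideanSpace ℝ (Fin q)) (x : EuclideanSpace ℝ (Fin d)) :
    AbsolutelyContinuousOnInterval (fun t => net (w t) (w' t) a v x) 0 T := by
  unfold net
  exact AbsolutelyContinuousOnInterval.const_mul _ (absCont_sum _ fun r =>
    (absCont_branch hw' r v).fun_mul
      (absCont_lipschitz_comp lipschitzWith_relu (absCont_inner_right (hw r) x)))

theorem absCont_sqResidual (hw : ∀ r, AbsolutelyContinuousOnInterval (fun t => w t r) 0 T)
    (hw' : ∀ r k, AbsolutelyContinuousOnInterval (fun t => w' t r k) 0 T) :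
    AbsolutelyContinuousOnInterval (fun t => sqResidual u y z (w t) (w' t) a) 0 T := by
  unfold sqResidual
  refine absCont_sum _ fun i => absCont_sum _ fun j => ?_
  simp_rw [pow_two]
  have := (absCont_const (z i j) 0 T).fun_sub (absCont_net (a := a) hw hw' (u i) (y j))
  exact this.fun_mul this

theorem hasDerivAt_sqResidual {t : ℝ} {s : Fin m → Fin n₂ → ℝ} {s' : Fin m → Fin p → Fin n₁ → ℝ}
    (hs : ∀ r j, s r j ∈ reluSubdiff (inner ℝ (w t r) (y j)))
    (hs' : ∀ r k i, s' r k i ∈ reluSubdiff (inner ℝ (w' t r k) (u i)))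
    (hw : ∀ r, HasDerivAt (fun τ => w τ r) (-gradTrunk u y z (w t) (w' t) a s r) t)
    (hw' : ∀ r k, HasDerivAt (fun τ => w' τ r k) (-gradBranch u y z (w t) (w' t) a s' r k) t)
    (hd : ∀ r j, DifferentiableAt ℝ (fun τ => relu (inner ℝ (w τ r) (y j))) t)
    (hd' : ∀ r k i, DifferentiableAt ℝ (fun τ => relu (inner ℝ (w' τ r k) (u i))) t) :
    HasDerivAt (fun τ => sqResidual u y z (w τ) (w' τ) a)
      (-2 * (∑ r, ‖gradTrunk u y z (w t) (w' t) a s r‖ ^ 2 +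
        ∑ r, ∑ k, ‖gradBranch u y z (w t) (w' t) a s' r k‖ ^ 2)) t := by
  have h1 : ∀ r j, HasDerivAt (fun τ => relu (inner ℝ (w τ r) (y j)))
      (s r j * inner ℝ (-gradTrunk u y z (w t) (w' t) a s r) (y j)) t := fun r j =>
    hasDerivAt_relu_comp (by simpa using (hw r).inner ℝ (hasDerivAt_const t (y j))) (hd r j) (hs r j)
  have h2 : ∀ r k i, HasDerivAt (fun τ => relu (inner ℝ (w' τ r k) (u i)))
      (s' r k i * inner ℝ (-gradBranch u y z (w t) (w' t) a s' r k) (u i)) t := fun r k i =>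
    hasDerivAt_relu_comp (by simpa using (hw' r k).inner ℝ (hasDerivAt_const t (u i)))
      (hd' r k i) (hs' r k i)
  have h3 : ∀ r i, HasDerivAt (fun τ => branch (w' τ) a r (u i))
      ((1 / √(p : ℝ)) * ∑ k, a r k * (s' r k i *
        inner ℝ (-gradBranch u y z (w t) (w' t) a s' r k) (u i))) t := fun r i =>
    (HasDerivAt.fun_sum fun k _ => (h2 r k i).const_mul (a r k)).const_mul _
  have h4 : ∀ i j, HasDerivAt (fun τ => net (w τ) (w' τ) a (u i) (y j))
      ((1 / √(m : ℝ)) * ∑ r, (((1 / √(p : ℝ)) * ∑ k, a r k * (s' r k i *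
        inner ℝ (-gradBranch u y z (w t) (w' t) a s' r k) (u i))) * relu (inner ℝ (w t r) (y j)) +
        branch (w' t) a r (u i) *
          (s r j * inner ℝ (-gradTrunk u y z (w t) (w' t) a s r) (y j)))) t := fun i j =>
    (HasDerivAt.fun_sum fun r _ => (h3 r i).fun_mul (h1 r j)).const_mul _
  have h5 := HasDerivAt.fun_sum (u := Finset.univ) fun i _ =>
    HasDerivAt.fun_sum (u := Finset.univ) fun j _ =>
      ((hasDerivAt_const t (z i j)).fun_sub (h4 i j)).fun_pow 2
  refine (h5.congr_deriv ?_)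
  rw [sum_norm_sq_gradTrunk, sum_norm_sq_gradBranch, ← Finset.sum_add_distrib, Finset.mul_sum]
  refine Finset.sum_congr rfl fun i _ => ?_
  rw [← Finset.sum_add_distrib, Finset.mul_sum]
  refine Finset.sum_congr rfl fun j _ => ?_
  simp only [inner_neg_left, mul_neg, Finset.sum_neg_distrib, Finset.sum_add_distrib, neg_mul]
  push_cast
  ring

theorem IsGradientFlow.mono {T' : ℝ} (hflow : IsGradientFlow u y z a T w w') (h0 : 0 ≤ T')
    (h : T' ≤ T) : IsGradientFlow u y z a T' w w' := by
  have hsub : uIcc 0 T' ⊆ uIcc 0 T := by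
    rw [uIcc_of_le h0, uIcc_of_le (h0.trans h)]
    exact Icc_subset_Icc_right h
  refine ⟨fun r => (hflow.absCont_trunk r).mono hsub, fun r k => (hflow.absCont_branch r k).mono hsub,
    ?_⟩
  filter_upwards [hflow.flow] with t ht hm
  exact ht ⟨hm.1, hm.2.trans_le h⟩

/-- The ReLU of an absolutely continuous preactivation is again absolutely continuous, hence
differentiable almost everywhere. As there are finitely many preactivations, one null set of times
serves for all of them. -/
theorem IsGradientFlow.ae_hasDerivAt_sqResidual (hT : 0 ≤ T)
    (hflow : IsGradientFlow u y z a T w w') :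
    ∀ᵐ t : ℝ, t ∈ Ioo 0 T → ∃ (s : Fin m → Fin n₂ → ℝ) (s' : Fin m → Fin p → Fin n₁ → ℝ),
      (∀ r j, s r j ∈ reluSubdiff (inner ℝ (w t r) (y j))) ∧
      (∀ r k i, s' r k i ∈ reluSubdiff (inner ℝ (w' t r k) (u i))) ∧
      (∀ r, HasDerivAt (fun τ => w τ r) (-gradTrunk u y z (w t) (w' t) a s r) t) ∧
      (∀ r k, HasDerivAt (fun τ => w' τ r k) (-gradBranch u y z (w t) (w' t) a s' r k) t) ∧
      HasDerivAt (fun τ => sqResidual u y z (w τ) (w' τ) a)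
        (-2 * (∑ r, ‖gradTrunk u y z (w t) (w' t) a s r‖ ^ 2 +
          ∑ r, ∑ k, ‖gradBranch u y z (w t) (w' t) a s' r k‖ ^ 2)) t := by
  have h1 : ∀ᵐ t : ℝ, ∀ r j, t ∈ uIcc 0 T →
      DifferentiableAt ℝ (fun τ => relu (inner ℝ (w τ r) (y j))) t := by
    refine ae_all_iff.2 fun r => ae_all_iff.2 fun j => ?_
    exact (absCont_lipschitz_comp lipschitzWith_relu
      (absCont_inner_right (hflow.absCont_trunk r) (y j))).ae_differentiableAt
  have h2 : ∀ᵐ t : ℝ, ∀ r k i, t ∈ uIcc 0 T →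
      DifferentiableAt ℝ (fun τ => relu (inner ℝ (w' τ r k) (u i))) t := by
    refine ae_all_iff.2 fun r => ae_all_iff.2 fun k => ae_all_iff.2 fun i => ?_
    exact (absCont_lipschitz_comp lipschitzWith_relu
      (absCont_inner_right (hflow.absCont_branch r k) (u i))).ae_differentiableAt
  filter_upwards [hflow.flow, h1, h2] with t ht hd hd' hm
  have hm' : t ∈ uIcc 0 T := by rw [uIcc_of_le hT]; exact Ioo_subset_Icc_self hm
  obtain ⟨s, s', hs, hs', hw, hw'⟩ := ht hm
  exact ⟨s, s', hs, hs', hw, hw', hasDerivAt_sqResidual hs hs' hw hw' (fun r j => hd r j hm')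
    fun r k i => hd' r k i hm'⟩

/-- The total displacement is bounded by the integral of the speed bound. The vector-valued case
reduces to the scalar one by pairing `f` with the fixed vector `f T - f 0`; the added exponential
term is the antiderivative that compensates the growth. -/
theorem norm_sub_le_of_ae_hasDerivAt {E : Type*} [NormedAddCommGroup E] [InnerProductSpace ℝ E]
    {f : ℝ → E} {T c κ : ℝ} (hT : 0 ≤ T) (hc : 0 ≤ c) (hκ : 0 < κ)
    (hf : AbsolutelyContinuousOnInterval f 0 T)
    (h : ∀ᵐ t : ℝ, t ∈ Ioo 0 T → ∃ f', HasDerivAt f f' t ∧ ‖f'‖ ≤ c * Real.exp (-κ * t)) :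
    ‖f T - f 0‖ ≤ c / κ := by
  set v := f T - f 0 with hv
  have hexp : AbsolutelyContinuousOnInterval
      (fun t => ‖v‖ * (c / κ) * Real.exp (-κ * t)) 0 T :=
    ContDiffOn.absolutelyContinuousOnInterval (by fun_prop)
  have key := absCont_le_of_ae_deriv_nonpos hT ((absCont_inner_right hf v).fun_add hexp) (by
    filter_upwards [h] with t ht hm
    obtain ⟨f', hf', hle⟩ := ht hm
    have he : HasDerivAt (fun t => ‖v‖ * (c / κ) * Real.exp (-κ * t))
        (‖v‖ * (c / κ) * (Real.exp (-κ * t) * -κ)) t := by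
      simpa using ((hasDerivAt_id t).const_mul (-κ)).exp.const_mul (‖v‖ * (c / κ))
    have hi : HasDerivAt (fun t => inner ℝ (f t) v) (inner ℝ f' v) t := by
      simpa using hf'.inner ℝ (hasDerivAt_const t v)
    rw [(hi.fun_add he).deriv]
    have h1 : inner ℝ f' v ≤ ‖f'‖ * ‖v‖ := real_inner_le_norm _ _
    have h2 : ‖f'‖ * ‖v‖ ≤ c * Real.exp (-κ * t) * ‖v‖ := by gcongr
    have h3 : ‖v‖ * (c / κ) * (Real.exp (-κ * t) * -κ) = -(c * Real.exp (-κ * t) * ‖v‖) := by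
      field_simp
    linarith)
  simp only [mul_zero, Real.exp_zero, mul_one] at key
  have h1 : inner ℝ (f T) v - inner ℝ (f 0) v = ‖v‖ ^ 2 := by
    rw [← inner_sub_left, ← hv, real_inner_self_eq_norm_sq]
  have h2 : 0 ≤ ‖v‖ * (c / κ) * Real.exp (-κ * T) := by positivity
  have h3 : ‖v‖ * ‖v‖ ≤ ‖v‖ * (c / κ) := by nlinarith
  rcases (norm_nonneg v).eq_or_lt with h0 | h0
  · rw [← h0]; positivity
  · exact le_of_mul_le_mul_left h3 h0

/-- Real induction. It is applied to the set of times up to which `P` has held without interruption,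
so that the step may use the whole past. -/
theorem forall_mem_Icc_of_continuation {P : ℝ → Prop} {T : ℝ} (h0 : P 0)
    (hcl : IsClosed ({t | P t} ∩ Icc 0 T))
    (hstep : ∀ t ∈ Ico 0 T, (∀ τ ∈ Icc 0 t, P τ) → ∀ᶠ τ in nhdsWithin t (Ioi t), P τ) :
    ∀ t ∈ Icc 0 T, P t := by
  have hcl' : IsClosed ({t | ∀ τ ∈ Icc 0 t, P τ} ∩ Icc 0 T) := by
    rw [← isSeqClosed_iff_isClosed]
    intro x l hx hl
    have hlT : l ∈ Icc 0 T := isClosed_Icc.mem_of_tendsto hl (Eventually.of_forall fun n => (hx n).2)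
    refine ⟨fun τ hτ => ?_, hlT⟩
    rcases hτ.2.eq_or_lt with rfl | hlt
    · exact (hcl.mem_of_tendsto hl
        (Eventually.of_forall fun n => ⟨(hx n).1 _ ⟨(hx n).2.1, le_rfl⟩, (hx n).2⟩)).1
    · obtain ⟨n, hn⟩ := (hl.eventually_const_lt hlt).exists
      exact (hx n).1 τ ⟨hτ.1, hn.le⟩
  have key := hcl'.Icc_subset_of_forall_mem_nhdsWithin
    (fun τ hτ => by obtain rfl : τ = 0 := le_antisymm hτ.2 hτ.1; exact h0)
    (fun t ht => by
      obtain ⟨hall, hT'⟩ := ht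
      obtain ⟨b, hb, hb'⟩ := mem_nhdsGT_iff_exists_Ioo_subset.1 (hstep t hT' hall)
      refine mem_nhdsGT_iff_exists_Ioo_subset.2 ⟨b, hb, fun x hx τ hτ => ?_⟩
      rcases le_or_gt τ t with h | h
      · exact hall τ ⟨hτ.1, h⟩
      · exact hb' ⟨h, hτ.2.trans_lt hx.2⟩)
  exact fun t ht => key ht t ⟨ht.1, le_rfl⟩

theorem IsGradientFlow.sqResidual_le_of_mem_ball {κ R R' : ℝ}
    (hT : 0 ≤ T) (hflow : IsGradientFlow u y z a T w w')
    (hcoer : ∀ v v' s s', (∀ r, ‖v r - w 0 r‖ ≤ R) → (∀ r k, ‖v' r k - w' 0 r k‖ ≤ R') →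
      (∀ r j, s r j ∈ reluSubdiff (inner ℝ (v r) (y j))) →
      (∀ r k i, s' r k i ∈ reluSubdiff (inner ℝ (v' r k) (u i))) →
      κ * sqResidual u y z v v' a ≤ 2 * (∑ r, ‖gradTrunk u y z v v' a s r‖ ^ 2 +
        ∑ r, ∑ k, ‖gradBranch u y z v v' a s' r k‖ ^ 2))
    (hball : ∀ t ∈ Icc 0 T, (∀ r, ‖w t r - w 0 r‖ ≤ R) ∧ ∀ r k, ‖w' t r k - w' 0 r k‖ ≤ R') :
    sqResidual u y z (w T) (w' T) a ≤ Real.exp (-κ * T) * sqResidual u y z (w 0) (w' 0) a := by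
  refine absCont_le_exp_mul hT (absCont_sqResidual hflow.absCont_trunk hflow.absCont_branch) ?_
  filter_upwards [hflow.ae_hasDerivAt_sqResidual hT] with t ht hm
  obtain ⟨s, s', hs, hs', -, -, hΦ⟩ := ht hm
  have hb := hball t (Ioo_subset_Icc_self hm)
  rw [hΦ.deriv]
  have := hcoer _ _ s s' hb.1 hb.2 hs hs'
  linarith

theorem sqResidual_nonneg (v : Fin m → EuclideanSpace ℝ (Fin d))
    (v' : Fin m → Fin p → EuclideanSpace ℝ (Fin q)) : 0 ≤ sqResidual u y z v v' a :=
  Finset.sum_nonneg fun _ _ => Finset.sum_nonneg fun _ _ => sq_nonneg _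

/-- A gradient flow whose loss satisfies a Polyak–Łojasiewicz inequality, and whose velocities are
controlled by the residual, on a neighbourhood of the initialization that is larger than the
distance these two bounds allow it to travel, never leaves that neighbourhood, and its residual
decays exponentially. -/
theorem IsGradientFlow.sqResidual_le_exp {κ R R' c c' : ℝ} (hκ : 0 < κ) (hc : 0 ≤ c) (hc' : 0 ≤ c')
    (hflow : IsGradientFlow u y z a T w w')
    (hcoer : ∀ v v' s s', (∀ r, ‖v r - w 0 r‖ ≤ R) → (∀ r k, ‖v' r k - w' 0 r k‖ ≤ R') →
      (∀ r j, s r j ∈ reluSubdiff (inner ℝ (v r) (y j))) →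
      (∀ r k i, s' r k i ∈ reluSubdiff (inner ℝ (v' r k) (u i))) →
      κ * sqResidual u y z v v' a ≤ 2 * (∑ r, ‖gradTrunk u y z v v' a s r‖ ^ 2 +
        ∑ r, ∑ k, ‖gradBranch u y z v v' a s' r k‖ ^ 2))
    (hvel : ∀ v v' s s', (∀ r, ‖v r - w 0 r‖ ≤ R) → (∀ r k, ‖v' r k - w' 0 r k‖ ≤ R') →
      (∀ r j, s r j ∈ reluSubdiff (inner ℝ (v r) (y j))) →
      (∀ r k i, s' r k i ∈ reluSubdiff (inner ℝ (v' r k) (u i))) →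
      (∀ r, ‖gradTrunk u y z v v' a s r‖ ≤ c * √(sqResidual u y z v v' a)) ∧
      ∀ r k, ‖gradBranch u y z v v' a s' r k‖ ≤ c' * √(sqResidual u y z v v' a))
    (hR : c * √(sqResidual u y z (w 0) (w' 0) a) / (κ / 2) < R)
    (hR' : c' * √(sqResidual u y z (w 0) (w' 0) a) / (κ / 2) < R') :
    ∀ t ∈ Icc 0 T, sqResidual u y z (w t) (w' t) a ≤
      Real.exp (-κ * t) * sqResidual u y z (w 0) (w' 0) a := by
  intro t ht
  have hT : 0 ≤ T := ht.1.trans ht.2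
  have hR0 : 0 < R := lt_of_le_of_lt (by positivity) hR
  have hR0' : 0 < R' := lt_of_le_of_lt (by positivity) hR'
  set P : ℝ → Prop := fun t => (∀ r, ‖w t r - w 0 r‖ ≤ R) ∧ ∀ r k, ‖w' t r k - w' 0 r k‖ ≤ R'
    with hP
  have hcw : ∀ r, ContinuousOn (fun t => w t r) (Icc 0 T) := fun r => by
    simpa [uIcc_of_le hT] using (hflow.absCont_trunk r).continuousOn
  have hcw' : ∀ r k, ContinuousOn (fun t => w' t r k) (Icc 0 T) := fun r k => by
    simpa [uIcc_of_le hT] using (hflow.absCont_branch r k).continuousOn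
  have hcl : IsClosed ({t | P t} ∩ Icc 0 T) := by
    have : {t | P t} ∩ Icc 0 T = Icc 0 T ∩
        ((⋂ r, Icc 0 T ∩ {t | ‖w t r - w 0 r‖ ≤ R}) ∩
          ⋂ r, ⋂ k, Icc 0 T ∩ {t | ‖w' t r k - w' 0 r k‖ ≤ R'}) := by
      ext x
      simp only [hP, mem_inter_iff, mem_ofPred_eq, mem_iInter]
      exact ⟨fun ⟨⟨h1, h2⟩, h3⟩ => ⟨h3, fun r => ⟨h3, h1 r⟩, fun r k => ⟨h3, h2 r k⟩⟩,
        fun ⟨h3, h1, h2⟩ => ⟨⟨fun r => (h1 r).2, fun r k => (h2 r k).2⟩, h3⟩⟩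
    rw [this]
    refine isClosed_Icc.inter ((isClosed_iInter fun r => ?_).inter
      (isClosed_iInter fun r => isClosed_iInter fun k => ?_))
    · exact ((hcw r).sub continuousOn_const).norm.preimage_isClosed_of_isClosed isClosed_Icc
        isClosed_Iic
    · exact ((hcw' r k).sub continuousOn_const).norm.preimage_isClosed_of_isClosed isClosed_Icc
        isClosed_Iic
  have hvel' : ∀ τ ∈ Icc 0 T, (∀ x ∈ Icc 0 τ, P x) → ∀ᵐ x : ℝ, x ∈ Ioo 0 τ →
      (∀ r, ∃ f', HasDerivAt (fun x => w x r) f' x ∧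
        ‖f'‖ ≤ c * √(sqResidual u y z (w 0) (w' 0) a) * Real.exp (-(κ / 2) * x)) ∧
      ∀ r k, ∃ f', HasDerivAt (fun x => w' x r k) f' x ∧
        ‖f'‖ ≤ c' * √(sqResidual u y z (w 0) (w' 0) a) * Real.exp (-(κ / 2) * x) := by
    intro τ hτ hall
    filter_upwards [(hflow.mono hτ.1 hτ.2).flow] with x hx hm
    obtain ⟨s, s', hs, hs', hw, hw'⟩ := hx hm
    have hPx := hall x (Ioo_subset_Icc_self hm)
    -- Decay of the residual up to the intermediate time `x`, which needs confinement on `[0, x]`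
    -- only.
    have hb := (hflow.mono hm.1.le (hm.2.le.trans hτ.2)).sqResidual_le_of_mem_ball hm.1.le hcoer
      fun b hb => hall b ⟨hb.1, hb.2.trans hm.2.le⟩
    have hv := hvel _ _ s s' hPx.1 hPx.2 hs hs'
    -- The velocities are controlled by the square root of the squared residual, which decays at
    -- half the rate; this is the source of `κ / 2` in the displacement bounds.
    have hsq : √(sqResidual u y z (w x) (w' x) a) ≤
        √(sqResidual u y z (w 0) (w' 0) a) * Real.exp (-(κ / 2) * x) := by
      refine Real.sqrt_le_iff.2 ⟨by positivity, ?_⟩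
      rw [mul_pow, Real.sq_sqrt (sqResidual_nonneg _ _), ← Real.exp_nat_mul]
      calc _ ≤ _ := hb
        _ = _ := by rw [mul_comm]; congr 2; push_cast; ring
    refine ⟨fun r => ⟨_, hw r, ?_⟩, fun r k => ⟨_, hw' r k, ?_⟩⟩
    · rw [norm_neg, mul_assoc]
      exact (hv.1 r).trans (mul_le_mul_of_nonneg_left hsq hc)
    · rw [norm_neg, mul_assoc]
      exact (hv.2 r k).trans (mul_le_mul_of_nonneg_left hsq hc')
  have hmem : ∀ t ∈ Icc 0 T, P t := by
    refine forall_mem_Icc_of_continuation ⟨by simp [hR0.le], by simp [hR0'.le]⟩ hcl ?_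
    intro τ hτ hall
    have hv := hvel' τ (Ico_subset_Icc_self hτ) hall
    have hfl := hflow.mono hτ.1 hτ.2.le
    have hnhds : ∀ {f : ℝ → ℝ}, ContinuousOn f (Icc 0 T) →
        Tendsto f (nhdsWithin τ (Ioi τ)) (nhds (f τ)) := fun hf =>
      (hf τ (Ico_subset_Icc_self hτ)).mono_left (by
        rw [← nhdsWithin_Ioc_eq_nhdsGT hτ.2]
        exact nhdsWithin_mono _ fun x hx => ⟨hτ.1.trans hx.1.le, hx.2⟩)
    -- The displacement up to `τ` is strictly below `R`, so by continuity it remains so a little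
    -- later.
    have e1 : ∀ r, ∀ᶠ x in nhdsWithin τ (Ioi τ), ‖w x r - w 0 r‖ ≤ R := fun r =>
      ((hnhds ((hcw r).sub continuousOn_const).norm).eventually_lt_const
        (lt_of_le_of_lt (norm_sub_le_of_ae_hasDerivAt hτ.1 (by positivity) (by positivity)
          (hfl.absCont_trunk r) (hv.mono fun x hx hm => (hx hm).1 r)) hR)).mono fun x hx => hx.le
    have e2 : ∀ r k, ∀ᶠ x in nhdsWithin τ (Ioi τ), ‖w' x r k - w' 0 r k‖ ≤ R' := fun r k =>
      ((hnhds ((hcw' r k).sub continuousOn_const).norm).eventually_lt_const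
        (lt_of_le_of_lt (norm_sub_le_of_ae_hasDerivAt hτ.1 (by positivity) (by positivity)
          (hfl.absCont_branch r k) (hv.mono fun x hx hm => (hx hm).2 r k)) hR')).mono
            fun x hx => hx.le
    filter_upwards [eventually_all.2 e1, eventually_all.2 fun r => eventually_all.2 (e2 r)]
      with x h1 h2 using ⟨h1, h2⟩
  exact (hflow.mono ht.1 ht.2).sqResidual_le_of_mem_ball ht.1 hcoer
    fun b hb => hmem b ⟨hb.1, hb.2.trans ht.2⟩

end Trajectory

/-! ### Variational properties of the least eigenvalue. -/

section LeastEigenvalue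

open Matrix

variable {ι : Type} [Fintype ι] [DecidableEq ι] {A : Matrix ι ι ℝ}

theorem leastEigenvalue_le (hA : A.IsHermitian) {x : ℝ} (hx : x ∈ spectrum ℝ A) :
    leastEigenvalue A ≤ x := by
  refine csInf_le ?_ hx
  rw [hA.spectrum_real_eq_range_eigenvalues]
  exact (Set.finite_range _).bddBelow

theorem leastEigenvalue_pos [Nonempty ι] (hA : A.PosDef) : 0 < leastEigenvalue A := by
  have hmem : leastEigenvalue A ∈ spectrum ℝ A := by
    refine Set.Nonempty.csInf_mem ?_ ?_
    · exact ⟨_, hA.isHermitian.eigenvalues_mem_spectrum_real (Classical.arbitrary ι)⟩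
    · rw [hA.isHermitian.spectrum_real_eq_range_eigenvalues]
      exact Set.finite_range _
  rw [hA.isHermitian.spectrum_real_eq_range_eigenvalues] at hmem
  obtain ⟨i, hi⟩ := hmem
  rw [← hi]
  exact hA.eigenvalues_pos i

/-- Rayleigh's bound: shifting `A` by its least eigenvalue leaves a nonnegative spectrum, so the
difference is positive semidefinite. -/
theorem leastEigenvalue_mul_le (hA : A.IsHermitian) (x : ι → ℝ) :
    leastEigenvalue A * ∑ i, x i ^ 2 ≤ ∑ i, ∑ j, x i * x j * A i j := by
  have hps : (A - algebraMap ℝ (Matrix ι ι ℝ) (leastEigenvalue A)).PosSemidef := by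
    rw [posSemidef_iff_isHermitian_and_spectrum_nonneg]
    constructor
    · refine hA.sub ?_
      rw [algebraMap_eq_diagonal]
      exact isHermitian_diagonal _
    · rw [← spectrum.sub_singleton_eq]
      rintro _ ⟨y, hy, _, rfl, rfl⟩
      simpa using leastEigenvalue_le hA hy
  have h := hps.dotProduct_mulVec_nonneg x
  rw [sub_mulVec, dotProduct_sub, algebraMap_eq_diagonal] at h
  simp only [dotProduct, mulVec, star_trivial, sub_nonneg, Finset.mul_sum] at h
  rw [Finset.mul_sum]
  calc _ = _ := Finset.sum_congr rfl fun i _ => by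
        simp [diagonal_apply]
        ring
    _ ≤ _ := h
    _ = _ := Finset.sum_congr rfl fun i _ => Finset.sum_congr rfl fun j _ => by ring

theorem leastEigenvalue_le_diag (hA : A.IsHermitian) (i : ι) : leastEigenvalue A ≤ A i i := by
  have h := leastEigenvalue_mul_le hA (Pi.single i 1)
  simpa [Pi.single_apply, ite_pow] using h

end LeastEigenvalue

/-! ### Positive definiteness of the limiting Gram matrices. -/

section GramMatrix

variable {D n : ℕ}

/-- The derivative of the ReLU, with value `1` at the kink. -/
def step (x : ℝ) : ℝ := if 0 ≤ x then 1 else 0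

theorem relu_eq_step_mul (x : ℝ) : relu x = step x * x := by
  unfold step
  split_ifs with h
  · rw [one_mul, relu_of_nonneg h]
  · rw [zero_mul, relu_of_nonpos (not_le.1 h).le]

theorem measurable_step : Measurable step :=
  Measurable.ite measurableSet_Ici measurable_const measurable_const

theorem measurable_relu : Measurable relu := lipschitzWith_relu.continuous.measurable

theorem step_nonneg (x : ℝ) : 0 ≤ step x := by unfold step; split_ifs <;> norm_num

theorem step_le_one (x : ℝ) : step x ≤ 1 := by unfold step; split_ifs <;> norm_num

/-- Needed to turn relations that hold almost surely into relations at some point of every nonempty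
open set. -/
instance isOpenPosMeasure_stdGaussian : (stdGaussian (EuclideanSpace ℝ (Fin D))).IsOpenPosMeasure := by
  have : (gaussianReal 0 1).IsOpenPosMeasure :=
    (gaussianReal_absolutelyContinuous' 0 one_ne_zero).isOpenPosMeasure
  rw [← map_pi_eq_stdGaussian]
  exact (PiLp.continuous_toLp 2 _).isOpenPosMeasure_map (WithLp.toLp_surjective 2)

theorem memLp_inner_stdGaussian (v : EuclideanSpace ℝ (Fin D)) (p : ENNReal) (hp : p ≠ ∞) :
    MemLp (fun w => inner ℝ w v) p (stdGaussian (EuclideanSpace ℝ (Fin D))) := by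
  simp_rw [real_inner_comm v]
  exact IsGaussian.memLp_dual _ (innerSL ℝ v) p hp

theorem measurable_inner_right (v : EuclideanSpace ℝ (Fin D)) :
    Measurable fun w : EuclideanSpace ℝ (Fin D) => inner ℝ w v := by fun_prop

theorem memLp_relu_inner_stdGaussian (v : EuclideanSpace ℝ (Fin D)) (p : ENNReal) (hp : p ≠ ∞) :
    MemLp (fun w => relu (inner ℝ w v)) p (stdGaussian (EuclideanSpace ℝ (Fin D))) := by
  refine (memLp_inner_stdGaussian v p hp).mono
    (measurable_relu.comp (measurable_inner_right v)).aestronglyMeasurable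
    (Filter.Eventually.of_forall fun w => ?_)
  rw [Real.norm_eq_abs, abs_of_nonneg (relu_nonneg _)]
  exact relu_le_abs _

/-- The quadratic form at `x` is the integral of `‖∑ xᵢ Fᵢ‖ ^ 2`. Vector values are allowed because
the derivative features are `step ⟪w, vᵢ⟫ • vᵢ`. -/
theorem posDef_integral_inner {Ω E : Type*} [MeasurableSpace Ω] {μ : Measure Ω}
    [NormedAddCommGroup E] [InnerProductSpace ℝ E] {F : Fin n → Ω → E}
    (hF : ∀ i j, Integrable (fun ω => inner ℝ (F i ω) (F j ω)) μ)
    (hli : ∀ x : Fin n → ℝ, (∀ᵐ ω ∂μ, ∑ i, x i • F i ω = 0) → x = 0) :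
    (Matrix.of fun i j => ∫ ω, inner ℝ (F i ω) (F j ω) ∂μ).PosDef := by
  refine Matrix.PosDef.of_dotProduct_mulVec_pos ?_ fun x hx => ?_
  · ext i j
    simp [Matrix.conjTranspose_apply, real_inner_comm]
  · have hexp : ∀ ω, ‖∑ i, x i • F i ω‖ ^ 2 =
        ∑ i, ∑ j, x i * (x j * inner ℝ (F i ω) (F j ω)) := by
      intro ω
      rw [← real_inner_self_eq_norm_sq]
      simp only [sum_inner, inner_sum, inner_smul_left, inner_smul_right, conj_trivial,
        Finset.mul_sum]
      refine Finset.sum_congr rfl fun i _ => Finset.sum_congr rfl fun j _ => ?_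
      rw [real_inner_comm]
    have hint : Integrable (fun ω => ‖∑ i, x i • F i ω‖ ^ 2) μ := by
      simp_rw [hexp]
      exact integrable_finsetSum _ fun i _ => integrable_finsetSum _ fun j _ =>
        ((hF i j).const_mul _).const_mul _
    have heq : star x ⬝ᵥ (Matrix.of fun i j => ∫ ω, inner ℝ (F i ω) (F j ω) ∂μ).mulVec x =
        ∫ ω, ‖∑ i, x i • F i ω‖ ^ 2 ∂μ := by
      simp_rw [hexp]
      rw [integral_finsetSum _ fun i _ => integrable_finsetSum _ fun j _ =>
        ((hF i j).const_mul _).const_mul _]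
      simp only [dotProduct, Matrix.mulVec, star_trivial, Matrix.of_apply, Finset.mul_sum]
      refine Finset.sum_congr rfl fun i _ => ?_
      rw [integral_finsetSum _ fun j _ => ((hF i j).const_mul _).const_mul _]
      refine Finset.sum_congr rfl fun j _ => ?_
      rw [integral_const_mul, integral_const_mul]
      ring
    rw [heq]
    refine lt_of_le_of_ne (integral_nonneg fun ω => sq_nonneg _) fun h0 => hx (hli x ?_)
    have := (integral_eq_zero_iff_of_nonneg (fun ω => sq_nonneg _) hint).1 h0.symm
    filter_upwards [this] with ω hω
    simpa using hω

variable {v : Fin n → EuclideanSpace ℝ (Fin D)}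

/-- A real vector space is not a finite union of proper subspaces. Each `⟪vᵢ, ·⟫` with `i ≠ i₀` is
nonzero on the hyperplane orthogonal to `v i₀`: otherwise `vᵢ` would lie in the double orthogonal
complement, the line through `v i₀`. -/
theorem exists_inner_eq_zero_forall_inner_ne_zero
    (hv : ∀ i i', i ≠ i' → LinearIndependent ℝ ![v i, v i']) (i₀ : Fin n) :
    ∃ w : EuclideanSpace ℝ (Fin D), inner ℝ w (v i₀) = 0 ∧ ∀ i, i ≠ i₀ → inner ℝ w (v i) ≠ 0 := by
  obtain ⟨w, hw, hne⟩ := Module.Dual.exists_forall_mem_ne_zero_of_forall_exists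
    (K := ℝ) (ι := {i // i ≠ i₀}) (Submodule.span ℝ {v i₀})ᗮ
    (fun i => (innerSL ℝ (v i) : EuclideanSpace ℝ (Fin D) →ₗ[ℝ] ℝ)) (by
      rintro ⟨i, hi⟩
      by_contra! hcon
      have hmem : v i ∈ (Submodule.span ℝ {v i₀})ᗮᗮ := by
        rw [Submodule.mem_orthogonal]
        intro x hx
        rw [real_inner_comm]
        exact hcon x hx
      rw [Submodule.orthogonal_orthogonal, Submodule.mem_span_singleton] at hmem
      obtain ⟨c, hc⟩ := hmem
      have := (LinearIndependent.pair_iff.1 (hv i i₀ hi)) 1 (-c) (by rw [← hc]; simp)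
      exact one_ne_zero this.1)
  refine ⟨w, ?_, fun i hi => ?_⟩
  · rw [real_inner_comm]
    exact Submodule.mem_orthogonal_singleton_iff_inner_right.1 hw
  · rw [real_inner_comm]
    exact hne ⟨i, hi⟩

theorem eventually_step_inner_eq (w₀ v : EuclideanSpace ℝ (Fin D)) (h : inner ℝ w₀ v ≠ 0) :
    ∀ᶠ w in nhds w₀, step (inner ℝ w v) = step (inner ℝ w₀ v) := by
  have hc : Continuous fun w : EuclideanSpace ℝ (Fin D) => inner ℝ w v := by fun_prop
  rcases h.lt_or_gt with h | h
  · filter_upwards [hc.continuousAt.eventually_lt_const h] with w hw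
    simp [step, hw.not_ge, h.not_ge]
  · filter_upwards [hc.continuousAt.eventually_const_lt h] with w hw
    simp [step, hw.le, h.le]

theorem exists_pos_forall_step_inner_eq {i₀ : Fin n} {w₀ : EuclideanSpace ℝ (Fin D)}
    (h : ∀ i, i ≠ i₀ → inner ℝ w₀ (v i) ≠ 0) :
    ∃ ε > 0, ∀ w ∈ Metric.ball w₀ ε, ∀ i, i ≠ i₀ →
      step (inner ℝ w (v i)) = step (inner ℝ w₀ (v i)) :=
  Metric.eventually_nhds_iff_ball.1 <| Filter.eventually_all.2 fun i => by
    by_cases hi : i = i₀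
    · simp [hi]
    · filter_upwards [eventually_step_inner_eq w₀ (v i) (h i hi)] with w hw _ using hw

theorem exists_pos_mem_ball_add_smul (w₀ x : EuclideanSpace ℝ (Fin D)) {ε : ℝ} (hε : 0 < ε) :
    ∃ h > (0 : ℝ), w₀ + h • x ∈ Metric.ball w₀ ε ∧ w₀ - h • x ∈ Metric.ball w₀ ε := by
  refine ⟨ε / (‖x‖ + 1), by positivity, ?_⟩
  have : ‖(ε / (‖x‖ + 1)) • x‖ < ε := by
    rw [norm_smul, Real.norm_of_nonneg (by positivity), div_mul_eq_mul_div, div_lt_iff₀ (by positivity)]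
    nlinarith
  simp [Metric.mem_ball, dist_eq_norm, this]

theorem derivGram_eq : derivGram v = Matrix.of fun i j =>
    ∫ w, inner ℝ (step (inner ℝ w (v i)) • v i) (step (inner ℝ w (v j)) • v j)
      ∂(stdGaussian (EuclideanSpace ℝ (Fin D))) := by
  ext i j
  simp only [derivGram, Matrix.of_apply]
  congr 1
  ext w
  simp only [Set.indicator, Set.mem_ofPred_eq, step, inner_smul_left, inner_smul_right]
  by_cases h1 : 0 ≤ inner ℝ w (v i) <;> by_cases h2 : 0 ≤ inner ℝ w (v j) <;> simp [h1, h2]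

/-- In a small ball around a point that lies on the hyperplane of `v i₀` alone, the linear relation
is compared on the two sides of that hyperplane. All terms but the one of `i₀` are constant in the
ball, so the difference is `x i₀ • v i₀`, which must vanish. -/
theorem posDef_derivGram (h0 : ∀ i, v i ≠ 0)
    (hv : ∀ i i', i ≠ i' → LinearIndependent ℝ ![v i, v i']) : (derivGram v).PosDef := by
  rw [derivGram_eq]
  have hmeas : ∀ i, Measurable fun w : EuclideanSpace ℝ (Fin D) => step (inner ℝ w (v i)) :=
    fun i => measurable_step.comp (measurable_inner_right _)
  refine posDef_integral_inner (fun i j => ?_) fun x hx => ?_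
  · refine Integrable.of_bound (C := ‖v i‖ * ‖v j‖) ?_ (Filter.Eventually.of_forall fun w => ?_)
    · simp_rw [inner_smul_left, inner_smul_right]
      exact ((hmeas i).mul ((hmeas j).mul_const _)).aestronglyMeasurable
    · refine (norm_inner_le_norm _ _).trans ?_
      rw [norm_smul, norm_smul, Real.norm_of_nonneg (step_nonneg _),
        Real.norm_of_nonneg (step_nonneg _)]
      exact mul_le_mul (mul_le_of_le_one_left (norm_nonneg _) (step_le_one _))
        (mul_le_of_le_one_left (norm_nonneg _) (step_le_one _))
        (mul_nonneg (step_nonneg _) (norm_nonneg _)) (norm_nonneg _)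
  · funext i₀
    obtain ⟨w₀, hw₀, hne⟩ := exists_inner_eq_zero_forall_inner_ne_zero hv i₀
    obtain ⟨ε, hε, hball⟩ := exists_pos_forall_step_inner_eq hne
    obtain ⟨h, hh, hp, hm⟩ := exists_pos_mem_ball_add_smul w₀ (v i₀) hε
    have hn : 0 < ‖v i₀‖ := norm_pos_iff.2 (h0 i₀)
    have hcont : Continuous fun w : EuclideanSpace ℝ (Fin D) => inner ℝ w (v i₀) := by fun_prop
    have hex : ∀ U : Set (EuclideanSpace ℝ (Fin D)), IsOpen U → U.Nonempty →
        ∃ w ∈ U, ∑ i, x i • step (inner ℝ w (v i)) • v i = 0 := by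
      intro U hU hUne
      by_contra! hcon
      exact hU.measure_ne_zero (stdGaussian (EuclideanSpace ℝ (Fin D))) hUne
        (measure_mono_null (fun w hw => hcon w hw) hx)
    obtain ⟨w₁, ⟨hw₁, hpos⟩, h1⟩ := hex (Metric.ball w₀ ε ∩ {w | 0 < inner ℝ w (v i₀)})
      (Metric.isOpen_ball.inter (isOpen_lt continuous_const hcont)) ⟨_, hp, by
        simp only [Set.mem_ofPred_eq, inner_add_left, hw₀, inner_smul_left, zero_add,
          real_inner_self_eq_norm_sq]
        exact mul_pos hh (by positivity)⟩
    obtain ⟨w₂, ⟨hw₂, hneg⟩, h2⟩ := hex (Metric.ball w₀ ε ∩ {w | inner ℝ w (v i₀) < 0})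
      (Metric.isOpen_ball.inter (isOpen_lt hcont continuous_const)) ⟨_, hm, by
        simp only [Set.mem_ofPred_eq, inner_sub_left, hw₀, inner_smul_left, zero_sub,
          real_inner_self_eq_norm_sq, Left.neg_neg_iff]
        exact mul_pos hh (by positivity)⟩
    have h3 : ∑ i, x i • step (inner ℝ w₁ (v i)) • v i -
        ∑ i, x i • step (inner ℝ w₂ (v i)) • v i = x i₀ • v i₀ := by
      rw [← Finset.sum_sub_distrib, Finset.sum_eq_single i₀]
      · simp only [Set.mem_ofPred_eq] at hpos hneg
        simp [step, hpos.le, hneg.not_ge]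
      · intro i _ hi
        rw [hball w₁ hw₁ i hi, hball w₂ hw₂ i hi, sub_self]
      · simp
    rw [h1, h2, sub_zero] at h3
    exact (smul_eq_zero.1 h3.symm).resolve_right (h0 i₀)

/-- By continuity the relation holds everywhere. Its second difference at `w₀` in direction `v i₀`
kills every term that is linear near `w₀` and retains only the kink of the term of `i₀`, which
contributes `h * ‖v i₀‖ ^ 2`. -/
theorem posDef_valueGram (h0 : ∀ i, v i ≠ 0)
    (hv : ∀ i i', i ≠ i' → LinearIndependent ℝ ![v i, v i']) : (valueGram v).PosDef := by
  have heq : valueGram v = Matrix.of fun i j =>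
      ∫ w, inner ℝ (relu (inner ℝ w (v i))) (relu (inner ℝ w (v j)))
        ∂(stdGaussian (EuclideanSpace ℝ (Fin D))) := by
    ext i j
    simp [valueGram, mul_comm]
  rw [heq]
  refine posDef_integral_inner (fun i j => ?_) fun x hx => ?_
  · simp only [RCLike.inner_apply, conj_trivial]
    exact (memLp_relu_inner_stdGaussian (v j) 2 (by simp)).integrable_mul
      (memLp_relu_inner_stdGaussian (v i) 2 (by simp))
  · have hcont : Continuous fun w : EuclideanSpace ℝ (Fin D) =>
        ∑ i, x i • relu (inner ℝ w (v i)) :=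
      continuous_finsetSum _ fun i _ => Continuous.fun_const_smul
        (lipschitzWith_relu.continuous.comp
          (by fun_prop : Continuous fun w : EuclideanSpace ℝ (Fin D) => inner ℝ w (v i))) _
    have hall := (Continuous.ae_eq_iff_eq (stdGaussian (EuclideanSpace ℝ (Fin D))) hcont
      continuous_const).1 hx
    have hall' : ∀ w : EuclideanSpace ℝ (Fin D), ∑ i, x i • relu (inner ℝ w (v i)) = 0 :=
      fun w => congrFun hall w
    funext i₀
    obtain ⟨w₀, hw₀, hne⟩ := exists_inner_eq_zero_forall_inner_ne_zero hv i₀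
    obtain ⟨ε, hε, hball⟩ := exists_pos_forall_step_inner_eq hne
    obtain ⟨h, hh, hp, hm⟩ := exists_pos_mem_ball_add_smul w₀ (v i₀) hε
    have hn : 0 < ‖v i₀‖ := norm_pos_iff.2 (h0 i₀)
    have h3 : ∑ i, x i • relu (inner ℝ (w₀ + h • v i₀) (v i)) +
        ∑ i, x i • relu (inner ℝ (w₀ - h • v i₀) (v i)) -
        2 * ∑ i, x i • relu (inner ℝ w₀ (v i)) = x i₀ * (h * ‖v i₀‖ ^ 2) := by
      rw [← Finset.sum_add_distrib, Finset.mul_sum, ← Finset.sum_sub_distrib,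
        Finset.sum_eq_single i₀]
      · have hpos : 0 < h * ‖v i₀‖ ^ 2 := by positivity
        rw [inner_add_left, inner_sub_left, hw₀, inner_smul_left, real_inner_self_eq_norm_sq]
        simp only [conj_trivial, zero_add, zero_sub]
        rw [relu_of_nonneg hpos.le, relu_of_nonpos (by linarith), relu_of_nonneg le_rfl]
        simp
      · intro i _ hi
        simp only [relu_eq_step_mul]
        rw [hball _ hp i hi, hball _ hm i hi, inner_add_left, inner_sub_left]
        simp only [smul_eq_mul]
        ring
      · simp
    rw [hall', hall', hall'] at h3
    have : x i₀ * (h * ‖v i₀‖ ^ 2) = 0 := by rw [← h3]; ring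
    exact (mul_eq_zero.1 this).resolve_right (by positivity)

end GramMatrix

/-! ### Subexponential and sub-Gaussian variables, and Bernstein's inequality. -/

section Concentration

open Real

variable {Ω : Type*} [MeasurableSpace Ω] {μ : Measure Ω}

/-- `X` is measurable and `exp (|X| / κ)` has expectation at most `2`. -/
structure IsSubexp (X : Ω → ℝ) (κ : ℝ) (μ : Measure Ω) : Prop where
  measurable : Measurable X
  integrable : Integrable (fun ω => exp (|X ω| / κ)) μ
  integral_le : ∫ ω, exp (|X ω| / κ) ∂μ ≤ 2

/-- `X` is measurable and `exp (X ^ 2 / c)` has expectation at most `2`. -/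
structure IsSqExp (X : Ω → ℝ) (c : ℝ) (μ : Measure Ω) : Prop where
  measurable : Measurable X
  integrable : Integrable (fun ω => exp (X ω ^ 2 / c)) μ
  integral_le : ∫ ω, exp (X ω ^ 2 / c) ∂μ ≤ 2

theorem exp_le_one_add_add_sq_mul_exp (x : ℝ) : exp x ≤ 1 + x + x ^ 2 * exp |x| := by
  have h1 : exp x - 1 ≤ x * exp x := by
    have h := add_one_le_exp (-x)
    have h2 : exp (-x) * exp x = 1 := by rw [← exp_add]; simp
    nlinarith [exp_pos x]
  have h2 := add_one_le_exp x
  rcases le_or_gt 0 x with hx | hx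
  · rw [abs_of_nonneg hx]
    nlinarith [mul_le_mul_of_nonneg_left h1 hx]
  · have h3 : 1 ≤ exp |x| := one_le_exp (abs_nonneg x)
    nlinarith [mul_nonneg (sq_nonneg x) (sub_nonneg.2 h3), mul_nonneg (neg_nonneg.2 hx.le) (sub_nonneg.2 h2)]

/-- The second-order remainder in the expansion of `exp (s * x)`. Of the available `exp (|x| / κ)`,
one square root absorbs the quadratic factor and the other the exponential factor. -/
theorem sq_mul_exp_le {x s κ : ℝ} (hκ : 0 < κ) (hs : |s| ≤ 1 / (2 * κ)) :
    (s * x) ^ 2 * exp |s * x| ≤ 8 * κ ^ 2 * s ^ 2 * exp (|x| / κ) := by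
  have h1 : |s * x| ≤ |x| / (2 * κ) := by
    rw [abs_mul, div_eq_mul_one_div, mul_comm]
    exact mul_le_mul_of_nonneg_left hs (abs_nonneg x)
  have h2 : (|x| / (2 * κ)) ^ 2 ≤ 2 * exp (|x| / (2 * κ)) := by
    have := quadratic_le_exp_of_nonneg (show 0 ≤ |x| / (2 * κ) by positivity)
    have h0 : 0 ≤ |x| / (2 * κ) := by positivity
    linarith
  have h3 : exp (|x| / κ) = exp (|x| / (2 * κ)) * exp (|x| / (2 * κ)) := by
    rw [← exp_add]; congr 1; field_simp; ring
  have h4 : (s * x) ^ 2 = 4 * κ ^ 2 * s ^ 2 * (|x| / (2 * κ)) ^ 2 := by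
    rw [div_pow, sq_abs]; field_simp; ring
  rw [h3, h4]
  calc 4 * κ ^ 2 * s ^ 2 * (|x| / (2 * κ)) ^ 2 * exp |s * x|
      ≤ 4 * κ ^ 2 * s ^ 2 * (2 * exp (|x| / (2 * κ))) * exp (|x| / (2 * κ)) := by gcongr
    _ = _ := by ring

theorem IsSubexp.integrable_self {X : Ω → ℝ} {κ : ℝ} (hκ : 0 < κ)
    (hX : IsSubexp X κ μ) : Integrable X μ := by
  refine (hX.integrable.const_mul κ).mono hX.measurable.aestronglyMeasurable
    (Filter.Eventually.of_forall fun ω => ?_)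
  rw [norm_eq_abs, norm_of_nonneg (by positivity)]
  have := add_one_le_exp (|X ω| / κ)
  calc |X ω| = κ * (|X ω| / κ) := by field_simp
    _ ≤ κ * exp (|X ω| / κ) := by gcongr; linarith

theorem IsSubexp.integrable_exp_mul {X : Ω → ℝ} {κ s : ℝ} (hκ : 0 < κ)
    (hX : IsSubexp X κ μ) (hs : |s| ≤ 1 / (2 * κ)) : Integrable (fun ω => exp (s * X ω)) μ := by
  refine hX.integrable.mono (hX.measurable.const_mul s).exp.aestronglyMeasurable
    (Filter.Eventually.of_forall fun ω => ?_)
  rw [norm_of_nonneg (exp_pos _).le, norm_of_nonneg (exp_pos _).le]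
  refine exp_le_exp.2 ((le_abs_self _).trans ?_)
  rw [abs_mul, div_eq_mul_one_div, mul_comm]
  refine mul_le_mul_of_nonneg_left (hs.trans ?_) (abs_nonneg _)
  gcongr
  linarith

/-- Expectation of `exp y ≤ 1 + y + y ^ 2 * exp |y|` at `y = s * X`, followed by `1 + t ≤ exp t`. -/
theorem IsSubexp.mgf_le {X : Ω → ℝ} {κ s : ℝ} [IsProbabilityMeasure μ] (hκ : 0 < κ)
    (hX : IsSubexp X κ μ) (hs : |s| ≤ 1 / (2 * κ)) :
    mgf X μ s ≤ exp (s * ∫ ω, X ω ∂μ + 16 * κ ^ 2 * s ^ 2) := by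
  have hint := hX.integrable_self hκ
  calc mgf X μ s ≤ ∫ ω, (1 + s * X ω + 8 * κ ^ 2 * s ^ 2 * exp (|X ω| / κ)) ∂μ := by
        refine integral_mono (hX.integrable_exp_mul hκ hs) ?_ fun ω => ?_
        · exact ((integrable_const _).add (hint.const_mul s)).add (hX.integrable.const_mul _)
        · have h1 := exp_le_one_add_add_sq_mul_exp (s * X ω)
          have h2 := sq_mul_exp_le (x := X ω) hκ hs
          dsimp only
          linarith
    _ = 1 + s * ∫ ω, X ω ∂μ + 8 * κ ^ 2 * s ^ 2 * ∫ ω, exp (|X ω| / κ) ∂μ := by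
        have h1 : Integrable (fun ω => 1 + s * X ω) μ := (integrable_const _).add (hint.const_mul s)
        rw [integral_add h1 (hX.integrable.const_mul _),
          integral_add (integrable_const _) (hint.const_mul s), integral_const_mul,
          integral_const_mul]
        simp
    _ ≤ 1 + s * ∫ ω, X ω ∂μ + 8 * κ ^ 2 * s ^ 2 * 2 := by
        gcongr
        exact hX.integral_le
    _ ≤ _ := by
        have := add_one_le_exp (s * ∫ ω, X ω ∂μ + 16 * κ ^ 2 * s ^ 2)
        linarith

theorem IsSubexp.neg {X : Ω → ℝ} {κ : ℝ} (hX : IsSubexp X κ μ) :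
    IsSubexp (fun ω => -X ω) κ μ :=
  ⟨hX.measurable.neg, by simpa using hX.integrable, by simpa using hX.integral_le⟩

/-- One-sided Bernstein inequality for the empirical mean of an i.i.d. sample. -/
theorem IsSubexp.measureReal_pi_le {m : ℕ} {X : Ω → ℝ} {κ ε : ℝ} [IsProbabilityMeasure μ]
    (hm : 0 < m) (hκ : 0 < κ) (hX : IsSubexp X κ μ) (hε : 0 ≤ ε) (hεκ : ε ≤ 16 * κ) :
    (Measure.pi fun _ : Fin m => μ).real
      {θ | ε ≤ (1 / (m : ℝ)) * ∑ r, X (θ r) - ∫ ω, X ω ∂μ} ≤ exp (-(m * ε ^ 2 / (64 * κ ^ 2))) := by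
  -- The minimizer of the Chernoff exponent `-s * ε + 16 * κ ^ 2 * s ^ 2`; the condition `ε ≤ 16 *
  -- κ` keeps it in the range where the moment generating function is controlled.
  set s := ε / (32 * κ ^ 2) with hs
  have hs0 : 0 ≤ s := by positivity
  have hsκ : |s| ≤ 1 / (2 * κ) := by
    rw [abs_of_nonneg hs0, hs, div_le_div_iff₀ (by positivity) (by positivity)]
    nlinarith
  have hm' : (0 : ℝ) < m := by exact_mod_cast hm
  set X' : Fin m → (Fin m → Ω) → ℝ := fun r θ => X (θ r) with hX'
  have hind : iIndepFun X' (Measure.pi fun _ : Fin m => μ) :=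
    iIndepFun_pi (X := fun _ => X) fun _ => hX.measurable.aemeasurable
  have hmeas : ∀ r, Measurable (X' r) := fun r => hX.measurable.comp (measurable_pi_apply r)
  have hpres : ∀ r : Fin m, MeasurePreserving (Function.eval r) (Measure.pi fun _ : Fin m => μ) μ :=
    fun r => measurePreserving_eval (fun _ => μ) r
  have hint : ∀ r, Integrable (fun θ => exp (s * X' r θ)) (Measure.pi fun _ : Fin m => μ) :=
    fun r => (hpres r).integrable_comp_of_integrable (hX.integrable_exp_mul hκ hsκ)
  have hmgf : ∀ r, mgf (X' r) (Measure.pi fun _ : Fin m => μ) s = mgf X μ s := fun r => by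
    have h1 : ∫ x, exp (s * X x) ∂((Measure.pi fun _ : Fin m => μ).map (Function.eval r)) =
        ∫ θ, exp (s * X (θ r)) ∂(Measure.pi fun _ : Fin m => μ) :=
      integral_map (hpres r).measurable.aemeasurable
        (hX.measurable.const_mul s).exp.aestronglyMeasurable
    rw [(hpres r).map_eq] at h1
    exact h1.symm
  have key := measure_ge_le_exp_mul_mgf (X := ∑ r, X' r) (m * (∫ ω, X ω ∂μ + ε)) hs0
    (hind.integrable_exp_mul_sum hmeas fun r _ => hint r)
  rw [hind.mgf_sum hmeas] at key
  simp only [hmgf, Finset.prod_const, Finset.card_univ, Fintype.card_fin] at key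
  have hset : {θ : Fin m → Ω | ε ≤ (1 / (m : ℝ)) * ∑ r, X (θ r) - ∫ ω, X ω ∂μ} =
      {θ | m * (∫ ω, X ω ∂μ + ε) ≤ (∑ r, X' r) θ} := by
    ext θ
    simp only [Set.mem_ofPred_eq, Finset.sum_apply, hX']
    rw [one_div, le_sub_iff_add_le, inv_mul_eq_div, le_div_iff₀ hm']
    constructor <;> intro h <;> linarith
  rw [hset]
  refine key.trans ?_
  calc exp (-s * (m * (∫ ω, X ω ∂μ + ε))) * mgf X μ s ^ m
      ≤ exp (-s * (m * (∫ ω, X ω ∂μ + ε))) *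
        exp (s * ∫ ω, X ω ∂μ + 16 * κ ^ 2 * s ^ 2) ^ m := by
        gcongr
        · exact mgf_nonneg
        · exact hX.mgf_le hκ hsκ
    _ = exp (-(m * ε ^ 2 / (64 * κ ^ 2))) := by
        rw [← exp_nat_mul, ← exp_add, hs]
        congr 1
        field_simp
        ring

/-- Two-sided Bernstein inequality for the empirical mean of an i.i.d. sample. -/
theorem IsSubexp.measure_pi_abs_le {m : ℕ} {X : Ω → ℝ} {κ ε : ℝ} [IsProbabilityMeasure μ]
    (hm : 0 < m) (hκ : 0 < κ) (hX : IsSubexp X κ μ) (hε : 0 ≤ ε) (hεκ : ε ≤ 16 * κ) :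
    (Measure.pi fun _ : Fin m => μ)
      {θ | ε ≤ |(1 / (m : ℝ)) * ∑ r, X (θ r) - ∫ ω, X ω ∂μ|} ≤
        ENNReal.ofReal (2 * exp (-(m * ε ^ 2 / (64 * κ ^ 2)))) := by
  have h1 := hX.measureReal_pi_le hm hκ hε hεκ
  have h2 := hX.neg.measureReal_pi_le hm hκ hε hεκ
  have hsub : {θ : Fin m → Ω | ε ≤ |(1 / (m : ℝ)) * ∑ r, X (θ r) - ∫ ω, X ω ∂μ|} ⊆
      {θ | ε ≤ (1 / (m : ℝ)) * ∑ r, X (θ r) - ∫ ω, X ω ∂μ} ∪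
      {θ | ε ≤ (1 / (m : ℝ)) * ∑ r, -X (θ r) - ∫ ω, -X ω ∂μ} := by
    intro θ hθ
    have hθ' : ε ≤ |(1 / (m : ℝ)) * ∑ r, X (θ r) - ∫ ω, X ω ∂μ| := hθ
    rcases le_abs.1 hθ' with h | h
    · exact Or.inl h
    · right
      simp only [Set.mem_ofPred_eq, Finset.sum_neg_distrib, integral_neg]
      linarith
  rw [← ofReal_measureReal]
  refine ENNReal.ofReal_le_ofReal ?_
  calc _ ≤ _ := measureReal_mono hsub
    _ ≤ _ := measureReal_union_le _ _
    _ ≤ _ := add_le_add h1 h2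
    _ = _ := by ring

theorem IsSqExp.measure_lt_sq_le {X : Ω → ℝ} {c t : ℝ} (hc : 0 < c) (hX : IsSqExp X c μ) :
    μ {ω | c * t < X ω ^ 2} ≤ ENNReal.ofReal (2 * exp (-t)) := by
  have h := mul_meas_ge_le_integral_of_nonneg (μ := μ)
    (f := fun ω => exp (X ω ^ 2 / c)) (Filter.Eventually.of_forall fun ω => (exp_pos _).le)
    hX.integrable (exp t)
  have hfin : μ {ω | exp t ≤ exp (X ω ^ 2 / c)} < ∞ := hX.integrable.measure_ge_lt_top (exp_pos t)
  calc μ {ω | c * t < X ω ^ 2} ≤ μ {ω | exp t ≤ exp (X ω ^ 2 / c)} := by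
        refine measure_mono fun ω hω => ?_
        simp only [Set.mem_ofPred_eq] at hω ⊢
        rw [exp_le_exp, le_div_iff₀ hc]
        linarith
    _ = ENNReal.ofReal (μ.real {ω | exp t ≤ exp (X ω ^ 2 / c)}) := (ofReal_measureReal hfin.ne).symm
    _ ≤ _ := by
        refine ENNReal.ofReal_le_ofReal ?_
        have h2 := h.trans hX.integral_le
        have h3 : exp (-t) * exp t = 1 := by rw [← exp_add]; simp
        calc μ.real {ω | exp t ≤ exp (X ω ^ 2 / c)}
            = exp (-t) * (exp t * μ.real {ω | exp t ≤ exp (X ω ^ 2 / c)}) := by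
              rw [← mul_assoc, h3, one_mul]
          _ ≤ exp (-t) * 2 := by gcongr
          _ = _ := mul_comm _ _

/-- A product of two sub-Gaussian variables is subexponential, without independence: the inequality
of arithmetic and geometric means is used once for `|X| * |Y|` and once for the exponentials. -/
theorem IsSqExp.isSubexp_of_abs_le {X Y Z : Ω → ℝ} {c K : ℝ} (hc : 0 < c) (hK : 0 < K)
    (hX : IsSqExp X c μ) (hY : IsSqExp Y c μ) (hZ : Measurable Z)
    (h : ∀ ω, |Z ω| ≤ K * (|X ω| * |Y ω|)) : IsSubexp Z (K * c) μ := by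
  have hle : ∀ ω, exp (|Z ω| / (K * c)) ≤ (exp (X ω ^ 2 / c) + exp (Y ω ^ 2 / c)) / 2 := by
    intro ω
    have h1 : |Z ω| / (K * c) ≤ X ω ^ 2 / (2 * c) + Y ω ^ 2 / (2 * c) := by
      rw [← add_div, div_le_div_iff₀ (by positivity) (by positivity)]
      have h2 : 2 * (|X ω| * |Y ω|) ≤ X ω ^ 2 + Y ω ^ 2 := by
        rw [← sq_abs (X ω), ← sq_abs (Y ω)]
        nlinarith [sq_nonneg (|X ω| - |Y ω|)]
      calc |Z ω| * (2 * c) ≤ K * (|X ω| * |Y ω|) * (2 * c) := by gcongr; exact h ω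
        _ = 2 * (|X ω| * |Y ω|) * (K * c) := by ring
        _ ≤ _ := by gcongr
    have h3 : exp (X ω ^ 2 / c) = exp (X ω ^ 2 / (2 * c)) ^ 2 := by
      rw [← exp_nat_mul]; congr 1; push_cast; field_simp
    have h4 : exp (Y ω ^ 2 / c) = exp (Y ω ^ 2 / (2 * c)) ^ 2 := by
      rw [← exp_nat_mul]; congr 1; push_cast; field_simp
    rw [h3, h4]
    calc _ ≤ exp (X ω ^ 2 / (2 * c) + Y ω ^ 2 / (2 * c)) := exp_le_exp.2 h1
      _ = exp (X ω ^ 2 / (2 * c)) * exp (Y ω ^ 2 / (2 * c)) := exp_add _ _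
      _ ≤ _ := by nlinarith [sq_nonneg (exp (X ω ^ 2 / (2 * c)) - exp (Y ω ^ 2 / (2 * c)))]
  have hint : Integrable (fun ω => (exp (X ω ^ 2 / c) + exp (Y ω ^ 2 / c)) / 2) μ :=
    (hX.integrable.add hY.integrable).div_const 2
  have hint' : Integrable (fun ω => exp (|Z ω| / (K * c))) μ := by
    refine hint.mono ?_ (Filter.Eventually.of_forall fun ω => ?_)
    · have : Measurable fun ω => |Z ω| := continuous_abs.measurable.comp hZ
      exact (this.div_const _).exp.aestronglyMeasurable
    · rw [norm_of_nonneg (exp_pos _).le, norm_of_nonneg (by positivity)]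
      exact hle ω
  refine ⟨hZ, hint', (integral_mono hint' hint hle).trans ?_⟩
  rw [integral_div, integral_add hX.integrable hY.integrable]
  have := hX.integral_le
  have := hY.integral_le
  linarith

theorem isSubexp_of_abs_le_one [IsProbabilityMeasure μ] {X : Ω → ℝ} {κ : ℝ} (hκ : 4 ≤ κ)
    (hX : Measurable X) (h : ∀ ω, |X ω| ≤ 1) : IsSubexp X κ μ := by
  have hle : ∀ ω, exp (|X ω| / κ) ≤ 2 := by
    intro ω
    have h1 : |X ω| / κ ≤ 1 / 4 := by
      rw [div_le_div_iff₀ (by linarith) (by norm_num)]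
      have := h ω
      linarith
    calc exp (|X ω| / κ) ≤ exp (1 / 4) := exp_le_exp.2 h1
      _ ≤ 2 := by
        have h4 : exp (1 / 4) ^ 4 = exp 1 := by rw [← exp_nat_mul]; norm_num
        have h5 := exp_one_lt_d9
        by_contra! hcon
        have : (2 : ℝ) ^ 4 < exp (1 / 4) ^ 4 := by gcongr
        norm_num at this
        linarith
  have hint : Integrable (fun ω => exp (|X ω| / κ)) μ := by
    refine Integrable.of_bound (C := 2) ?_ (Filter.Eventually.of_forall fun ω => ?_)
    · have : Measurable fun ω => |X ω| := continuous_abs.measurable.comp hX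
      exact (this.div_const _).exp.aestronglyMeasurable
    · rw [norm_of_nonneg (exp_pos _).le]
      exact hle ω
  refine ⟨hX, hint, ?_⟩
  calc _ ≤ ∫ _, (2 : ℝ) ∂μ := integral_mono hint (integrable_const _) hle
    _ = 2 := by simp

/-- The exact value is `√2`. -/
theorem lintegral_exp_sq_gaussianReal_le :
    ∫⁻ x, ENNReal.ofReal (exp (x ^ 2 / 4)) ∂(gaussianReal 0 1) ≤ 2 := by
  have hpdf : ∀ x : ℝ, gaussianPDFReal 0 1 x • exp (x ^ 2 / 4) =
      (√(2 * π))⁻¹ * exp (-(1 / 4) * x ^ 2) := by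
    intro x
    rw [gaussianPDFReal, smul_eq_mul, mul_assoc, ← exp_add]
    congr 2
    · simp
    · push_cast; ring
  have hI : Integrable (fun x : ℝ => (√(2 * π))⁻¹ * exp (-(1 / 4) * x ^ 2)) :=
    (integrable_exp_neg_mul_sq (by norm_num)).const_mul _
  rw [gaussianReal_of_var_ne_zero _ one_ne_zero,
    lintegral_withDensity_eq_lintegral_mul _ (measurable_gaussianPDF 0 1) (by fun_prop)]
  have : ∀ x : ℝ, (gaussianPDF 0 1 * fun x => ENNReal.ofReal (exp (x ^ 2 / 4))) x =
      ENNReal.ofReal ((√(2 * π))⁻¹ * exp (-(1 / 4) * x ^ 2)) := by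
    intro x
    rw [← hpdf, Pi.mul_apply, gaussianPDF, ← ENNReal.ofReal_mul (gaussianPDFReal_nonneg _ _ _),
      smul_eq_mul]
  simp_rw [this]
  rw [← ofReal_integral_eq_lintegral_ofReal hI
    (Filter.Eventually.of_forall fun x => by positivity), integral_const_mul, integral_gaussian]
  rw [show (2 : ℝ≥0∞) = ENNReal.ofReal 2 by simp]
  refine ENNReal.ofReal_le_ofReal ?_
  rw [← div_eq_inv_mul, ← sqrt_div (by positivity)]
  refine sqrt_le_iff.2 ⟨by norm_num, ?_⟩
  rw [div_le_iff₀ (by positivity)]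
  have := pi_pos
  rw [div_le_iff₀ (by norm_num)]
  linarith

/-- The square in the exponent is linearized by an auxiliary Gaussian `ξ`: `exp (x ^ 2 / (4 * C))`
is the expectation of `exp (x * ξ / √(2 * C))`. After Tonelli the sub-Gaussian bound applies to `X`
for fixed `ξ` and leaves `exp (ξ ^ 2 / 4)`. Working with `lintegral` gives integrability at the same
time. -/
theorem isSqExp_of_hasSubgaussianMGF [SFinite μ] {X : Ω → ℝ} {c : NNReal} (hm : Measurable X)
    (hX : HasSubgaussianMGF X c μ) {C : ℝ} (hC : 0 < C) (hcC : c ≤ C) :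
    IsSqExp X (4 * C) μ := by
  have hgauss : ∀ x : ℝ, ENNReal.ofReal (exp (x ^ 2 / (4 * C))) =
      ∫⁻ ξ, ENNReal.ofReal (exp (x / √(2 * C) * ξ)) ∂(gaussianReal 0 1) := by
    intro x
    rw [← ofReal_integral_eq_lintegral_ofReal (integrable_exp_mul_gaussianReal _)
      (Filter.Eventually.of_forall fun ξ => (exp_pos _).le)]
    congr 1
    have := mgf_gaussianReal (p := gaussianReal 0 1) (X := id) Measure.map_id (x / √(2 * C))
    simp only [mgf, id] at this
    rw [this, div_pow, sq_sqrt (by positivity)]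
    congr 1
    push_cast
    field_simp
    ring
  have hlint : ∫⁻ ω, ENNReal.ofReal (exp (X ω ^ 2 / (4 * C))) ∂μ ≤ 2 := by
    simp_rw [hgauss]
    rw [lintegral_lintegral_swap (by fun_prop)]
    refine (lintegral_mono fun ξ => ?_).trans lintegral_exp_sq_gaussianReal_le
    have h1 : ∀ ω, exp (X ω / √(2 * C) * ξ) = exp (ξ / √(2 * C) * X ω) := fun ω => by
      congr 1; ring
    simp_rw [h1]
    rw [← ofReal_integral_eq_lintegral_ofReal (hX.integrable_exp_mul _)
      (Filter.Eventually.of_forall fun ω => (exp_pos _).le)]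
    refine ENNReal.ofReal_le_ofReal ((hX.mgf_le _).trans (exp_le_exp.2 ?_))
    rw [div_pow, sq_sqrt (by positivity)]
    calc (c : ℝ) * (ξ ^ 2 / (2 * C)) / 2 ≤ C * (ξ ^ 2 / (2 * C)) / 2 := by gcongr
      _ = ξ ^ 2 / 4 := by field_simp; ring
  have hint : Integrable (fun ω => exp (X ω ^ 2 / (4 * C))) μ := by
    refine ⟨((hm.pow_const 2).div_const _).exp.aestronglyMeasurable, ?_⟩
    rw [hasFiniteIntegral_iff_ofReal (Filter.Eventually.of_forall fun ω => (exp_pos _).le)]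
    exact hlint.trans_lt (by simp)
  refine ⟨hm, hint, ?_⟩
  rw [integral_eq_lintegral_of_nonneg_ae (Filter.Eventually.of_forall fun ω => (exp_pos _).le)
    hint.aestronglyMeasurable]
  exact ENNReal.toReal_le_of_le_ofReal (by norm_num) (by simpa using hlint)

theorem IsSqExp.comp {Ω' : Type*} [MeasurableSpace Ω'] {μ' : Measure Ω'} {f : Ω' → Ω}
    (hf : MeasurePreserving f μ' μ) {X : Ω → ℝ} {c : ℝ} (hX : IsSqExp X c μ) :
    IsSqExp (fun ω => X (f ω)) c μ' := by
  refine ⟨hX.measurable.comp hf.measurable, hf.integrable_comp_of_integrable hX.integrable, ?_⟩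
  have h := integral_map (μ := μ') hf.measurable.aemeasurable
    (f := fun ω => exp (X ω ^ 2 / c)) (by rw [hf.map_eq]; exact hX.integrable.aestronglyMeasurable)
  rw [hf.map_eq] at h
  rw [← h]
  exact hX.integral_le

theorem IsSqExp.mono_abs {X Y : Ω → ℝ} {c : ℝ} (hc : 0 < c) (hX : IsSqExp X c μ)
    (hY : Measurable Y) (h : ∀ ω, |Y ω| ≤ |X ω|) : IsSqExp Y c μ := by
  have hle : ∀ ω, exp (Y ω ^ 2 / c) ≤ exp (X ω ^ 2 / c) := fun ω => by
    gcongr 1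
    exact div_le_div_of_nonneg_right (sq_le_sq.2 (h ω)) hc.le
  have hint : Integrable (fun ω => exp (Y ω ^ 2 / c)) μ := by
    refine hX.integrable.mono ((hY.pow_const 2).div_const _).exp.aestronglyMeasurable
      (Filter.Eventually.of_forall fun ω => ?_)
    rw [norm_of_nonneg (exp_pos _).le, norm_of_nonneg (exp_pos _).le]
    exact hle ω
  exact ⟨hY, hint, (integral_mono hint hX.integrable hle).trans hX.integral_le⟩

end Concentration

/-! ### The law of one neuron: sub-Gaussian features, their moments, and anticoncentration. -/

section NeuronLaw

open Real

variable {p d q D : ℕ}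

instance isProbabilityMeasure_rademacher : IsProbabilityMeasure rademacher := by
  refine ⟨?_⟩
  simp only [rademacher, Measure.coe_add, Measure.coe_smul, Pi.add_apply, Pi.smul_apply,
    measure_univ, smul_eq_mul, mul_one]
  exact ENNReal.add_halves 1

theorem integral_rademacher (f : ℝ → ℝ) : ∫ x, f x ∂rademacher = (f (-1) + f 1) / 2 := by
  have hi : ∀ x : ℝ, Integrable f ((1 / 2 : ℝ≥0∞) • Measure.dirac x) := fun x =>
    (integrable_dirac (by simp)).smul_measure (by simp)
  rw [rademacher, integral_add_measure (hi _) (hi _), integral_smul_measure,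
    integral_smul_measure, integral_dirac, integral_dirac]
  simp
  ring

theorem ae_rademacher_sq : ∀ᵐ x ∂rademacher, x ^ 2 = 1 := by
  rw [rademacher, ae_add_measure_iff]
  have hm : MeasurableSet {x : ℝ | x ^ 2 = 1} := measurableSet_eq_fun (by fun_prop) (by fun_prop)
  exact ⟨Measure.ae_smul_measure ((ae_dirac_iff hm).2 (by norm_num)) _,
    Measure.ae_smul_measure ((ae_dirac_iff hm).2 (by norm_num)) _⟩

theorem map_inner_stdGaussian (v : EuclideanSpace ℝ (Fin D)) :
    (stdGaussian (EuclideanSpace ℝ (Fin D))).map (fun w => inner ℝ w v) =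
      gaussianReal 0 (‖v‖ ^ 2).toNNReal := by
  have h := IsGaussian.map_eq_gaussianReal (μ := stdGaussian (EuclideanSpace ℝ (Fin D)))
    (innerSL ℝ v)
  rw [variance_dual_stdGaussian, innerSL_apply_norm] at h
  rw [integral_strongDual_stdGaussian] at h
  rw [← h]
  congr 1
  ext w
  exact real_inner_comm _ _

theorem integrable_exp_mul_inner (v : EuclideanSpace ℝ (Fin D)) (t : ℝ) :
    Integrable (fun w => exp (t * inner ℝ w v)) (stdGaussian (EuclideanSpace ℝ (Fin D))) := by
  have h := integrable_exp_mul_gaussianReal (μ := 0) (v := (‖v‖ ^ 2).toNNReal) t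
  rw [← map_inner_stdGaussian] at h
  exact (integrable_map_measure (by fun_prop) (measurable_inner_right v).aemeasurable).1 h

theorem mgf_inner_stdGaussian (v : EuclideanSpace ℝ (Fin D)) (t : ℝ) :
    mgf (fun w => inner ℝ w v) (stdGaussian (EuclideanSpace ℝ (Fin D))) t =
      exp (‖v‖ ^ 2 * t ^ 2 / 2) := by
  rw [mgf_gaussianReal (map_inner_stdGaussian v)]
  simp

theorem hasSubgaussianMGF_inner (v : EuclideanSpace ℝ (Fin D)) :
    HasSubgaussianMGF (fun w => inner ℝ w v) (‖v‖ ^ 2).toNNReal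
      (stdGaussian (EuclideanSpace ℝ (Fin D))) := by
  refine ⟨integrable_exp_mul_inner v, fun t => ?_⟩
  rw [mgf_inner_stdGaussian, coe_toNNReal _ (by positivity)]

theorem measurable_mul_relu_inner (v : EuclideanSpace ℝ (Fin D)) :
    Measurable fun x : EuclideanSpace ℝ (Fin D) × ℝ => x.2 * relu (inner ℝ x.1 v) :=
  measurable_snd.mul (measurable_relu.comp ((measurable_inner_right v).comp measurable_fst))

/-- Averaging over the random sign turns the exponential into `cosh (t * relu x)`, which is at most
`cosh (t * x)` since `relu x ≤ |x|`. The signed ReLU is thus no worse than the Gaussian `⟪w, v⟫`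
itself. -/
theorem hasSubgaussianMGF_mul_relu_inner (v : EuclideanSpace ℝ (Fin D)) :
    HasSubgaussianMGF (fun x : EuclideanSpace ℝ (Fin D) × ℝ => x.2 * relu (inner ℝ x.1 v))
      (‖v‖ ^ 2).toNNReal ((stdGaussian (EuclideanSpace ℝ (Fin D))).prod rademacher) := by
  have hdom : ∀ t : ℝ, Integrable (fun w => (exp (-t * inner ℝ w v) + exp (t * inner ℝ w v)) / 2)
      (stdGaussian (EuclideanSpace ℝ (Fin D))) := fun t =>
    ((integrable_exp_mul_inner v (-t)).add (integrable_exp_mul_inner v t)).div_const 2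
  have hcosh : ∀ t x : ℝ, (exp (-t * x) + exp (t * x)) / 2 = cosh (t * x) := fun t x => by
    rw [cosh_eq, neg_mul, add_comm]
  have hint : ∀ t : ℝ, Integrable
      (fun x : EuclideanSpace ℝ (Fin D) × ℝ => exp (t * (x.2 * relu (inner ℝ x.1 v))))
      ((stdGaussian (EuclideanSpace ℝ (Fin D))).prod rademacher) := by
    intro t
    refine (((hdom t).comp_fst rademacher).const_mul 2).mono
      ((measurable_mul_relu_inner v).const_mul t).exp.aestronglyMeasurable ?_
    filter_upwards [Measure.quasiMeasurePreserving_snd.ae ae_rademacher_sq] with x hx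
    have hx' : |x.2| = 1 := (sq_eq_sq₀ (abs_nonneg _) zero_le_one).1 (by rw [sq_abs, hx, one_pow])
    rw [norm_of_nonneg (exp_pos _).le, norm_of_nonneg (by positivity), hcosh, ← cosh_abs]
    calc exp (t * (x.2 * relu (inner ℝ x.1 v))) ≤ exp |t * inner ℝ x.1 v| := by
          refine exp_le_exp.2 ((le_abs_self _).trans ?_)
          rw [abs_mul, abs_mul, abs_mul, hx', one_mul, abs_of_nonneg (relu_nonneg _)]
          gcongr
          exact relu_le_abs _
      _ ≤ 2 * cosh |t * inner ℝ x.1 v| := by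
          rw [cosh_eq]
          have := exp_pos (-|t * inner ℝ x.1 v|)
          linarith
  refine ⟨hint, fun t => ?_⟩
  rw [mgf, integral_prod _ (hint t)]
  simp_rw [integral_rademacher]
  rw [coe_toNNReal _ (by positivity)]
  have hle : ∀ w : EuclideanSpace ℝ (Fin D), (exp (t * (-1 * relu (inner ℝ w v))) +
      exp (t * (1 * relu (inner ℝ w v)))) / 2 ≤
      (exp (-t * inner ℝ w v) + exp (t * inner ℝ w v)) / 2 := by
    intro w
    have h1 : (exp (t * (-1 * relu (inner ℝ w v))) + exp (t * (1 * relu (inner ℝ w v)))) / 2 =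
        cosh (t * relu (inner ℝ w v)) := by
      rw [← hcosh]; simp
    rw [h1, hcosh, cosh_le_cosh, abs_mul, abs_mul, abs_of_nonneg (relu_nonneg _)]
    gcongr
    exact relu_le_abs _
  have hm : Measurable fun w : EuclideanSpace ℝ (Fin D) => relu (inner ℝ w v) :=
    measurable_relu.comp (measurable_inner_right v)
  calc _ ≤ ∫ w, (exp (-t * inner ℝ w v) + exp (t * inner ℝ w v)) / 2
        ∂(stdGaussian (EuclideanSpace ℝ (Fin D))) := by
        refine integral_mono_of_nonneg (Filter.Eventually.of_forall fun w => by positivity)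
          (hdom t) (Filter.Eventually.of_forall hle)
    _ = _ := by
        have h1 := mgf_inner_stdGaussian v (-t)
        have h2 := mgf_inner_stdGaussian v t
        simp only [mgf] at h1 h2
        rw [integral_div, integral_add (integrable_exp_mul_inner v (-t))
          (integrable_exp_mul_inner v t), h1, h2]
        simp

/-- The parameters of one neuron of the operator: a trunk weight, the weights of a branch, and the
output weights of that branch. -/
abbrev Neuron (p d q : ℕ) : Type :=
  EuclideanSpace ℝ (Fin d) × (Fin p → EuclideanSpace ℝ (Fin q)) × (Fin p → ℝ)

/-- The law of the parameters of one neuron at initialization. -/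
def neuronLaw (p d q : ℕ) : Measure (Neuron p d q) :=
  (stdGaussian (EuclideanSpace ℝ (Fin d))).prod
    ((Measure.pi fun _ => stdGaussian (EuclideanSpace ℝ (Fin q))).prod
      (Measure.pi fun _ => rademacher))

instance isProbabilityMeasure_neuronLaw : IsProbabilityMeasure (neuronLaw p d q) := by
  unfold neuronLaw; infer_instance

/-- The feature of a branch with weights `x.1` and output weights `x.2`. -/
def feature (x : (Fin p → EuclideanSpace ℝ (Fin q)) × (Fin p → ℝ))
    (v : EuclideanSpace ℝ (Fin q)) : ℝ :=
  (1 / √(p : ℝ)) * ∑ k, x.2 k * relu (inner ℝ (x.1 k) v)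

theorem measurable_feature (v : EuclideanSpace ℝ (Fin q)) :
    Measurable fun x : (Fin p → EuclideanSpace ℝ (Fin q)) × (Fin p → ℝ) => feature x v := by
  refine Measurable.const_mul (Finset.measurable_sum _ fun k _ => ?_) _
  exact ((measurable_pi_apply k).comp measurable_snd).mul (measurable_relu.comp
    ((measurable_inner_right v).comp ((measurable_pi_apply k).comp measurable_fst)))

theorem isSqExp_inner {v : EuclideanSpace ℝ (Fin D)} {B : ℝ} (hB : 0 < B) (hv : ‖v‖ ≤ B) :
    IsSqExp (fun w => inner ℝ w v) (4 * B ^ 2) (stdGaussian (EuclideanSpace ℝ (Fin D))) :=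
  isSqExp_of_hasSubgaussianMGF (measurable_inner_right v) (hasSubgaussianMGF_inner v)
    (by positivity) (by rw [coe_toNNReal _ (by positivity)]; gcongr)

/-- The variance proxies of `p` independent terms add up, and the factor `1 / √p` cancels the sum
exactly. The constant is free of `p`, which is why the inner width needs no lower bound beyond `0 <
p`. -/
theorem isSqExp_feature (hp : 0 < p) {v : EuclideanSpace ℝ (Fin q)} {B : ℝ} (hB : 0 < B)
    (hv : ‖v‖ ≤ B) :
    IsSqExp (fun x : (Fin p → EuclideanSpace ℝ (Fin q)) × (Fin p → ℝ) => feature x v) (4 * B ^ 2)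
      ((Measure.pi fun _ => stdGaussian (EuclideanSpace ℝ (Fin q))).prod
        (Measure.pi fun _ => rademacher)) := by
  set P := (stdGaussian (EuclideanSpace ℝ (Fin q))).prod rademacher
  have hsingle : ∀ k : Fin p, HasSubgaussianMGF
      (fun x : Fin p → EuclideanSpace ℝ (Fin q) × ℝ => (x k).2 * relu (inner ℝ (x k).1 v))
      (‖v‖ ^ 2).toNNReal (Measure.pi fun _ => P) := fun k => by
    have h := hasSubgaussianMGF_mul_relu_inner v
    have hev := (measurePreserving_eval (fun _ : Fin p => P) k)
    change HasSubgaussianMGF _ _ P at h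
    rw [← hev.map_eq] at h
    exact h.of_map hev.measurable.aemeasurable
  have hind : iIndepFun (fun (k : Fin p) (x : Fin p → EuclideanSpace ℝ (Fin q) × ℝ) =>
      (x k).2 * relu (inner ℝ (x k).1 v)) (Measure.pi fun _ => P) :=
    iIndepFun_pi
      (X := fun _ (x : EuclideanSpace ℝ (Fin q) × ℝ) => x.2 * relu (inner ℝ x.1 v))
      fun _ => (measurable_mul_relu_inner v).aemeasurable
  have hsum := (HasSubgaussianMGF.sum_of_iIndepFun (s := Finset.univ) hind
    fun k _ => hsingle k).const_mul (1 / √(p : ℝ))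
  have hsq := isSqExp_of_hasSubgaussianMGF (C := B ^ 2) (by
    refine Measurable.const_mul (Finset.measurable_sum _ fun k _ => ?_) _
    exact (measurable_mul_relu_inner v).comp (measurable_pi_apply k)) hsum (by positivity) (by
      change (1 / √(p : ℝ)) ^ 2 * ((∑ _k : Fin p, (‖v‖ ^ 2).toNNReal : NNReal) : ℝ) ≤ B ^ 2
      simp only [Finset.sum_const, Finset.card_univ, Fintype.card_fin, NNReal.coe_mul,
        nsmul_eq_mul, NNReal.coe_natCast]
      rw [coe_toNNReal _ (by positivity), div_pow, one_pow, sq_sqrt (by positivity)]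
      have : (0 : ℝ) < p := by exact_mod_cast hp
      rw [← mul_assoc, one_div_mul_cancel this.ne', one_mul]
      gcongr)
  exact hsq.comp (measurePreserving_arrowProdEquivProdArrow (EuclideanSpace ℝ (Fin q)) ℝ (Fin p)
    (fun _ => stdGaussian (EuclideanSpace ℝ (Fin q))) (fun _ => rademacher)).symm

theorem integrable_pi_comp_eval {Ω : Type*} [MeasurableSpace Ω] {μ : Measure Ω}
    [IsProbabilityMeasure μ] {f : Ω → ℝ} (hf : Integrable f μ) (k : Fin p) :
    Integrable (fun x : Fin p → Ω => f (x k)) (Measure.pi fun _ => μ) :=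
  (measurePreserving_eval (fun _ : Fin p => μ) k).integrable_comp_of_integrable hf

theorem ae_pi_rademacher_sq : ∀ᵐ a ∂(Measure.pi fun _ : Fin p => rademacher), ∀ k, a k ^ 2 = 1 :=
  ae_all_iff.2 fun k =>
    (Measure.quasiMeasurePreserving_eval (fun _ : Fin p => rademacher) k).ae ae_rademacher_sq

theorem memLp_pi_rademacher (k : Fin p) :
    MemLp (fun a : Fin p → ℝ => a k) 2 (Measure.pi fun _ : Fin p => rademacher) := by
  refine MemLp.of_bound (measurable_pi_apply k).aestronglyMeasurable 1 ?_
  filter_upwards [ae_pi_rademacher_sq] with a ha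
  rw [norm_eq_abs]
  exact ((sq_eq_sq₀ (abs_nonneg _) zero_le_one).1 (by rw [sq_abs, ha k, one_pow])).le

theorem integral_pi_rademacher (k : Fin p) :
    ∫ a, a k ∂(Measure.pi fun _ : Fin p => rademacher) = 0 := by
  have h := integral_comp_eval (μ := fun _ : Fin p => rademacher) (i := k) (f := fun x : ℝ => x)
    aestronglyMeasurable_id
  rw [h, integral_rademacher]
  norm_num

theorem integral_pi_rademacher_mul (k l : Fin p) :
    ∫ a, a k * a l ∂(Measure.pi fun _ : Fin p => rademacher) = if k = l then 1 else 0 := by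
  split_ifs with h
  · subst h
    have : (fun a : Fin p → ℝ => a k * a k) =ᵐ[Measure.pi fun _ : Fin p => rademacher]
        fun _ => 1 := by
      filter_upwards [ae_pi_rademacher_sq] with a ha
      rw [← pow_two, ha k]
    rw [integral_congr_ae this]
    simp
  · have hind : iIndepFun (fun (k : Fin p) (a : Fin p → ℝ) => a k)
        (Measure.pi fun _ : Fin p => rademacher) :=
      iIndepFun_pi (X := fun _ x => x) fun _ => aemeasurable_id
    have := (hind.indepFun h).integral_mul_eq_mul_integral
      (measurable_pi_apply k).aestronglyMeasurable (measurable_pi_apply l).aestronglyMeasurable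
    simp only [Pi.mul_apply] at this
    rw [this, integral_pi_rademacher, zero_mul]

theorem memLp_relu_inner_pi (k : Fin p) (v : EuclideanSpace ℝ (Fin q)) :
    MemLp (fun x : Fin p → EuclideanSpace ℝ (Fin q) => relu (inner ℝ (x k) v)) 2
      (Measure.pi fun _ : Fin p => stdGaussian (EuclideanSpace ℝ (Fin q))) :=
  (memLp_relu_inner_stdGaussian v 2 (by simp)).comp_measurePreserving
    (measurePreserving_eval (fun _ : Fin p => stdGaussian (EuclideanSpace ℝ (Fin q))) k)

/-- The signs are centred, independent and of square one, so only the diagonal terms `k = l`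
survive; each equals the value on the right. -/
theorem integral_feature_mul_feature (hp : 0 < p) (v v' : EuclideanSpace ℝ (Fin q)) :
    ∫ x, feature x v * feature x v'
      ∂((Measure.pi fun _ : Fin p => stdGaussian (EuclideanSpace ℝ (Fin q))).prod
        (Measure.pi fun _ => rademacher)) =
      ∫ w, relu (inner ℝ w v) * relu (inner ℝ w v')
        ∂(stdGaussian (EuclideanSpace ℝ (Fin q))) := by
  have hp' : (0 : ℝ) < p := by exact_mod_cast hp
  have hexp : ∀ x : (Fin p → EuclideanSpace ℝ (Fin q)) × (Fin p → ℝ),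
      feature x v * feature x v' = (1 / (p : ℝ)) * ∑ k, ∑ l,
        (relu (inner ℝ (x.1 k) v) * relu (inner ℝ (x.1 l) v')) * (x.2 k * x.2 l) := by
    intro x
    have h1 : (1 / (p : ℝ)) = (1 / √(p : ℝ)) * (1 / √(p : ℝ)) := by
      rw [← pow_two, div_pow, sq_sqrt hp'.le, one_pow]
    rw [feature, feature, mul_mul_mul_comm, ← h1, Finset.sum_mul_sum]
    congr 1
    exact Finset.sum_congr rfl fun k _ => Finset.sum_congr rfl fun l _ => by ring
  have hint : ∀ k l : Fin p, Integrable
      (fun x : (Fin p → EuclideanSpace ℝ (Fin q)) × (Fin p → ℝ) =>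
        (relu (inner ℝ (x.1 k) v) * relu (inner ℝ (x.1 l) v')) * (x.2 k * x.2 l))
      ((Measure.pi fun _ : Fin p => stdGaussian (EuclideanSpace ℝ (Fin q))).prod
        (Measure.pi fun _ => rademacher)) := fun k l =>
    ((memLp_relu_inner_pi k v).integrable_mul (memLp_relu_inner_pi l v')).mul_prod
      ((memLp_pi_rademacher k).integrable_mul (memLp_pi_rademacher l))
  simp_rw [hexp]
  rw [integral_const_mul, integral_finsetSum _ fun k _ => integrable_finsetSum _ fun l _ => hint k l]
  have hk : ∀ k : Fin p, ∫ x, ∑ l,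
      (relu (inner ℝ (x.1 k) v) * relu (inner ℝ (x.1 l) v')) * (x.2 k * x.2 l)
      ∂((Measure.pi fun _ : Fin p => stdGaussian (EuclideanSpace ℝ (Fin q))).prod
        (Measure.pi fun _ => rademacher)) =
      ∫ w, relu (inner ℝ w v) * relu (inner ℝ w v')
        ∂(stdGaussian (EuclideanSpace ℝ (Fin q))) := by
    intro k
    rw [integral_finsetSum _ fun l _ => hint k l]
    have h2 : ∀ l, ∫ x, (relu (inner ℝ (x.1 k) v) * relu (inner ℝ (x.1 l) v')) * (x.2 k * x.2 l)
        ∂((Measure.pi fun _ : Fin p => stdGaussian (EuclideanSpace ℝ (Fin q))).prod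
        (Measure.pi fun _ => rademacher)) =
        (∫ x, relu (inner ℝ (x k) v) * relu (inner ℝ (x l) v')
          ∂(Measure.pi fun _ : Fin p => stdGaussian (EuclideanSpace ℝ (Fin q)))) *
          if k = l then 1 else 0 := fun l => by
      rw [← integral_pi_rademacher_mul k l]
      exact integral_prod_mul
        (fun x : Fin p → EuclideanSpace ℝ (Fin q) =>
          relu (inner ℝ (x k) v) * relu (inner ℝ (x l) v')) (fun a : Fin p → ℝ => a k * a l)
    simp only [h2, mul_ite, mul_one, mul_zero, Finset.sum_ite_eq, Finset.mem_univ, if_true]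
    exact integral_comp_eval (μ := fun _ : Fin p => stdGaussian (EuclideanSpace ℝ (Fin q)))
      (i := k) (f := fun w => relu (inner ℝ w v) * relu (inner ℝ w v'))
      ((memLp_relu_inner_stdGaussian v 2 (by simp)).integrable_mul
        (memLp_relu_inner_stdGaussian v' 2 (by simp))).aestronglyMeasurable
  simp only [hk, Finset.sum_const, Finset.card_univ, Fintype.card_fin, nsmul_eq_mul]
  field_simp

theorem integral_feature (v : EuclideanSpace ℝ (Fin q)) :
    ∫ x, feature x v ∂((Measure.pi fun _ : Fin p => stdGaussian (EuclideanSpace ℝ (Fin q))).prod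
        (Measure.pi fun _ => rademacher)) = 0 := by
  have hint : ∀ k : Fin p, Integrable
      (fun x : (Fin p → EuclideanSpace ℝ (Fin q)) × (Fin p → ℝ) =>
        relu (inner ℝ (x.1 k) v) * x.2 k)
      ((Measure.pi fun _ : Fin p => stdGaussian (EuclideanSpace ℝ (Fin q))).prod
        (Measure.pi fun _ => rademacher)) := fun k =>
    ((memLp_relu_inner_pi k v).integrable (by simp)).mul_prod
      ((memLp_pi_rademacher k).integrable (by simp))
  simp only [feature, mul_comm _ (relu _)]
  rw [integral_const_mul, integral_finsetSum _ fun k _ => hint k]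
  have h2 : ∀ k : Fin p, ∫ x, relu (inner ℝ (x.1 k) v) * x.2 k
      ∂((Measure.pi fun _ : Fin p => stdGaussian (EuclideanSpace ℝ (Fin q))).prod
        (Measure.pi fun _ => rademacher)) = 0 := fun k => by
    have := integral_prod_mul (μ := Measure.pi fun _ : Fin p => stdGaussian (EuclideanSpace ℝ (Fin q)))
      (ν := Measure.pi fun _ : Fin p => rademacher)
      (fun x : Fin p → EuclideanSpace ℝ (Fin q) => relu (inner ℝ (x k) v)) (fun a : Fin p → ℝ => a k)
    rw [this, integral_pi_rademacher, mul_zero]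
  simp [h2]

/-- The density of `⟪w, v⟫` is at most `1 / (√(2 * π) * ‖v‖) ≤ 1 / (2 * ‖v‖)`, and the interval has
length `2 * R * ‖v‖`. -/
theorem measureReal_abs_inner_le {v : EuclideanSpace ℝ (Fin D)} (hv : v ≠ 0) {R : ℝ} (hR : 0 ≤ R) :
    (stdGaussian (EuclideanSpace ℝ (Fin D))).real {w | |inner ℝ w v| ≤ R * ‖v‖} ≤ R := by
  have hn : 0 < ‖v‖ := norm_pos_iff.2 hv
  have hpre : {w : EuclideanSpace ℝ (Fin D) | |inner ℝ w v| ≤ R * ‖v‖} =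
      (fun w => inner ℝ w v) ⁻¹' Set.Icc (-(R * ‖v‖)) (R * ‖v‖) := by
    ext w
    simp [abs_le]
  rw [measureReal_def, hpre, ← Measure.map_apply (measurable_inner_right v) measurableSet_Icc,
    map_inner_stdGaussian, gaussianReal_apply _ (by positivity)]
  refine ENNReal.toReal_le_of_le_ofReal hR ?_
  have hpdf : ∀ x : ℝ, gaussianPDF 0 (‖v‖ ^ 2).toNNReal x ≤ ENNReal.ofReal (1 / (2 * ‖v‖)) := by
    intro x
    refine ENNReal.ofReal_le_ofReal ?_
    rw [gaussianPDFReal, coe_toNNReal _ (by positivity)]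
    have h1 : exp (-(x - 0) ^ 2 / (2 * ‖v‖ ^ 2)) ≤ 1 := by
      rw [exp_le_one_iff]
      exact div_nonpos_of_nonpos_of_nonneg (by nlinarith [sq_nonneg (x - 0)]) (by positivity)
    have h2 : 2 * ‖v‖ ≤ √(2 * π * ‖v‖ ^ 2) := by
      refine le_sqrt_of_sq_le ?_
      have := pi_gt_three
      nlinarith [sq_nonneg ‖v‖]
    calc _ ≤ (√(2 * π * ‖v‖ ^ 2))⁻¹ * 1 := by gcongr
      _ ≤ _ := by rw [mul_one, ← one_div]; gcongr
  calc ∫⁻ x in Set.Icc (-(R * ‖v‖)) (R * ‖v‖), gaussianPDF 0 (‖v‖ ^ 2).toNNReal x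
      ≤ ∫⁻ _ in Set.Icc (-(R * ‖v‖)) (R * ‖v‖), ENNReal.ofReal (1 / (2 * ‖v‖)) :=
        lintegral_mono fun x => hpdf x
    _ = ENNReal.ofReal R := by
        rw [setLIntegral_const, volume_Icc, ← ENNReal.ofReal_mul (by positivity)]
        congr 1
        field_simp
        ring

end NeuronLaw

/-! ### The functions of one neuron whose empirical means must concentrate, with their tails and
expectations. -/

section NeuronFunctions

open Real

variable {p d q : ℕ}

/-- The contribution of a neuron to an entry of the Gram matrix of the trunk weights. -/
def trunkKernel (u u' : EuclideanSpace ℝ (Fin q)) (y y' : EuclideanSpace ℝ (Fin d))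
    (θ : Neuron p d q) : ℝ :=
  (step (inner ℝ θ.1 y) * step (inner ℝ θ.1 y') * inner ℝ y y') *
    (feature θ.2 u * feature θ.2 u')

/-- The contribution of a neuron to an entry of the Gram matrix of the branch weights. -/
def branchKernel (u u' : EuclideanSpace ℝ (Fin q)) (y y' : EuclideanSpace ℝ (Fin d))
    (θ : Neuron p d q) : ℝ :=
  (relu (inner ℝ θ.1 y) * relu (inner ℝ θ.1 y')) * ((1 / (p : ℝ)) *
    ∑ k, step (inner ℝ (θ.2.1 k) u) * step (inner ℝ (θ.2.1 k) u') * inner ℝ u u')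

/-- The contribution of a neuron to the prediction of the network. -/
def neuronOutput (u : EuclideanSpace ℝ (Fin q)) (y : EuclideanSpace ℝ (Fin d))
    (θ : Neuron p d q) : ℝ :=
  relu (inner ℝ θ.1 y) * feature θ.2 u

/-- The indicator of the small preactivations. -/
def small (R x : ℝ) : ℝ := if |x| ≤ R then 1 else 0

theorem measurable_small (R : ℝ) : Measurable (small R) :=
  Measurable.ite (measurableSet_le continuous_abs.measurable measurable_const) measurable_const
    measurable_const

theorem small_nonneg (R x : ℝ) : 0 ≤ small R x := by unfold small; split_ifs <;> norm_num

theorem small_le_one (R x : ℝ) : small R x ≤ 1 := by unfold small; split_ifs <;> norm_num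

/-- The indicator that the trunk weight of a neuron almost lies on the hyperplane `yᗮ`. -/
def trunkSmall (R : ℝ) (y : EuclideanSpace ℝ (Fin d)) (θ : Neuron p d q) : ℝ :=
  small (R * ‖y‖) (inner ℝ θ.1 y)

/-- The fraction of the branch weights of a neuron that almost lie on the hyperplane `uᗮ`. -/
def branchSmall (R : ℝ) (u : EuclideanSpace ℝ (Fin q)) (θ : Neuron p d q) : ℝ :=
  (1 / (p : ℝ)) * ∑ k, small (R * ‖u‖) (inner ℝ (θ.2.1 k) u)

theorem measurePreserving_neuron_fst : MeasurePreserving (Prod.fst : Neuron p d q → _)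
    (neuronLaw p d q) (stdGaussian (EuclideanSpace ℝ (Fin d))) :=
  measurePreserving_fst

theorem measurePreserving_neuron_snd : MeasurePreserving (Prod.snd : Neuron p d q → _)
    (neuronLaw p d q) ((Measure.pi fun _ => stdGaussian (EuclideanSpace ℝ (Fin q))).prod
      (Measure.pi fun _ => rademacher)) :=
  measurePreserving_snd

theorem measurable_step_inner_fst (y : EuclideanSpace ℝ (Fin d)) :
    Measurable fun θ : Neuron p d q => step (inner ℝ θ.1 y) :=
  measurable_step.comp ((measurable_inner_right y).comp measurable_fst)

theorem measurable_relu_inner_fst (y : EuclideanSpace ℝ (Fin d)) :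
    Measurable fun θ : Neuron p d q => relu (inner ℝ θ.1 y) :=
  measurable_relu.comp ((measurable_inner_right y).comp measurable_fst)

theorem measurable_inner_branch (u : EuclideanSpace ℝ (Fin q)) (k : Fin p) :
    Measurable fun θ : Neuron p d q => inner ℝ (θ.2.1 k) u :=
  (measurable_inner_right u).comp
    ((measurable_pi_apply k).comp (measurable_fst.comp measurable_snd))

theorem measurable_feature_snd (u : EuclideanSpace ℝ (Fin q)) :
    Measurable fun θ : Neuron p d q => feature θ.2 u :=
  (measurable_feature u).comp measurable_snd

theorem measurable_trunkKernel (u u' : EuclideanSpace ℝ (Fin q))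
    (y y' : EuclideanSpace ℝ (Fin d)) :
    Measurable (trunkKernel u u' y y' : Neuron p d q → ℝ) :=
  (((measurable_step_inner_fst y).mul (measurable_step_inner_fst y')).mul_const _).mul
    ((measurable_feature_snd u).mul (measurable_feature_snd u'))

theorem measurable_branchKernel (u u' : EuclideanSpace ℝ (Fin q))
    (y y' : EuclideanSpace ℝ (Fin d)) :
    Measurable (branchKernel u u' y y' : Neuron p d q → ℝ) :=
  ((measurable_relu_inner_fst y).mul (measurable_relu_inner_fst y')).mul
    ((Finset.measurable_sum _ fun k _ => ((measurable_step.comp (measurable_inner_branch u k)).mul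
      (measurable_step.comp (measurable_inner_branch u' k))).mul_const _).const_mul _)

theorem measurable_neuronOutput (u : EuclideanSpace ℝ (Fin q)) (y : EuclideanSpace ℝ (Fin d)) :
    Measurable (neuronOutput u y : Neuron p d q → ℝ) :=
  (measurable_relu_inner_fst y).mul (measurable_feature_snd u)

theorem measurable_trunkSmall (R : ℝ) (y : EuclideanSpace ℝ (Fin d)) :
    Measurable (trunkSmall R y : Neuron p d q → ℝ) :=
  (measurable_small _).comp ((measurable_inner_right y).comp measurable_fst)

theorem measurable_branchSmall (R : ℝ) (u : EuclideanSpace ℝ (Fin q)) :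
    Measurable (branchSmall R u : Neuron p d q → ℝ) :=
  (Finset.measurable_sum _ fun k _ =>
    (measurable_small _).comp (measurable_inner_branch u k)).const_mul _

theorem isSqExp_neuron_inner {B : ℝ} (hB : 0 < B) {y : EuclideanSpace ℝ (Fin d)} (hy : ‖y‖ ≤ B) :
    IsSqExp (fun θ : Neuron p d q => inner ℝ θ.1 y) (4 * B ^ 2) (neuronLaw p d q) :=
  (isSqExp_inner hB hy).comp measurePreserving_neuron_fst

theorem isSqExp_neuron_relu {B : ℝ} (hB : 0 < B) {y : EuclideanSpace ℝ (Fin d)} (hy : ‖y‖ ≤ B) :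
    IsSqExp (fun θ : Neuron p d q => relu (inner ℝ θ.1 y)) (4 * B ^ 2) (neuronLaw p d q) :=
  (isSqExp_neuron_inner hB hy).mono_abs (by positivity) (measurable_relu_inner_fst y) fun θ => by
    rw [abs_of_nonneg (relu_nonneg _)]
    exact relu_le_abs _

theorem isSqExp_neuron_feature (hp : 0 < p) {B : ℝ} (hB : 0 < B) {u : EuclideanSpace ℝ (Fin q)}
    (hu : ‖u‖ ≤ B) :
    IsSqExp (fun θ : Neuron p d q => feature θ.2 u) (4 * B ^ 2) (neuronLaw p d q) :=
  (isSqExp_feature hp hB hu).comp measurePreserving_neuron_snd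

theorem abs_inner_le_sq {D : ℕ} {B : ℝ} {v v' : EuclideanSpace ℝ (Fin D)} (hv : ‖v‖ ≤ B)
    (hv' : ‖v'‖ ≤ B) : |inner ℝ v v'| ≤ B ^ 2 := by
  have hB : 0 ≤ B := (norm_nonneg v).trans hv
  calc |inner ℝ v v'| ≤ ‖v‖ * ‖v'‖ := abs_real_inner_le_norm v v'
    _ ≤ B * B := by gcongr
    _ = B ^ 2 := (pow_two B).symm

theorem abs_step_mul_step_mul_le {a b c C : ℝ} (hc : |c| ≤ C) :
    |step a * step b * c| ≤ C := by
  rw [abs_mul, abs_mul, abs_of_nonneg (step_nonneg _), abs_of_nonneg (step_nonneg _)]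
  have h1 : step a * step b ≤ 1 := mul_le_one₀ (step_le_one _) (step_nonneg _) (step_le_one _)
  exact (mul_le_of_le_one_left (abs_nonneg c) h1).trans hc

theorem abs_average_le {f : Fin p → ℝ} {C : ℝ} (hC : 0 ≤ C) (hf : ∀ k, |f k| ≤ C) :
    |(1 / (p : ℝ)) * ∑ k, f k| ≤ C := by
  rcases Nat.eq_zero_or_pos p with rfl | hp
  · simpa using hC
  · have hp' : (0 : ℝ) < p := by exact_mod_cast hp
    rw [abs_mul, abs_of_pos (by positivity), one_div, inv_mul_le_iff₀ hp']
    calc |∑ k, f k| ≤ ∑ k, |f k| := Finset.abs_sum_le_sum_abs _ _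
      _ ≤ ∑ _k : Fin p, C := Finset.sum_le_sum fun k _ => hf k
      _ = p * C := by simp

/-- A bounded trunk factor times two features of the same branch. The features are dependent, but
the product rule for sub-Gaussian variables does not mind. For `branchKernel` the roles are
exchanged: the branch average is bounded and the two ReLUs of the trunk are sub-Gaussian. -/
theorem isSubexp_trunkKernel (hp : 0 < p) {B : ℝ} (hB : 0 < B) {u u' : EuclideanSpace ℝ (Fin q)}
    {y y' : EuclideanSpace ℝ (Fin d)} (hu : ‖u‖ ≤ B) (hu' : ‖u'‖ ≤ B) (hy : ‖y‖ ≤ B)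
    (hy' : ‖y'‖ ≤ B) :
    IsSubexp (trunkKernel u u' y y') (B ^ 2 * (4 * B ^ 2)) (neuronLaw p d q) :=
  IsSqExp.isSubexp_of_abs_le (by positivity) (by positivity) (isSqExp_neuron_feature hp hB hu)
    (isSqExp_neuron_feature hp hB hu') (measurable_trunkKernel u u' y y') fun θ => by
      rw [trunkKernel, abs_mul, abs_mul (feature _ _)]
      gcongr
      exact abs_step_mul_step_mul_le (abs_inner_le_sq hy hy')

theorem isSubexp_branchKernel {B : ℝ} (hB : 0 < B) {u u' : EuclideanSpace ℝ (Fin q)}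
    {y y' : EuclideanSpace ℝ (Fin d)} (hu : ‖u‖ ≤ B) (hu' : ‖u'‖ ≤ B) (hy : ‖y‖ ≤ B)
    (hy' : ‖y'‖ ≤ B) :
    IsSubexp (branchKernel u u' y y') (B ^ 2 * (4 * B ^ 2)) (neuronLaw p d q) :=
  IsSqExp.isSubexp_of_abs_le (by positivity) (by positivity) (isSqExp_neuron_relu hB hy)
    (isSqExp_neuron_relu hB hy') (measurable_branchKernel u u' y y') fun θ => by
      rw [branchKernel, abs_mul, abs_mul (relu _), mul_comm]
      gcongr
      exact abs_average_le (by positivity) fun k => abs_step_mul_step_mul_le (abs_inner_le_sq hu hu')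

theorem isSubexp_neuronOutput (hp : 0 < p) {B : ℝ} (hB : 0 < B) {u : EuclideanSpace ℝ (Fin q)}
    {y : EuclideanSpace ℝ (Fin d)} (hu : ‖u‖ ≤ B) (hy : ‖y‖ ≤ B) :
    IsSubexp (neuronOutput u y) (1 * (4 * B ^ 2)) (neuronLaw p d q) :=
  IsSqExp.isSubexp_of_abs_le (by positivity) one_pos (isSqExp_neuron_relu hB hy)
    (isSqExp_neuron_feature hp hB hu) (measurable_neuronOutput u y) fun θ => by
      rw [neuronOutput, abs_mul, one_mul]

theorem isSubexp_trunkSmall (R : ℝ) (y : EuclideanSpace ℝ (Fin d)) :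
    IsSubexp (trunkSmall R y) 4 (neuronLaw p d q) :=
  isSubexp_of_abs_le_one le_rfl (measurable_trunkSmall R y) fun θ => by
    rw [trunkSmall, abs_of_nonneg (small_nonneg _ _)]
    exact small_le_one _ _

theorem isSubexp_branchSmall (R : ℝ) (u : EuclideanSpace ℝ (Fin q)) :
    IsSubexp (branchSmall R u) 4 (neuronLaw p d q) :=
  isSubexp_of_abs_le_one le_rfl (measurable_branchSmall R u) fun θ =>
    abs_average_le zero_le_one fun k => by
      rw [abs_of_nonneg (small_nonneg _ _)]
      exact small_le_one _ _

theorem integral_average_branch {f : EuclideanSpace ℝ (Fin q) → ℝ} (hp : 0 < p)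
    (hf : Integrable f (stdGaussian (EuclideanSpace ℝ (Fin q)))) :
    ∫ x, (1 / (p : ℝ)) * ∑ k, f (x.1 k)
      ∂((Measure.pi fun _ : Fin p => stdGaussian (EuclideanSpace ℝ (Fin q))).prod
        (Measure.pi fun _ : Fin p => rademacher)) =
      ∫ w, f w ∂(stdGaussian (EuclideanSpace ℝ (Fin q))) := by
  have hp' : (p : ℝ) ≠ 0 := by exact_mod_cast hp.ne'
  rw [integral_fun_fst (fun x : Fin p → EuclideanSpace ℝ (Fin q) => (1 / (p : ℝ)) * ∑ k, f (x k)),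
    integral_const_mul, integral_finsetSum _ fun k _ => integrable_pi_comp_eval hf k]
  have h : ∀ k : Fin p, ∫ x, f (x k)
      ∂(Measure.pi fun _ : Fin p => stdGaussian (EuclideanSpace ℝ (Fin q))) =
      ∫ w, f w ∂(stdGaussian (EuclideanSpace ℝ (Fin q))) := fun k =>
    integral_comp_eval (μ := fun _ : Fin p => stdGaussian (EuclideanSpace ℝ (Fin q)))
      hf.aestronglyMeasurable
  simp only [h, Finset.sum_const, Finset.card_univ, Fintype.card_fin, nsmul_eq_mul]
  simp
  field_simp

theorem derivGram_apply {n D : ℕ} (v : Fin n → EuclideanSpace ℝ (Fin D)) (i j : Fin n) :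
    derivGram v i j = ∫ w, step (inner ℝ w (v i)) * step (inner ℝ w (v j)) * inner ℝ (v i) (v j)
      ∂(stdGaussian (EuclideanSpace ℝ (Fin D))) := by
  simp only [derivGram_eq, Matrix.of_apply, inner_smul_left, inner_smul_right, conj_trivial]
  refine integral_congr_ae (Filter.Eventually.of_forall fun w => ?_)
  dsimp only
  ring

theorem integrable_step_mul_step (v v' : EuclideanSpace ℝ (Fin q)) (c : ℝ) :
    Integrable (fun w => step (inner ℝ w v) * step (inner ℝ w v') * c)
      (stdGaussian (EuclideanSpace ℝ (Fin q))) :=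
  Integrable.of_bound (C := |c|) (((measurable_step.comp (measurable_inner_right v)).mul
    (measurable_step.comp (measurable_inner_right v'))).mul_const c).aestronglyMeasurable
    (Filter.Eventually.of_forall fun _ => abs_step_mul_step_mul_le le_rfl)

/-- Trunk and branch weights of a neuron are independent, so the expectation factorizes; this is the
origin of the Kronecker product. -/
theorem integral_trunkKernel {n₁ n₂ : ℕ} (hp : 0 < p) (u : Fin n₁ → EuclideanSpace ℝ (Fin q))
    (y : Fin n₂ → EuclideanSpace ℝ (Fin d)) (i i' : Fin n₁) (j j' : Fin n₂) :
    ∫ θ, trunkKernel (u i) (u i') (y j) (y j') θ ∂(neuronLaw p d q) =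
      valueGram u i i' * derivGram y j j' := by
  rw [derivGram_apply, valueGram, Matrix.of_apply, ← integral_feature_mul_feature hp, mul_comm]
  exact integral_prod_mul (fun w => step (inner ℝ w (y j)) * step (inner ℝ w (y j')) *
    inner ℝ (y j) (y j')) (fun x => feature x (u i) * feature x (u i'))

theorem integral_branchKernel {n₁ n₂ : ℕ} (hp : 0 < p) (u : Fin n₁ → EuclideanSpace ℝ (Fin q))
    (y : Fin n₂ → EuclideanSpace ℝ (Fin d)) (i i' : Fin n₁) (j j' : Fin n₂) :
    ∫ θ, branchKernel (u i) (u i') (y j) (y j') θ ∂(neuronLaw p d q) =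
      derivGram u i i' * valueGram y j j' := by
  rw [derivGram_apply, valueGram, Matrix.of_apply,
    ← integral_average_branch hp (integrable_step_mul_step _ _ _), mul_comm]
  exact integral_prod_mul (fun w => relu (inner ℝ w (y j)) * relu (inner ℝ w (y j')))
    (fun x : (Fin p → EuclideanSpace ℝ (Fin q)) × (Fin p → ℝ) => (1 / (p : ℝ)) *
      ∑ k, step (inner ℝ (x.1 k) (u i)) * step (inner ℝ (x.1 k) (u i')) * inner ℝ (u i) (u i'))

theorem integral_neuronOutput (u : EuclideanSpace ℝ (Fin q)) (y : EuclideanSpace ℝ (Fin d)) :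
    ∫ θ, neuronOutput u y θ ∂(neuronLaw p d q) = 0 := by
  have := integral_prod_mul (μ := stdGaussian (EuclideanSpace ℝ (Fin d)))
    (ν := (Measure.pi fun _ : Fin p => stdGaussian (EuclideanSpace ℝ (Fin q))).prod
      (Measure.pi fun _ : Fin p => rademacher))
    (fun w => relu (inner ℝ w y)) (fun x => feature x u)
  rw [integral_feature, mul_zero] at this
  exact this

theorem integral_small_inner_le {D : ℕ} {v : EuclideanSpace ℝ (Fin D)} (hv : v ≠ 0) {R : ℝ}
    (hR : 0 ≤ R) :
    ∫ w, small (R * ‖v‖) (inner ℝ w v) ∂(stdGaussian (EuclideanSpace ℝ (Fin D))) ≤ R := by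
  have hms : MeasurableSet {w : EuclideanSpace ℝ (Fin D) | |inner ℝ w v| ≤ R * ‖v‖} :=
    measurableSet_le (continuous_abs.measurable.comp (measurable_inner_right v)) measurable_const
  have : (fun w => small (R * ‖v‖) (inner ℝ w v)) =
      Set.indicator {w : EuclideanSpace ℝ (Fin D) | |inner ℝ w v| ≤ R * ‖v‖} (fun _ => (1 : ℝ)) := by
    ext w
    simp [small, Set.indicator]
  rw [this, integral_indicator_const _ hms, smul_eq_mul, mul_one]
  exact measureReal_abs_inner_le hv hR

theorem integral_trunkSmall_le {y : EuclideanSpace ℝ (Fin d)} (hy : y ≠ 0) {R : ℝ} (hR : 0 ≤ R) :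
    ∫ θ, trunkSmall R y θ ∂(neuronLaw p d q) ≤ R := by
  have := integral_fun_fst (μ := stdGaussian (EuclideanSpace ℝ (Fin d)))
    (ν := (Measure.pi fun _ : Fin p => stdGaussian (EuclideanSpace ℝ (Fin q))).prod
      (Measure.pi fun _ : Fin p => rademacher)) (fun w => small (R * ‖y‖) (inner ℝ w y))
  unfold trunkSmall neuronLaw
  rw [this]
  simpa using integral_small_inner_le hy hR

theorem integral_branchSmall_le (hp : 0 < p) {u : EuclideanSpace ℝ (Fin q)} (hu : u ≠ 0) {R : ℝ}
    (hR : 0 ≤ R) : ∫ θ, branchSmall R u θ ∂(neuronLaw p d q) ≤ R := by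
  have := integral_fun_snd (μ := stdGaussian (EuclideanSpace ℝ (Fin d)))
    (ν := (Measure.pi fun _ : Fin p => stdGaussian (EuclideanSpace ℝ (Fin q))).prod
      (Measure.pi fun _ : Fin p => rademacher))
    (fun x => (1 / (p : ℝ)) * ∑ k, small (R * ‖u‖) (inner ℝ (x.1 k) u))
  unfold branchSmall neuronLaw
  rw [this, integral_average_branch (f := fun w => small (R * ‖u‖) (inner ℝ w u)) hp]
  · simpa using integral_small_inner_le hu hR
  · refine Integrable.of_bound (C := 1)
      ((measurable_small _).comp (measurable_inner_right u)).aestronglyMeasurable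
      (Filter.Eventually.of_forall fun w => ?_)
    rw [norm_of_nonneg (small_nonneg _ _)]
    exact small_le_one _ _

theorem ae_neuronLaw_sq : ∀ᵐ θ ∂(neuronLaw p d q), ∀ k, θ.2.2 k ^ 2 = 1 :=
  Measure.quasiMeasurePreserving_snd.ae (Measure.quasiMeasurePreserving_snd.ae ae_pi_rademacher_sq)

end NeuronFunctions

/-! ### Deterministic analysis in a neighbourhood of a good initialization. -/

section Perturbation

open Real

variable {m p d q n₁ n₂ : ℕ}

theorem step_mem_reluSubdiff (x : ℝ) : step x ∈ reluSubdiff x :=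
  ⟨step_nonneg x, step_le_one x, fun h => by simp [step, h.not_ge], fun h => by simp [step, h.le]⟩

/-- A displacement of at most `R` changes the preactivation by at most `R * ‖y‖`, so its sign can
change only if it was that small initially; otherwise every subgradient agrees with the initial
indicator. -/
theorem abs_sub_step_le_small {D : ℕ} {v w y : EuclideanSpace ℝ (Fin D)} {R s : ℝ}
    (h : ‖v - w‖ ≤ R) (hs : s ∈ reluSubdiff (inner ℝ v y)) :
    |s - step (inner ℝ w y)| ≤ small (R * ‖y‖) (inner ℝ w y) := by
  have hd : |inner ℝ v y - inner ℝ w y| ≤ R * ‖y‖ := by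
    rw [← inner_sub_left]
    exact (abs_real_inner_le_norm _ _).trans (by gcongr)
  obtain ⟨h0, h1, hneg, hpos⟩ := hs
  by_cases hw : |inner ℝ w y| ≤ R * ‖y‖
  · have h2 := step_nonneg (inner ℝ w y)
    have h3 := step_le_one (inner ℝ w y)
    rw [small, if_pos hw, abs_le]
    constructor <;> linarith
  · rw [small, if_neg hw]
    rw [abs_le] at hd
    rcases le_or_gt 0 (inner ℝ w y) with hw0 | hw0
    · rw [abs_of_nonneg hw0] at hw
      rw [hpos (by linarith), step, if_pos hw0, sub_self, abs_zero]
    · rw [abs_of_neg hw0] at hw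
      rw [hneg (by linarith), step, if_neg hw0.not_ge, sub_self, abs_zero]

theorem abs_mul_sub_mul_le_of_unit {s s' t t' f f' : ℝ} (hs : |s| ≤ 1) (ht : |t'| ≤ 1)
    (h : |s - t| ≤ f) (h' : |s' - t'| ≤ f') : |s * s' - t * t'| ≤ f + f' := by
  have : s * s' - t * t' = (s - t) * t' + s * (s' - t') := by ring
  rw [this]
  refine (abs_add_le _ _).trans ?_
  rw [abs_mul, abs_mul]
  have h1 : |s - t| * |t'| ≤ |s - t| * 1 := by gcongr
  have h2 : |s| * |s' - t'| ≤ 1 * |s' - t'| := by gcongr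
  linarith

/-- Stability of the empirical mean of `b * b' * Y * c`. -/
theorem abs_average_kernel_sub_le {b b₀ b' b₀' Y Y₀ f : Fin m → ℝ} {c C M δ F : ℝ}
    (hm : 0 < m) (hδ : 0 ≤ δ) (hM : 0 ≤ M) (hc : |c| ≤ C)
    (hb₀ : ∀ r, |b₀ r| ≤ M) (hb₀' : ∀ r, |b₀' r| ≤ M)
    (hb : ∀ r, |b r - b₀ r| ≤ δ) (hb' : ∀ r, |b' r - b₀' r| ≤ δ)
    (hY : ∀ r, |Y r| ≤ 1) (hYf : ∀ r, |Y r - Y₀ r| ≤ f r) (hF : (1 / (m : ℝ)) * ∑ r, f r ≤ F) :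
    |(1 / (m : ℝ)) * ∑ r, Y r * c * (b r * b' r) - (1 / (m : ℝ)) * ∑ r, Y₀ r * c * (b₀ r * b₀' r)| ≤
      C * (δ * (2 * M + δ) + M ^ 2 * F) := by
  have hm' : (0 : ℝ) < m := by exact_mod_cast hm
  have hC : 0 ≤ C := (abs_nonneg c).trans hc
  have hr : ∀ r, |Y r * c * (b r * b' r) - Y₀ r * c * (b₀ r * b₀' r)| ≤
      C * (δ * (2 * M + δ)) + C * M ^ 2 * f r := by
    intro r
    have h1 : |b r * b' r - b₀ r * b₀' r| ≤ δ * (2 * M + δ) := by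
      have : b r * b' r - b₀ r * b₀' r = (b r - b₀ r) * (b' r - b₀' r) +
          (b r - b₀ r) * b₀' r + b₀ r * (b' r - b₀' r) := by ring
      rw [this]
      refine (abs_add_three _ _ _).trans ?_
      rw [abs_mul, abs_mul, abs_mul]
      have e1 : |b r - b₀ r| * |b' r - b₀' r| ≤ δ * δ :=
        mul_le_mul (hb r) (hb' r) (abs_nonneg _) hδ
      have e2 : |b r - b₀ r| * |b₀' r| ≤ δ * M := mul_le_mul (hb r) (hb₀' r) (abs_nonneg _) hδ
      have e3 : |b₀ r| * |b' r - b₀' r| ≤ M * δ := mul_le_mul (hb₀ r) (hb' r) (abs_nonneg _) hM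
      linarith
    have h2 : |b₀ r * b₀' r| ≤ M ^ 2 := by
      rw [abs_mul, pow_two]
      exact mul_le_mul (hb₀ r) (hb₀' r) (abs_nonneg _) hM
    have h3 : Y r * c * (b r * b' r) - Y₀ r * c * (b₀ r * b₀' r) =
        c * (Y r * (b r * b' r - b₀ r * b₀' r) + (Y r - Y₀ r) * (b₀ r * b₀' r)) := by ring
    rw [h3, abs_mul, mul_assoc, ← mul_add]
    refine mul_le_mul hc ((abs_add_le _ _).trans ?_) (abs_nonneg _) hC
    rw [abs_mul, abs_mul]
    have e1 : |Y r| * |b r * b' r - b₀ r * b₀' r| ≤ 1 * (δ * (2 * M + δ)) :=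
      mul_le_mul (hY r) h1 (abs_nonneg _) zero_le_one
    have e2 : |Y r - Y₀ r| * |b₀ r * b₀' r| ≤ f r * M ^ 2 :=
      mul_le_mul (hYf r) h2 (abs_nonneg _) ((abs_nonneg _).trans (hYf r))
    linarith
  rw [← mul_sub, ← Finset.sum_sub_distrib, abs_mul, abs_of_pos (by positivity)]
  calc _ ≤ (1 / (m : ℝ)) * ∑ r, (C * (δ * (2 * M + δ)) + C * M ^ 2 * f r) := by
        gcongr
        exact (Finset.abs_sum_le_sum_abs _ _).trans (Finset.sum_le_sum fun r _ => hr r)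
    _ = C * (δ * (2 * M + δ)) + C * M ^ 2 * ((1 / (m : ℝ)) * ∑ r, f r) := by
        rw [Finset.sum_add_distrib, Finset.sum_const, ← Finset.mul_sum, Finset.card_univ,
          Fintype.card_fin, nsmul_eq_mul]
        field_simp
    _ ≤ C * (δ * (2 * M + δ)) + C * M ^ 2 * F := by gcongr
    _ = _ := by ring

theorem sum_norm_sq_sum_smul {ι κ E : Type*} [Fintype ι] [Fintype κ] [NormedAddCommGroup E]
    [InnerProductSpace ℝ E] (c : κ → ι → ℝ) (V : ι → E) :
    ∑ r, ‖∑ α, c r α • V α‖ ^ 2 = ∑ α, ∑ β, ∑ r, c r α * c r β * inner ℝ (V α) (V β) := by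
  have h : ∀ r, ‖∑ α, c r α • V α‖ ^ 2 = ∑ α, ∑ β, c r α * c r β * inner ℝ (V α) (V β) := by
    intro r
    rw [← real_inner_self_eq_norm_sq]
    simp only [sum_inner, inner_sum, inner_smul_left, inner_smul_right, conj_trivial,
      Finset.mul_sum]
    refine Finset.sum_congr rfl fun i _ => Finset.sum_congr rfl fun j _ => ?_
    rw [real_inner_comm]
    ring
  simp_rw [h]
  rw [Finset.sum_comm]
  exact Finset.sum_congr rfl fun α _ => Finset.sum_comm

variable {u : Fin n₁ → EuclideanSpace ℝ (Fin q)}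
  {y : Fin n₂ → EuclideanSpace ℝ (Fin d)} {z : Fin n₁ → Fin n₂ → ℝ} {a : Fin m → Fin p → ℝ}
  {v : Fin m → EuclideanSpace ℝ (Fin d)} {v' : Fin m → Fin p → EuclideanSpace ℝ (Fin q)}
  {s : Fin m → Fin n₂ → ℝ} {s' : Fin m → Fin p → Fin n₁ → ℝ}

theorem sum_norm_sq_gradTrunk_eq :
    ∑ r, ‖gradTrunk u y z v v' a s r‖ ^ 2 = ∑ α : Fin n₁ × Fin n₂, ∑ β : Fin n₁ × Fin n₂,
      (net v v' a (u α.1) (y α.2) - z α.1 α.2) * (net v v' a (u β.1) (y β.2) - z β.1 β.2) *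
        ((1 / (m : ℝ)) * ∑ r, (s r α.2 * s r β.2) * inner ℝ (y α.2) (y β.2) *
          (branch v' a r (u α.1) * branch v' a r (u β.1))) := by
  have h : ∀ r, gradTrunk u y z v v' a s r = ∑ α : Fin n₁ × Fin n₂,
      ((net v v' a (u α.1) (y α.2) - z α.1 α.2) *
        ((1 / √(m : ℝ)) * branch v' a r (u α.1) * s r α.2)) • y α.2 := fun r => by
    rw [gradTrunk, Fintype.sum_prod_type]
    simp only [smul_smul]
  simp_rw [h]
  rw [sum_norm_sq_sum_smul (fun r (α : Fin n₁ × Fin n₂) =>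
    (net v v' a (u α.1) (y α.2) - z α.1 α.2) *
        ((1 / √(m : ℝ)) * branch v' a r (u α.1) * s r α.2)) (fun α => y α.2)]
  refine Finset.sum_congr rfl fun α _ => Finset.sum_congr rfl fun β _ => ?_
  simp_rw [Finset.mul_sum]
  refine Finset.sum_congr rfl fun r _ => ?_
  have hm : (1 / (m : ℝ)) = (1 / √(m : ℝ)) * (1 / √(m : ℝ)) := by
    rw [← pow_two, div_pow, sq_sqrt (by positivity), one_pow]
  rw [hm]
  ring

/-- Since the output weights have square one, they disappear from this Gram matrix. -/
theorem sum_norm_sq_gradBranch_eq (ha : ∀ r k, a r k ^ 2 = 1) :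
    ∑ r, ∑ k, ‖gradBranch u y z v v' a s' r k‖ ^ 2 =
      ∑ α : Fin n₁ × Fin n₂, ∑ β : Fin n₁ × Fin n₂,
      (net v v' a (u α.1) (y α.2) - z α.1 α.2) * (net v v' a (u β.1) (y β.2) - z β.1 β.2) *
        ((1 / (m : ℝ)) * ∑ r, ((1 / (p : ℝ)) * ∑ k, s' r k α.1 * s' r k β.1) *
          inner ℝ (u α.1) (u β.1) * (relu (inner ℝ (v r) (y α.2)) *
            relu (inner ℝ (v r) (y β.2)))) := by
  have h : ∀ x : Fin m × Fin p, gradBranch u y z v v' a s' x.1 x.2 = ∑ α : Fin n₁ × Fin n₂,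
      ((net v v' a (u α.1) (y α.2) - z α.1 α.2) *
        ((1 / √(m : ℝ)) * (1 / √(p : ℝ)) * a x.1 x.2 * s' x.1 x.2 α.1 *
          relu (inner ℝ (v x.1) (y α.2)))) • u α.1 := fun x => by
    rw [gradBranch, Fintype.sum_prod_type]
    simp only [smul_smul]
  rw [← Fintype.sum_prod_type' (fun r k => ‖gradBranch u y z v v' a s' r k‖ ^ 2)]
  simp_rw [h]
  rw [sum_norm_sq_sum_smul (fun (x : Fin m × Fin p) (α : Fin n₁ × Fin n₂) =>
    (net v v' a (u α.1) (y α.2) - z α.1 α.2) *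
        ((1 / √(m : ℝ)) * (1 / √(p : ℝ)) * a x.1 x.2 * s' x.1 x.2 α.1 *
          relu (inner ℝ (v x.1) (y α.2)))) (fun α => u α.1)]
  refine Finset.sum_congr rfl fun α _ => Finset.sum_congr rfl fun β _ => ?_
  rw [Fintype.sum_prod_type]
  simp_rw [Finset.mul_sum, Finset.sum_mul, Finset.mul_sum]
  refine Finset.sum_congr rfl fun r _ => Finset.sum_congr rfl fun k _ => ?_
  have hm : (1 / (m : ℝ)) = (1 / √(m : ℝ)) * (1 / √(m : ℝ)) := by
    rw [← pow_two, div_pow, sq_sqrt (by positivity), one_pow]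
  have hp : (1 / (p : ℝ)) = (1 / √(p : ℝ)) * (1 / √(p : ℝ)) := by
    rw [← pow_two, div_pow, sq_sqrt (by positivity), one_pow]
  rw [hm, hp]
  linear_combination (net v v' a (u α.1) (y α.2) - z α.1 α.2) *
    (net v v' a (u β.1) (y β.2) - z β.1 β.2) * (1 / √(m : ℝ)) * (1 / √(m : ℝ)) * (1 / √(p : ℝ)) *
    (1 / √(p : ℝ)) * s' r k α.1 * s' r k β.1 * inner ℝ (u α.1) (u β.1) *
    relu (inner ℝ (v r) (y α.2)) * relu (inner ℝ (v r) (y β.2)) * ha r k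

/-- The properties of a typical initialization that make the gradient flow converge: `R` is the
radius of the neighbourhood in which the weights will stay, `M` bounds the features and the
preactivations, `ε` the deviations of the Gram matrices and `τ` the predictions. -/
structure IsGoodInit (u : Fin n₁ → EuclideanSpace ℝ (Fin q)) (y : Fin n₂ → EuclideanSpace ℝ (Fin d))
    (M R ε τ : ℝ) (w : Fin m → EuclideanSpace ℝ (Fin d))
    (w' : Fin m → Fin p → EuclideanSpace ℝ (Fin q)) (a : Fin m → Fin p → ℝ) : Prop where
  sq_eq_one : ∀ r k, a r k ^ 2 = 1
  abs_branch_le : ∀ r i, |branch w' a r (u i)| ≤ M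
  abs_inner_le : ∀ r j, |inner ℝ (w r) (y j)| ≤ M
  trunkSmall_le : ∀ j, (1 / (m : ℝ)) * ∑ r, trunkSmall R (y j) (w r, w' r, a r) ≤ 2 * R
  branchSmall_le : ∀ i, (1 / (m : ℝ)) * ∑ r, branchSmall R (u i) (w r, w' r, a r) ≤ 2 * R
  trunkKernel_le : ∀ i i' j j', |(1 / (m : ℝ)) * ∑ r, trunkKernel (u i) (u i') (y j) (y j')
    (w r, w' r, a r) - valueGram u i i' * derivGram y j j'| ≤ ε
  branchKernel_le : ∀ i i' j j', |(1 / (m : ℝ)) * ∑ r, branchKernel (u i) (u i') (y j) (y j')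
    (w r, w' r, a r) - derivGram u i i' * valueGram y j j'| ≤ ε
  abs_net_le : ∀ i j, |net w w' a (u i) (y j)| ≤ τ

variable {M R ε τ B : ℝ} {w : Fin m → EuclideanSpace ℝ (Fin d)}
  {w' : Fin m → Fin p → EuclideanSpace ℝ (Fin q)}

theorem abs_of_mem_reluSubdiff {t x : ℝ} (ht : t ∈ reluSubdiff x) : |t| ≤ 1 := by
  rw [abs_of_nonneg ht.1]
  exact ht.2.1

theorem abs_step_le_one (x : ℝ) : |step x| ≤ 1 := abs_of_mem_reluSubdiff (step_mem_reluSubdiff x)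

theorem abs_relu_inner_sub_le {D : ℕ} {x x' y : EuclideanSpace ℝ (Fin D)} (h : ‖x - x'‖ ≤ R)
    (hy : ‖y‖ ≤ B) : |relu (inner ℝ x y) - relu (inner ℝ x' y)| ≤ R * B := by
  refine (abs_relu_sub_relu_le _ _).trans ?_
  rw [← inner_sub_left]
  refine (abs_real_inner_le_norm _ _).trans ?_
  have := norm_nonneg (x - x')
  exact mul_le_mul h hy (norm_nonneg _) (this.trans h)

/-- The radius `R / √p` is the natural scale for branch weights: `p` terms, each moving by `R * B /
√p`, are summed with weight `1 / √p`. The gradients of the branch weights carry the same additional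
factor `1 / √p`. -/
theorem abs_branch_sub_le (hp : 0 < p) (ha : ∀ r k, a r k ^ 2 = 1)
    (hv' : ∀ r k, ‖v' r k - w' r k‖ ≤ R / √(p : ℝ)) {x : EuclideanSpace ℝ (Fin q)} (hx : ‖x‖ ≤ B)
    (r : Fin m) : |branch v' a r x - branch w' a r x| ≤ R * B := by
  have hp' : (0 : ℝ) < p := by exact_mod_cast hp
  have hs : 0 < √(p : ℝ) := sqrt_pos.2 hp'
  have ha' : ∀ r k, |a r k| = 1 := fun r k =>
    (sq_eq_sq₀ (abs_nonneg _) zero_le_one).1 (by rw [sq_abs, ha r k, one_pow])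
  rw [branch, branch, ← mul_sub, ← Finset.sum_sub_distrib, abs_mul, abs_of_pos (by positivity)]
  calc _ ≤ (1 / √(p : ℝ)) * ∑ _k : Fin p, R / √(p : ℝ) * B := by
        gcongr
        refine (Finset.abs_sum_le_sum_abs _ _).trans (Finset.sum_le_sum fun k _ => ?_)
        rw [← mul_sub, abs_mul, ha', one_mul]
        exact abs_relu_inner_sub_le (hv' r k) hx
    _ = R * B := by
        rw [Finset.sum_const, Finset.card_univ, Fintype.card_fin, nsmul_eq_mul]
        field_simp
        rw [sq_sqrt hp'.le]

theorem div_sqrt_natCast_le (hp : 0 < p) (hR : 0 ≤ R) : R / √(p : ℝ) ≤ R := by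
  have h1 : (1 : ℝ) ≤ √(p : ℝ) := one_le_sqrt.2 (by exact_mod_cast hp)
  exact div_le_self hR h1

/-- Since `R * B ≤ M`, the change of the two factors contributes `3 * M ^ 2 * R`. The change of the
ReLU derivatives contributes `4 * M ^ 2 * R`, from a fraction `2 * R` for each of the two samples.
-/
theorem kernel_stability_bound (hB : 1 ≤ B) (hBM : B ≤ M) (hR : 0 ≤ R) (hR1 : R ≤ 1) :
    B ^ 2 * (R * B * (2 * M + R * B) + M ^ 2 * (4 * R)) ≤ 7 * B ^ 2 * M ^ 2 * R := by
  have e1 : R * B ≤ M := by nlinarith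
  have e2 : R * B * (2 * M + R * B) ≤ R * M * (3 * M) := by
    have : 0 ≤ R * B := by positivity
    exact mul_le_mul (by gcongr) (by linarith) (by linarith) (by nlinarith)
  have e3 : 0 ≤ B ^ 2 := by positivity
  nlinarith

theorem IsGoodInit.abs_trunkGram_sub_le (hg : IsGoodInit u y M R ε τ w w' a) (hm : 0 < m)
    (hp : 0 < p) (hB : 1 ≤ B) (hBM : B ≤ M) (hR : 0 ≤ R) (hR1 : R ≤ 1) (hu : ∀ i, ‖u i‖ ≤ B)
    (hy : ∀ j, ‖y j‖ ≤ B) (hv : ∀ r, ‖v r - w r‖ ≤ R)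
    (hv' : ∀ r k, ‖v' r k - w' r k‖ ≤ R / √(p : ℝ))
    (hs : ∀ r j, s r j ∈ reluSubdiff (inner ℝ (v r) (y j))) (i i' : Fin n₁) (j j' : Fin n₂) :
    |(1 / (m : ℝ)) * ∑ r, (s r j * s r j') * inner ℝ (y j) (y j') *
      (branch v' a r (u i) * branch v' a r (u i')) - valueGram u i i' * derivGram y j j'| ≤
        ε + 7 * B ^ 2 * M ^ 2 * R := by
  have hF : (1 / (m : ℝ)) * ∑ r, (trunkSmall R (y j) (w r, w' r, a r) +
      trunkSmall R (y j') (w r, w' r, a r)) ≤ 4 * R := by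
    rw [Finset.sum_add_distrib, mul_add]
    linarith [hg.trunkSmall_le j, hg.trunkSmall_le j']
  have key := abs_average_kernel_sub_le (b := fun r => branch v' a r (u i))
    (b₀ := fun r => branch w' a r (u i)) (b' := fun r => branch v' a r (u i'))
    (b₀' := fun r => branch w' a r (u i')) (Y := fun r => s r j * s r j')
    (Y₀ := fun r => step (inner ℝ (w r) (y j)) * step (inner ℝ (w r) (y j')))
    (M := M) (δ := R * B) hm (by positivity) (by linarith) (abs_inner_le_sq (hy j) (hy j'))
    (fun r => hg.abs_branch_le r i) (fun r => hg.abs_branch_le r i')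
    (fun r => abs_branch_sub_le hp hg.sq_eq_one hv' (hu i) r)
    (fun r => abs_branch_sub_le hp hg.sq_eq_one hv' (hu i') r)
    (fun r => by
      rw [abs_mul]
      exact mul_le_one₀ (abs_of_mem_reluSubdiff (hs r j)) (abs_nonneg _)
        (abs_of_mem_reluSubdiff (hs r j')))
    (fun r => abs_mul_sub_mul_le_of_unit (abs_of_mem_reluSubdiff (hs r j)) (abs_step_le_one _)
      (abs_sub_step_le_small (hv r) (hs r j)) (abs_sub_step_le_small (hv r) (hs r j'))) hF
  have h2 := hg.trunkKernel_le i i' j j'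
  have h4 := abs_sub_le _ ((1 / (m : ℝ)) * ∑ r, trunkKernel (u i) (u i') (y j) (y j')
    (w r, w' r, a r)) (valueGram u i i' * derivGram y j j') |>.trans
      (add_le_add (key.trans (kernel_stability_bound hB hBM hR hR1)) h2)
  linarith

theorem IsGoodInit.abs_branchGram_sub_le (hg : IsGoodInit u y M R ε τ w w' a) (hm : 0 < m)
    (hp : 0 < p) (hB : 1 ≤ B) (hBM : B ≤ M) (hR : 0 ≤ R) (hR1 : R ≤ 1) (hu : ∀ i, ‖u i‖ ≤ B)
    (hy : ∀ j, ‖y j‖ ≤ B) (hv : ∀ r, ‖v r - w r‖ ≤ R)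
    (hv' : ∀ r k, ‖v' r k - w' r k‖ ≤ R / √(p : ℝ))
    (hs' : ∀ r k i, s' r k i ∈ reluSubdiff (inner ℝ (v' r k) (u i))) (i i' : Fin n₁)
    (j j' : Fin n₂) :
    |(1 / (m : ℝ)) * ∑ r, ((1 / (p : ℝ)) * ∑ k, s' r k i * s' r k i') *
          inner ℝ (u i) (u i') * (relu (inner ℝ (v r) (y j)) *
            relu (inner ℝ (v r) (y j'))) - derivGram u i i' * valueGram y j j'| ≤
        ε + 7 * B ^ 2 * M ^ 2 * R := by
  have hF : (1 / (m : ℝ)) * ∑ r, (branchSmall R (u i) (w r, w' r, a r) +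
      branchSmall R (u i') (w r, w' r, a r)) ≤ 4 * R := by
    rw [Finset.sum_add_distrib, mul_add]
    linarith [hg.branchSmall_le i, hg.branchSmall_le i']
  have hv'' : ∀ r k, ‖v' r k - w' r k‖ ≤ R := fun r k =>
    (hv' r k).trans (div_sqrt_natCast_le hp hR)
  have hrelu : ∀ r j, |relu (inner ℝ (w r) (y j))| ≤ M := fun r j => by
    rw [abs_of_nonneg (relu_nonneg _)]
    exact (relu_le_abs _).trans (hg.abs_inner_le r j)
  have key := abs_average_kernel_sub_le (b := fun r => relu (inner ℝ (v r) (y j)))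
    (b₀ := fun r => relu (inner ℝ (w r) (y j))) (b' := fun r => relu (inner ℝ (v r) (y j')))
    (b₀' := fun r => relu (inner ℝ (w r) (y j')))
    (Y := fun r => (1 / (p : ℝ)) * ∑ k, s' r k i * s' r k i')
    (Y₀ := fun r => (1 / (p : ℝ)) * ∑ k,
      step (inner ℝ (w' r k) (u i)) * step (inner ℝ (w' r k) (u i')))
    (M := M) (δ := R * B) hm (by positivity) (by linarith) (abs_inner_le_sq (hu i) (hu i'))
    (fun r => hrelu r j) (fun r => hrelu r j')
    (fun r => abs_relu_inner_sub_le (hv r) (hy j))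
    (fun r => abs_relu_inner_sub_le (hv r) (hy j'))
    (fun r => abs_average_le zero_le_one fun k => by
      rw [abs_mul]
      exact mul_le_one₀ (abs_of_mem_reluSubdiff (hs' r k i)) (abs_nonneg _)
        (abs_of_mem_reluSubdiff (hs' r k i')))
    (fun r => by
      rw [branchSmall, branchSmall, ← mul_add, ← mul_sub, ← Finset.sum_add_distrib,
        ← Finset.sum_sub_distrib, abs_mul, abs_of_nonneg (a := 1 / (p : ℝ)) (by positivity)]
      gcongr
      refine (Finset.abs_sum_le_sum_abs _ _).trans (Finset.sum_le_sum fun k _ => ?_)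
      exact abs_mul_sub_mul_le_of_unit (abs_of_mem_reluSubdiff (hs' r k i)) (abs_step_le_one _)
        (abs_sub_step_le_small (hv'' r k) (hs' r k i))
        (abs_sub_step_le_small (hv'' r k) (hs' r k i'))) hF
  have h2 := hg.branchKernel_le i i' j j'
  have hker : ∀ r, branchKernel (u i) (u i') (y j) (y j') (w r, w' r, a r) =
      ((1 / (p : ℝ)) * ∑ k, step (inner ℝ (w' r k) (u i)) * step (inner ℝ (w' r k) (u i'))) *
        inner ℝ (u i) (u i') * (relu (inner ℝ (w r) (y j)) * relu (inner ℝ (w r) (y j'))) := by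
    intro r
    rw [branchKernel, ← Finset.sum_mul]
    ring
  simp_rw [hker] at h2
  have h4 := (abs_sub_le _ _ (derivGram u i i' * valueGram y j j')).trans
      (add_le_add (key.trans (kernel_stability_bound hB hBM hR hR1)) h2)
  linarith

theorem sum_abs_sq_le {ι : Type*} [Fintype ι] (x : ι → ℝ) :
    (∑ α, |x α|) ^ 2 ≤ Fintype.card ι * ∑ α, x α ^ 2 := by
  have := sq_sum_le_card_mul_sum_sq (s := Finset.univ) (f := fun α => |x α|)
  simpa using this

/-- An entrywise perturbation of size `η` changes the form by at most `η * (∑ |x α|) ^ 2`, and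
Cauchy–Schwarz costs the factor `card ι`. -/
theorem quadForm_ge_of_abs_sub_le {ι : Type} [Fintype ι] [DecidableEq ι] {A : Matrix ι ι ℝ}
    (hA : A.IsHermitian) {K : ι → ι → ℝ} {η : ℝ} (h : ∀ α β, |K α β - A α β| ≤ η) (x : ι → ℝ) :
    (leastEigenvalue A - Fintype.card ι * η) * ∑ α, x α ^ 2 ≤ ∑ α, ∑ β, x α * x β * K α β := by
  have h1 := leastEigenvalue_mul_le hA x
  rcases isEmpty_or_nonempty ι with hι | ⟨⟨α₀⟩⟩
  · simp
  have hη : 0 ≤ η := (abs_nonneg _).trans (h α₀ α₀)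
  have h2 : ∑ α, ∑ β, x α * x β * A α β - ∑ α, ∑ β, x α * x β * K α β ≤ η * (∑ α, |x α|) ^ 2 := by
    rw [pow_two, Finset.sum_mul_sum, Finset.mul_sum, ← Finset.sum_sub_distrib]
    refine Finset.sum_le_sum fun α _ => ?_
    rw [Finset.mul_sum, ← Finset.sum_sub_distrib]
    refine Finset.sum_le_sum fun β _ => ?_
    calc x α * x β * A α β - x α * x β * K α β ≤ |x α * x β * (A α β - K α β)| := by
          rw [← mul_sub]; exact le_abs_self _
      _ = |x α| * |x β| * |K α β - A α β| := by rw [abs_mul, abs_mul, abs_sub_comm]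
      _ ≤ |x α| * |x β| * η := by gcongr; exact h α β
      _ = _ := by ring
  have h3 := mul_le_mul_of_nonneg_left (sum_abs_sq_le x) hη
  nlinarith

theorem isHermitian_valueGram {n D : ℕ} (x : Fin n → EuclideanSpace ℝ (Fin D)) :
    (valueGram x).IsHermitian := by
  ext i j
  simp [valueGram, Matrix.conjTranspose_apply, mul_comm]

theorem isHermitian_derivGram {n D : ℕ} (x : Fin n → EuclideanSpace ℝ (Fin D)) :
    (derivGram x).IsHermitian := by
  ext i j
  rw [Matrix.conjTranspose_apply, derivGram_apply, derivGram_apply, star_trivial]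
  simp only [real_inner_comm (x i), mul_comm (step (inner ℝ _ (x j)))]

theorem isHermitian_kronecker {n n' : ℕ} {A : Matrix (Fin n) (Fin n) ℝ}
    {A' : Matrix (Fin n') (Fin n') ℝ} (h : A.IsHermitian) (h' : A'.IsHermitian) :
    (A ⊗ₖ A').IsHermitian := by
  rw [Matrix.IsHermitian, Matrix.conjTranspose_kronecker, h, h']

theorem sqResidual_eq_sum_prod : sqResidual u y z v v' a = ∑ α : Fin n₁ × Fin n₂,
    (net v v' a (u α.1) (y α.2) - z α.1 α.2) ^ 2 := by
  rw [sqResidual, Fintype.sum_prod_type]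
  exact Finset.sum_congr rfl fun i _ => Finset.sum_congr rfl fun j _ => by ring

/-- The Polyak–Łojasiewicz inequality near a good initialization. -/
theorem IsGoodInit.mul_sqResidual_le (hg : IsGoodInit u y M R ε τ w w' a) (hm : 0 < m)
    (hp : 0 < p) (hB : 1 ≤ B) (hBM : B ≤ M) (hR : 0 ≤ R) (hR1 : R ≤ 1) (hu : ∀ i, ‖u i‖ ≤ B)
    (hy : ∀ j, ‖y j‖ ≤ B)
    (hε : 4 * (n₁ * n₂) * (ε + 7 * B ^ 2 * M ^ 2 * R) ≤ lam u y + lam' u y)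
    (hv : ∀ r, ‖v r - w r‖ ≤ R)
    (hv' : ∀ r k, ‖v' r k - w' r k‖ ≤ R / √(p : ℝ))
    (hs : ∀ r j, s r j ∈ reluSubdiff (inner ℝ (v r) (y j)))
    (hs' : ∀ r k i, s' r k i ∈ reluSubdiff (inner ℝ (v' r k) (u i))) :
    (lam u y + lam' u y) * sqResidual u y z v v' a ≤
      2 * (∑ r, ‖gradTrunk u y z v v' a s r‖ ^ 2 +
        ∑ r, ∑ k, ‖gradBranch u y z v v' a s' r k‖ ^ 2) := by
  have h1 := quadForm_ge_of_abs_sub_le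
    (isHermitian_kronecker (isHermitian_valueGram u) (isHermitian_derivGram y))
    (K := fun α β => (1 / (m : ℝ)) * ∑ r, (s r α.2 * s r β.2) * inner ℝ (y α.2) (y β.2) *
          (branch v' a r (u α.1) * branch v' a r (u β.1)))
    (fun α β => hg.abs_trunkGram_sub_le hm hp hB hBM hR hR1 hu hy hv hv' hs α.1 β.1 α.2 β.2)
    (fun α => net v v' a (u α.1) (y α.2) - z α.1 α.2)
  have h2 := quadForm_ge_of_abs_sub_le
    (isHermitian_kronecker (isHermitian_derivGram u) (isHermitian_valueGram y))
    (K := fun α β => (1 / (m : ℝ)) * ∑ r, ((1 / (p : ℝ)) * ∑ k, s' r k α.1 * s' r k β.1) *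
          inner ℝ (u α.1) (u β.1) * (relu (inner ℝ (v r) (y α.2)) *
            relu (inner ℝ (v r) (y β.2))))
    (fun α β => hg.abs_branchGram_sub_le hm hp hB hBM hR hR1 hu hy hv hv' hs' α.1 β.1 α.2 β.2)
    (fun α => net v v' a (u α.1) (y α.2) - z α.1 α.2)
  rw [← sum_norm_sq_gradTrunk_eq, ← sqResidual_eq_sum_prod] at h1
  rw [← sum_norm_sq_gradBranch_eq hg.sq_eq_one, ← sqResidual_eq_sum_prod] at h2
  simp only [Fintype.card_prod, Fintype.card_fin, Nat.cast_mul] at h1 h2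
  change (lam u y - _) * _ ≤ _ at h1
  change (lam' u y - _) * _ ≤ _ at h2
  -- Each Gram matrix loses `N * (ε + 7 * B ^ 2 * M ^ 2 * R)`, with `N = n₁ * n₂`. Twice the sum of
  -- both forms has coefficient `2 * (lam + lam')` minus four times this loss, and `hε` lets the
  -- total loss consume half.
  have h3 := mul_le_mul_of_nonneg_right hε (sqResidual_nonneg (u := u) (y := y) (z := z) (a := a) v v')
  linarith

theorem sum_abs_residual_le : ∑ α : Fin n₁ × Fin n₂, |net v v' a (u α.1) (y α.2) - z α.1 α.2| ≤
    √((n₁ : ℝ) * n₂) * √(sqResidual u y z v v' a) := by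
  rw [← sqrt_mul (by positivity), sqResidual_eq_sum_prod]
  refine le_sqrt_of_sq_le ((sum_abs_sq_le _).trans_eq ?_)
  simp

/-- The features stay below `2 * M` because they move by at most `R * B ≤ M`; the sum of the
absolute residuals costs a factor `√(n₁ * n₂)` by Cauchy–Schwarz. -/
theorem IsGoodInit.norm_gradTrunk_le (hg : IsGoodInit u y M R ε τ w w' a)
    (hp : 0 < p) (hB : 1 ≤ B) (hBM : B ≤ M) (hR1 : R ≤ 1) (hu : ∀ i, ‖u i‖ ≤ B)
    (hy : ∀ j, ‖y j‖ ≤ B) (hv' : ∀ r k, ‖v' r k - w' r k‖ ≤ R / √(p : ℝ))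
    (hs : ∀ r j, s r j ∈ reluSubdiff (inner ℝ (v r) (y j))) (r : Fin m) :
    ‖gradTrunk u y z v v' a s r‖ ≤
      2 * M * B * √((n₁ : ℝ) * n₂) / √(m : ℝ) * √(sqResidual u y z v v' a) := by
  have hterm : ∀ i j, ‖(net v v' a (u i) (y j) - z i j) •
      ((1 / √(m : ℝ)) * branch v' a r (u i) * s r j) • y j‖ ≤
      |net v v' a (u i) (y j) - z i j| * (2 * M * B / √(m : ℝ)) := by
    intro i j
    rw [norm_smul, norm_smul, norm_eq_abs, norm_eq_abs]
    gcongr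
    rw [abs_mul, abs_mul, abs_of_nonneg (a := 1 / √(m : ℝ)) (by positivity)]
    have hb : |branch v' a r (u i)| ≤ 2 * M := by
      have e1 := hg.abs_branch_le r i
      have e2 := abs_branch_sub_le hp hg.sq_eq_one hv' (hu i) r
      have e3 := abs_sub_abs_le_abs_sub (branch v' a r (u i)) (branch w' a r (u i))
      have e4 : R * B ≤ 1 * B := by gcongr
      linarith
    have hM : 0 ≤ M := by linarith
    calc 1 / √(m : ℝ) * |branch v' a r (u i)| * |s r j| * ‖y j‖
        ≤ 1 / √(m : ℝ) * (2 * M) * 1 * B := by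
          gcongr
          · exact abs_of_mem_reluSubdiff (hs r j)
          · exact hy j
      _ = _ := by ring
  rw [gradTrunk]
  calc _ ≤ ∑ i, ∑ j, |net v v' a (u i) (y j) - z i j| * (2 * M * B / √(m : ℝ)) :=
        (norm_sum_le _ _).trans (Finset.sum_le_sum fun i _ =>
          (norm_sum_le _ _).trans (Finset.sum_le_sum fun j _ => hterm i j))
    _ = (∑ α : Fin n₁ × Fin n₂, |net v v' a (u α.1) (y α.2) - z α.1 α.2|) *
          (2 * M * B / √(m : ℝ)) := by
        rw [Fintype.sum_prod_type]
        simp_rw [Finset.sum_mul]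
    _ ≤ √((n₁ : ℝ) * n₂) * √(sqResidual u y z v v' a) * (2 * M * B / √(m : ℝ)) := by
        gcongr
        · have : 0 ≤ M := by linarith
          positivity
        · exact sum_abs_residual_le
    _ = _ := by ring

theorem IsGoodInit.norm_gradBranch_le (hg : IsGoodInit u y M R ε τ w w' a)
    (hB : 1 ≤ B) (hBM : B ≤ M) (hR1 : R ≤ 1) (hu : ∀ i, ‖u i‖ ≤ B)
    (hy : ∀ j, ‖y j‖ ≤ B) (hv : ∀ r, ‖v r - w r‖ ≤ R)
    (hs' : ∀ r k i, s' r k i ∈ reluSubdiff (inner ℝ (v' r k) (u i))) (r : Fin m) (k : Fin p) :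
    ‖gradBranch u y z v v' a s' r k‖ ≤
      2 * M * B * √((n₁ : ℝ) * n₂) / √(m : ℝ) / √(p : ℝ) * √(sqResidual u y z v v' a) := by
  have ha' : |a r k| = 1 :=
    (sq_eq_sq₀ (abs_nonneg _) zero_le_one).1 (by rw [sq_abs, hg.sq_eq_one r k, one_pow])
  have hterm : ∀ i j, ‖(net v v' a (u i) (y j) - z i j) •
      ((1 / √(m : ℝ)) * (1 / √(p : ℝ)) * a r k * s' r k i * relu (inner ℝ (v r) (y j))) • u i‖ ≤
      |net v v' a (u i) (y j) - z i j| * (2 * M * B / √(m : ℝ) / √(p : ℝ)) := by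
    intro i j
    rw [norm_smul, norm_smul, norm_eq_abs, norm_eq_abs]
    gcongr
    rw [abs_mul, abs_mul, abs_mul, abs_mul, ha', abs_of_nonneg (a := 1 / √(m : ℝ)) (by positivity),
      abs_of_nonneg (a := 1 / √(p : ℝ)) (by positivity)]
    have hb : |relu (inner ℝ (v r) (y j))| ≤ 2 * M := by
      have e1 := hg.abs_inner_le r j
      have e0 := relu_le_abs (inner ℝ (w r) (y j))
      rw [← abs_of_nonneg (relu_nonneg (inner ℝ (w r) (y j)))] at e0
      have e2 := abs_relu_inner_sub_le (hv r) (hy j)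
      have e3 := abs_sub_abs_le_abs_sub (relu (inner ℝ (v r) (y j))) (relu (inner ℝ (w r) (y j)))
      have e4 : R * B ≤ 1 * B := by gcongr
      linarith
    have hM : 0 ≤ M := by linarith
    calc 1 / √(m : ℝ) * (1 / √(p : ℝ)) * 1 * |s' r k i| * |relu (inner ℝ (v r) (y j))| * ‖u i‖
        ≤ 1 / √(m : ℝ) * (1 / √(p : ℝ)) * 1 * 1 * (2 * M) * B := by
          gcongr
          · exact abs_of_mem_reluSubdiff (hs' r k i)
          · exact hu i
      _ = _ := by ring
  rw [gradBranch]
  calc _ ≤ ∑ i, ∑ j, |net v v' a (u i) (y j) - z i j| * (2 * M * B / √(m : ℝ) / √(p : ℝ)) :=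
        (norm_sum_le _ _).trans (Finset.sum_le_sum fun i _ =>
          (norm_sum_le _ _).trans (Finset.sum_le_sum fun j _ => hterm i j))
    _ = (∑ α : Fin n₁ × Fin n₂, |net v v' a (u α.1) (y α.2) - z α.1 α.2|) *
          (2 * M * B / √(m : ℝ) / √(p : ℝ)) := by
        rw [Fintype.sum_prod_type]
        simp_rw [Finset.sum_mul]
    _ ≤ √((n₁ : ℝ) * n₂) * √(sqResidual u y z v v' a) * (2 * M * B / √(m : ℝ) / √(p : ℝ)) := by
        gcongr
        · have : 0 ≤ M := by linarith
          positivity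
        · exact sum_abs_residual_le
    _ = _ := by ring

theorem IsGoodInit.sqrt_sqResidual_le (hg : IsGoodInit u y M R ε τ w w' a) (hB : 0 ≤ B)
    (hτ : 0 ≤ τ) (hz : ∀ i j, |z i j| ≤ B) :
    √(sqResidual u y z w w' a) ≤ √((n₁ : ℝ) * n₂) * (B + τ) := by
  refine sqrt_le_iff.2 ⟨by positivity, ?_⟩
  rw [mul_pow, sq_sqrt (by positivity), sqResidual]
  calc _ ≤ ∑ _i : Fin n₁, ∑ _j : Fin n₂, (B + τ) ^ 2 := by
        refine Finset.sum_le_sum fun i _ => Finset.sum_le_sum fun j _ => ?_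
        refine sq_le_sq' ?_ ?_
        · linarith [abs_le.1 (hz i j), abs_le.1 (hg.abs_net_le i j)]
        · linarith [abs_le.1 (hz i j), abs_le.1 (hg.abs_net_le i j)]
    _ = _ := by simp; ring

/-- Linear convergence of the gradient flow from a good initialization. -/
theorem IsGoodInit.sqResidual_le_exp (hg : IsGoodInit u y M R ε τ w w' a) (hm : 0 < m)
    (hp : 0 < p) (hB : 1 ≤ B) (hBM : B ≤ M) (hR1 : R ≤ 1) (hτ : 0 ≤ τ) (hu : ∀ i, ‖u i‖ ≤ B)
    (hy : ∀ j, ‖y j‖ ≤ B) (hz : ∀ i j, |z i j| ≤ B) (hΛ : 0 < lam u y + lam' u y)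
    (hε : 4 * (n₁ * n₂) * (ε + 7 * B ^ 2 * M ^ 2 * R) ≤ lam u y + lam' u y)
    (hR : 4 * M * B * (n₁ * n₂) * (B + τ) / (√(m : ℝ) * (lam u y + lam' u y)) < R)
    {T : ℝ} {W : ℝ → Fin m → EuclideanSpace ℝ (Fin d)}
    {W' : ℝ → Fin m → Fin p → EuclideanSpace ℝ (Fin q)}
    (hflow : IsGradientFlow u y z a T W W') (hW : W 0 = w) (hW' : W' 0 = w') {t : ℝ}
    (ht : t ∈ Set.Icc 0 T) :
    sqResidual u y z (W t) (W' t) a ≤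
      exp (-(lam u y + lam' u y) * t) * sqResidual u y z w w' a := by
  subst hW hW'
  have hM : 0 ≤ M := by linarith
  have hm' : (0 : ℝ) < m := by exact_mod_cast hm
  have hp' : (0 : ℝ) < p := by exact_mod_cast hp
  have hsp : 0 < √(p : ℝ) := sqrt_pos.2 hp'
  have hsm : 0 < √(m : ℝ) := sqrt_pos.2 hm'
  have hR0 : 0 ≤ R := le_trans (by positivity) hR.le
  -- The distance the velocity bound allows, with both factors `√(n₁ * n₂)`, one from the gradient
  -- and one from the initial residual, multiplied together.
  have hmove : 2 * M * B * √((n₁ : ℝ) * n₂) / √(m : ℝ) * √(sqResidual u y z (W 0) (W' 0) a) /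
      ((lam u y + lam' u y) / 2) < R := by
    refine lt_of_le_of_lt ?_ hR
    calc _ ≤ 2 * M * B * √((n₁ : ℝ) * n₂) / √(m : ℝ) * (√((n₁ : ℝ) * n₂) * (B + τ)) /
          ((lam u y + lam' u y) / 2) := by
          gcongr
          exact hg.sqrt_sqResidual_le (by linarith) hτ hz
      _ = 4 * M * B * (√((n₁ : ℝ) * n₂) * √((n₁ : ℝ) * n₂)) * (B + τ) /
          (√(m : ℝ) * (lam u y + lam' u y)) := by field_simp; ring
      _ = _ := by rw [mul_self_sqrt (by positivity)]
  refine hflow.sqResidual_le_exp (R := R) (R' := R / √(p : ℝ))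
    (c := 2 * M * B * √((n₁ : ℝ) * n₂) / √(m : ℝ))
    (c' := 2 * M * B * √((n₁ : ℝ) * n₂) / √(m : ℝ) / √(p : ℝ)) hΛ (by positivity) (by positivity)
    (fun v v' s s' hv hv' hs hs' =>
      hg.mul_sqResidual_le hm hp hB hBM hR0 hR1 hu hy hε hv hv' hs hs')
    (fun v v' s s' hv hv' hs hs' =>
      ⟨hg.norm_gradTrunk_le hp hB hBM hR1 hu hy hv' hs,
        hg.norm_gradBranch_le hB hBM hR1 hu hy hv hs'⟩) hmove ?_ t ht
  -- For the branch weights both the speed and the allowed radius carry the same factor `1 / √p`.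
  calc _ = 2 * M * B * √((n₁ : ℝ) * n₂) / √(m : ℝ) * √(sqResidual u y z (W 0) (W' 0) a) /
      ((lam u y + lam' u y) / 2) / √(p : ℝ) := by field_simp
    _ < _ := by gcongr

end Perturbation

/-! ### A random initialization is good with high probability. -/

section GoodInit

open Real

variable {m p d q n₁ n₂ : ℕ}

theorem measure_exists_le {Ω ι : Type*} [MeasurableSpace Ω] {μ : Measure Ω} [Fintype ι]
    {E : ι → Ω → Prop} {c : ℝ} (h : ∀ i, μ {ω | E i ω} ≤ ENNReal.ofReal c) :
    μ {ω | ∃ i, E i ω} ≤ ENNReal.ofReal (Fintype.card ι * c) := by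
  have hset : {ω | ∃ i, E i ω} = ⋃ i, {ω | E i ω} := by
    ext ω
    simp
  rw [hset]
  refine (measure_iUnion_fintype_le μ _).trans ((Finset.sum_le_sum fun i _ => h i).trans ?_)
  rw [Finset.sum_const, Finset.card_univ, nsmul_eq_mul, ENNReal.ofReal_mul (by positivity),
    ENNReal.ofReal_natCast]

theorem IsSqExp.measure_pi_exists_lt_le {Ω : Type*} [MeasurableSpace Ω] {μ : Measure Ω}
    [IsProbabilityMeasure μ] {X : Ω → ℝ} {c t M : ℝ} (hc : 0 < c) (hM : 0 ≤ M) (hMt : M ^ 2 = c * t)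
    (hX : IsSqExp X c μ) :
    (Measure.pi fun _ : Fin m => μ) {θ | ∃ r, M < |X (θ r)|} ≤
      ENNReal.ofReal (m * (2 * exp (-t))) := by
  have h := measure_exists_le (μ := Measure.pi fun _ : Fin m => μ)
    (E := fun r θ => M < |X (θ r)|) (c := 2 * exp (-t)) (fun r => ?_)
  · simpa using h
  · have hset : {θ : Fin m → Ω | M < |X (θ r)|} = Function.eval r ⁻¹' {ω | c * t < X ω ^ 2} := by
      ext θ
      simp only [Set.mem_ofPred_eq, Set.mem_preimage, Function.eval, ← hMt, ← sq_abs (X _)]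
      exact (sq_lt_sq₀ hM (abs_nonneg _)).symm
    rw [hset, (measurePreserving_eval (fun _ : Fin m => μ) r).measure_preimage
      (measurableSet_lt measurable_const (hX.measurable.pow_const 2)).nullMeasurableSet]
    exact hX.measure_lt_sq_le hc

/-- Neuron outputs are centred, so concentration of their mean at scale `τ / √m` bounds the initial
predictions by `τ`, independently of the width. -/
theorem net_eq_sqrt_mul_average (hm : 0 < m) (θ : Fin m → Neuron p d q)
    (u : EuclideanSpace ℝ (Fin q)) (y : EuclideanSpace ℝ (Fin d)) :
    net (fun r => (θ r).1) (fun r => (θ r).2.1) (fun r => (θ r).2.2) u y =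
      √(m : ℝ) * ((1 / (m : ℝ)) * ∑ r, neuronOutput u y (θ r)) := by
  have hm' : (0 : ℝ) < m := by exact_mod_cast hm
  have h : 1 / √(m : ℝ) = √(m : ℝ) * (1 / (m : ℝ)) := by
    have := sqrt_pos.2 hm'
    field_simp
    exact (sq_sqrt hm'.le).symm
  rw [net, ← mul_assoc, ← h]
  congr 1
  refine Finset.sum_congr rfl fun r _ => ?_
  rw [neuronOutput, mul_comm]
  rfl

theorem measure_pi_ae_sq : (Measure.pi fun _ : Fin m => neuronLaw p d q)
    {θ | ¬ ∀ r k, (θ r).2.2 k ^ 2 = 1} = 0 :=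
  ae_all_iff.2 fun r =>
    (Measure.quasiMeasurePreserving_eval (fun _ : Fin m => neuronLaw p d q) r).ae ae_neuronLaw_sq

variable {u : Fin n₁ → EuclideanSpace ℝ (Fin q)} {y : Fin n₂ → EuclideanSpace ℝ (Fin d)}
  {M R ε τ B t : ℝ}

/-- A union bound. The terms account, in order, for the sizes of features and preactivations over
all neurons, for the two fractions of small preactivations (mean at most `R`, deviation less than
`R`), for the entries of both Gram matrices, and for the predictions. -/
theorem measure_pi_not_isGoodInit_le (hm : 0 < m) (hp : 0 < p) (hB : 0 < B) (hu : ∀ i, ‖u i‖ ≤ B)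
    (hy : ∀ j, ‖y j‖ ≤ B) (hu0 : ∀ i, u i ≠ 0) (hy0 : ∀ j, y j ≠ 0) (hM : 0 ≤ M)
    (hMt : M ^ 2 = 4 * B ^ 2 * t) (hR : 0 ≤ R) (hR1 : R ≤ 1) (hε : 0 ≤ ε) (hεB : ε ≤ 64 * B ^ 4)
    (hτ : 0 ≤ τ) (hτB : τ / √(m : ℝ) ≤ 64 * B ^ 2) :
    (Measure.pi fun _ : Fin m => neuronLaw p d q) {θ | ¬ IsGoodInit u y M R ε τ
      (fun r => (θ r).1) (fun r => (θ r).2.1) (fun r => (θ r).2.2)} ≤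
      ENNReal.ofReal (2 * m * (n₁ + n₂) * exp (-t) + 2 * (n₁ + n₂) * exp (-(m * R ^ 2 / 1024)) +
        4 * (n₁ * n₂) ^ 2 * exp (-(m * ε ^ 2 / (1024 * B ^ 8))) +
        2 * (n₁ * n₂) * exp (-(τ ^ 2 / (1024 * B ^ 4)))) := by
  set Q := Measure.pi fun _ : Fin m => neuronLaw p d q with hQ
  have hm' : (0 : ℝ) < m := by exact_mod_cast hm
  have hsm : 0 < √(m : ℝ) := sqrt_pos.2 hm'
  have b1 := measure_exists_le (μ := Q) (E := fun i θ => ∃ r, M < |feature (θ r).2 (u i)|)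
    fun i => (isSqExp_neuron_feature hp hB (hu i)).measure_pi_exists_lt_le (m := m)
      (by positivity) hM hMt
  have b2 := measure_exists_le (μ := Q) (E := fun j θ => ∃ r, M < |inner ℝ (θ r).1 (y j)|)
    fun j => (isSqExp_neuron_inner hB (hy j)).measure_pi_exists_lt_le (m := m)
      (by positivity) hM hMt
  have b3 := measure_exists_le (μ := Q) (E := fun j θ => R ≤ |(1 / (m : ℝ)) *
      ∑ r, trunkSmall R (y j) (θ r) - ∫ ω, trunkSmall R (y j) ω ∂(neuronLaw p d q)|)
    fun j => (isSubexp_trunkSmall R (y j)).measure_pi_abs_le hm (by norm_num) hR (by linarith)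
  have b4 := measure_exists_le (μ := Q) (E := fun i θ => R ≤ |(1 / (m : ℝ)) *
      ∑ r, branchSmall R (u i) (θ r) - ∫ ω, branchSmall R (u i) ω ∂(neuronLaw p d q)|)
    fun i => (isSubexp_branchSmall R (u i)).measure_pi_abs_le hm (by norm_num) hR (by linarith)
  have b5 := measure_exists_le (μ := Q)
    (E := fun (x : (Fin n₁ × Fin n₁) × (Fin n₂ × Fin n₂)) θ => ε ≤ |(1 / (m : ℝ)) *
      ∑ r, trunkKernel (u x.1.1) (u x.1.2) (y x.2.1) (y x.2.2) (θ r) -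
      ∫ ω, trunkKernel (u x.1.1) (u x.1.2) (y x.2.1) (y x.2.2) ω ∂(neuronLaw p d q)|)
    fun x => (isSubexp_trunkKernel hp hB (hu x.1.1) (hu x.1.2) (hy x.2.1)
      (hy x.2.2)).measure_pi_abs_le hm (by positivity) hε (by linarith)
  have b6 := measure_exists_le (μ := Q)
    (E := fun (x : (Fin n₁ × Fin n₁) × (Fin n₂ × Fin n₂)) θ => ε ≤ |(1 / (m : ℝ)) *
      ∑ r, branchKernel (u x.1.1) (u x.1.2) (y x.2.1) (y x.2.2) (θ r) -
      ∫ ω, branchKernel (u x.1.1) (u x.1.2) (y x.2.1) (y x.2.2) ω ∂(neuronLaw p d q)|)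
    fun x => (isSubexp_branchKernel hB (hu x.1.1) (hu x.1.2) (hy x.2.1)
      (hy x.2.2)).measure_pi_abs_le hm (by positivity) hε (by linarith)
  have b7 := measure_exists_le (μ := Q)
    (E := fun (x : Fin n₁ × Fin n₂) θ => τ / √(m : ℝ) ≤ |(1 / (m : ℝ)) *
      ∑ r, neuronOutput (u x.1) (y x.2) (θ r) -
      ∫ ω, neuronOutput (u x.1) (y x.2) ω ∂(neuronLaw p d q)|)
    fun x => (isSubexp_neuronOutput hp hB (hu x.1) (hy x.2)).measure_pi_abs_le hm
      (by positivity) (by positivity) (by linarith)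
  have hsub : {θ : Fin m → Neuron p d q | ¬ IsGoodInit u y M R ε τ (fun r => (θ r).1)
      (fun r => (θ r).2.1) (fun r => (θ r).2.2)} ⊆
      {θ | ¬ ∀ r k, (θ r).2.2 k ^ 2 = 1} ∪ ({θ | ∃ i r, M < |feature (θ r).2 (u i)|} ∪
      ({θ | ∃ j r, M < |inner ℝ (θ r).1 (y j)|} ∪ ({θ | ∃ j, R ≤ |(1 / (m : ℝ)) *
      ∑ r, trunkSmall R (y j) (θ r) - ∫ ω, trunkSmall R (y j) ω ∂(neuronLaw p d q)|} ∪
      ({θ | ∃ i, R ≤ |(1 / (m : ℝ)) *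
      ∑ r, branchSmall R (u i) (θ r) - ∫ ω, branchSmall R (u i) ω ∂(neuronLaw p d q)|} ∪
      ({θ | ∃ x : (Fin n₁ × Fin n₁) × (Fin n₂ × Fin n₂), ε ≤ |(1 / (m : ℝ)) *
      ∑ r, trunkKernel (u x.1.1) (u x.1.2) (y x.2.1) (y x.2.2) (θ r) -
      ∫ ω, trunkKernel (u x.1.1) (u x.1.2) (y x.2.1) (y x.2.2) ω ∂(neuronLaw p d q)|} ∪
      ({θ | ∃ x : (Fin n₁ × Fin n₁) × (Fin n₂ × Fin n₂), ε ≤ |(1 / (m : ℝ)) *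
      ∑ r, branchKernel (u x.1.1) (u x.1.2) (y x.2.1) (y x.2.2) (θ r) -
      ∫ ω, branchKernel (u x.1.1) (u x.1.2) (y x.2.1) (y x.2.2) ω ∂(neuronLaw p d q)|} ∪
      {θ | ∃ x : Fin n₁ × Fin n₂, τ / √(m : ℝ) ≤ |(1 / (m : ℝ)) *
      ∑ r, neuronOutput (u x.1) (y x.2) (θ r) -
      ∫ ω, neuronOutput (u x.1) (y x.2) ω ∂(neuronLaw p d q)|})))))) := by
    intro θ hθ
    by_contra hcon
    simp only [Set.mem_union, Set.mem_ofPred_eq, not_or, not_exists, not_le, not_lt, not_not]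
      at hcon
    obtain ⟨h0, h1, h2, h3, h4, h5, h6, h7⟩ := hcon
    refine hθ ⟨h0, fun r i => h1 i r, fun r j => h2 j r, fun j => ?_, fun i => ?_,
      fun i i' j j' => ?_, fun i i' j j' => ?_, fun i j => ?_⟩
    · have e1 := (abs_lt.1 (h3 j)).2
      have e2 := integral_trunkSmall_le (p := p) (q := q) (hy0 j) hR
      linarith
    · have e1 := (abs_lt.1 (h4 i)).2
      have e2 := integral_branchSmall_le (d := d) hp (hu0 i) hR
      linarith
    · have e1 := h5 ((i, i'), (j, j'))
      rw [integral_trunkKernel hp u y i i' j j'] at e1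
      exact e1.le
    · have e1 := h6 ((i, i'), (j, j'))
      rw [integral_branchKernel hp u y i i' j j'] at e1
      exact e1.le
    · have e1 := h7 (i, j)
      rw [integral_neuronOutput, sub_zero, lt_div_iff₀ hsm] at e1
      rw [net_eq_sqrt_mul_average hm, abs_mul, abs_of_pos hsm, mul_comm]
      exact e1.le
  refine (measure_mono hsub).trans ?_
  refine (measure_union_le _ _).trans ?_
  rw [measure_pi_ae_sq, zero_add]
  refine (measure_union_le _ _).trans ((add_le_add b1 ((measure_union_le _ _).trans
    (add_le_add b2 ((measure_union_le _ _).trans (add_le_add b3 ((measure_union_le _ _).trans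
    (add_le_add b4 ((measure_union_le _ _).trans (add_le_add b5 ((measure_union_le _ _).trans
    (add_le_add b6 b7))))))))))).trans ?_)
  rw [← ENNReal.ofReal_add (by positivity) (by positivity),
    ← ENNReal.ofReal_add (by positivity) (by positivity),
    ← ENNReal.ofReal_add (by positivity) (by positivity),
    ← ENNReal.ofReal_add (by positivity) (by positivity),
    ← ENNReal.ofReal_add (by positivity) (by positivity),
    ← ENNReal.ofReal_add (by positivity) (by positivity)]
  refine ENNReal.ofReal_le_ofReal (le_of_eq ?_)
  have c1 : (m : ℝ) * R ^ 2 / (64 * 4 ^ 2) = m * R ^ 2 / 1024 := by norm_num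
  have c2 : (m : ℝ) * ε ^ 2 / (64 * (B ^ 2 * (4 * B ^ 2)) ^ 2) = m * ε ^ 2 / (1024 * B ^ 8) := by
    congr 1; ring
  have c3 : (m : ℝ) * (τ / √(m : ℝ)) ^ 2 / (64 * (1 * (4 * B ^ 2)) ^ 2) =
      τ ^ 2 / (1024 * B ^ 4) := by
    rw [div_pow, sq_sqrt hm'.le]
    field_simp
    ring
  rw [c1, c2, c3]
  simp only [Fintype.card_prod, Fintype.card_fin, Nat.cast_mul]
  ring

/-- Regrouping the parameters of the operator by neuron. -/
def neuronsEquiv (m p d q : ℕ) : (Fin m → Neuron p d q) ≃ᵐ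
    (Fin m → EuclideanSpace ℝ (Fin d)) ×
      (Fin m → Fin p → EuclideanSpace ℝ (Fin q)) × (Fin m → Fin p → ℝ) :=
  (MeasurableEquiv.arrowProdEquivProdArrow _ _ _).trans
    ((MeasurableEquiv.refl _).prodCongr (MeasurableEquiv.arrowProdEquivProdArrow _ _ _))

theorem measurePreserving_neuronsEquiv : MeasurePreserving (neuronsEquiv m p d q)
    (Measure.pi fun _ : Fin m => neuronLaw p d q) (initLaw m p d q) :=
  (measurePreserving_arrowProdEquivProdArrow _ _ (Fin m) _ _).trans
    ((MeasurePreserving.id _).prod (measurePreserving_arrowProdEquivProdArrow _ _ (Fin m) _ _))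

instance isProbabilityMeasure_initLaw : IsProbabilityMeasure (initLaw m p d q) := by
  unfold initLaw; infer_instance

/-- The complement of a measurable hull of the bad set, so measurability of `IsGoodInit` itself is
not needed. -/
theorem exists_measurableSet_isGoodInit {δ : ℝ} (hδ : 0 ≤ δ)
    (h : (Measure.pi fun _ : Fin m => neuronLaw p d q) {θ | ¬ IsGoodInit u y M R ε τ
      (fun r => (θ r).1) (fun r => (θ r).2.1) (fun r => (θ r).2.2)} ≤ ENNReal.ofReal δ) :
    ∃ S : Set ((Fin m → EuclideanSpace ℝ (Fin d)) ×
        (Fin m → Fin p → EuclideanSpace ℝ (Fin q)) × (Fin m → Fin p → ℝ)),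
      MeasurableSet S ∧ ENNReal.ofReal (1 - δ) ≤ initLaw m p d q S ∧
      ∀ w w' a, (w, w', a) ∈ S → IsGoodInit u y M R ε τ w w' a := by
  set bad : Set ((Fin m → EuclideanSpace ℝ (Fin d)) ×
        (Fin m → Fin p → EuclideanSpace ℝ (Fin q)) × (Fin m → Fin p → ℝ)) :=
    {x | ¬ IsGoodInit u y M R ε τ x.1 x.2.1 x.2.2} with hbad
  have hle : initLaw m p d q bad ≤ ENNReal.ofReal δ := by
    rw [← measurePreserving_neuronsEquiv.measure_preimage_equiv]
    exact h
  refine ⟨(toMeasurable (initLaw m p d q) bad)ᶜ, (measurableSet_toMeasurable _ _).compl, ?_,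
    fun w w' a hmem => ?_⟩
  · rw [prob_compl_eq_one_sub (measurableSet_toMeasurable _ _), measure_toMeasurable,
      ENNReal.ofReal_sub _ hδ, ENNReal.ofReal_one]
    exact tsub_le_tsub_left hle 1
  · by_contra hcon
    exact hmem (subset_toMeasurable _ _ hcon)

end GoodInit

/-! ### Bounds on the eigenvalues, choice of the parameters, and the width condition. -/

section Convergence

open Real

variable {n₁ n₂ d q : ℕ} {u : Fin n₁ → EuclideanSpace ℝ (Fin q)}
  {y : Fin n₂ → EuclideanSpace ℝ (Fin d)}

theorem lam_pos (hn₁ : 0 < n₁) (hn₂ : 0 < n₂) (hu0 : ∀ i, u i ≠ 0) (hy0 : ∀ j, y j ≠ 0)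
    (hu : ∀ i i', i ≠ i' → LinearIndependent ℝ ![u i, u i'])
    (hy : ∀ j j', j ≠ j' → LinearIndependent ℝ ![y j, y j']) : 0 < lam u y :=
  haveI : Nonempty (Fin n₁ × Fin n₂) := ⟨(⟨0, hn₁⟩, ⟨0, hn₂⟩)⟩
  leastEigenvalue_pos ((posDef_valueGram hu0 hu).kronecker (posDef_derivGram hy0 hy))

theorem lam'_pos (hn₁ : 0 < n₁) (hn₂ : 0 < n₂) (hu0 : ∀ i, u i ≠ 0) (hy0 : ∀ j, y j ≠ 0)
    (hu : ∀ i i', i ≠ i' → LinearIndependent ℝ ![u i, u i'])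
    (hy : ∀ j j', j ≠ j' → LinearIndependent ℝ ![y j, y j']) : 0 < lam' u y :=
  haveI : Nonempty (Fin n₁ × Fin n₂) := ⟨(⟨0, hn₁⟩, ⟨0, hn₂⟩)⟩
  leastEigenvalue_pos ((posDef_derivGram hu0 hu).kronecker (posDef_valueGram hy0 hy))

theorem valueGram_diag_nonneg {n D : ℕ} (v : Fin n → EuclideanSpace ℝ (Fin D)) (i : Fin n) :
    0 ≤ valueGram v i i :=
  integral_nonneg fun _ => mul_self_nonneg _

/-- From `x ^ 2 ≤ c * (exp (x ^ 2 / c) - 1)`, whose right side has expectation at most `c` for `c =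
4 * B ^ 2`. -/
theorem valueGram_diag_le {n D : ℕ} {v : Fin n → EuclideanSpace ℝ (Fin D)} {B : ℝ} (hB : 0 < B)
    (hv : ∀ i, ‖v i‖ ≤ B) (i : Fin n) : valueGram v i i ≤ 4 * B ^ 2 := by
  obtain ⟨_, hint, hle⟩ := isSqExp_inner hB (hv i)
  have hc : 0 < 4 * B ^ 2 := by positivity
  have hint' := (hint.sub (integrable_const (1 : ℝ))).const_mul (4 * B ^ 2)
  calc valueGram v i i ≤ ∫ w, 4 * B ^ 2 * (exp (inner ℝ w (v i) ^ 2 / (4 * B ^ 2)) - 1)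
        ∂(stdGaussian (EuclideanSpace ℝ (Fin D))) := by
        refine integral_mono_of_nonneg (Filter.Eventually.of_forall fun w => mul_self_nonneg _)
          hint' (Filter.Eventually.of_forall fun w => ?_)
        have h1 := add_one_le_exp (inner ℝ w (v i) ^ 2 / (4 * B ^ 2))
        have h2 : inner ℝ w (v i) ^ 2 = 4 * B ^ 2 * (inner ℝ w (v i) ^ 2 / (4 * B ^ 2)) := by
          field_simp
        have h3 : relu (inner ℝ w (v i)) * relu (inner ℝ w (v i)) ≤ inner ℝ w (v i) ^ 2 := by
          rcases le_total 0 (inner ℝ w (v i)) with h | h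
          · rw [relu, max_eq_left h, sq]
          · rw [relu, max_eq_right h, mul_zero]
            positivity
        refine h3.trans (h2.trans_le ?_)
        exact mul_le_mul_of_nonneg_left (by linarith) hc.le
    _ ≤ 4 * B ^ 2 := by
        rw [integral_const_mul, integral_sub hint (integrable_const _)]
        simp only [integral_const, probReal_univ, smul_eq_mul, mul_one]
        exact mul_le_of_le_one_right hc.le (by linarith)

theorem derivGram_diag_le {n D : ℕ} {v : Fin n → EuclideanSpace ℝ (Fin D)} {B : ℝ}
    (hv : ∀ i, ‖v i‖ ≤ B) (i : Fin n) : derivGram v i i ≤ B ^ 2 := by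
  have hle : inner ℝ (v i) (v i) ≤ B ^ 2 := (le_abs_self _).trans (abs_inner_le_sq (hv i) (hv i))
  calc derivGram v i i ≤ ∫ _, B ^ 2 ∂(stdGaussian (EuclideanSpace ℝ (Fin D))) := by
        refine integral_mono_of_nonneg (Filter.Eventually.of_forall fun w => ?_)
          (integrable_const _) (Filter.Eventually.of_forall fun w => ?_)
        · exact Set.indicator_nonneg (fun _ _ => real_inner_self_nonneg) _
        · exact (Set.indicator_le_self' (fun _ _ => real_inner_self_nonneg) w).trans hle
    _ = B ^ 2 := by simp

/-- A least eigenvalue is at most any diagonal entry. This upper bound allows powers of `Λ` to be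
traded for powers of `B` in the width condition. -/
theorem lam_add_lam'_le {B : ℝ} (hB : 0 < B) (hn₁ : 0 < n₁) (hn₂ : 0 < n₂) (hu : ∀ i, ‖u i‖ ≤ B)
    (hy : ∀ j, ‖y j‖ ≤ B) : lam u y + lam' u y ≤ 8 * B ^ 4 := by
  have h1 := leastEigenvalue_le_diag
    (isHermitian_kronecker (isHermitian_valueGram u) (isHermitian_derivGram y))
    (⟨0, hn₁⟩, ⟨0, hn₂⟩)
  have h2 := leastEigenvalue_le_diag
    (isHermitian_kronecker (isHermitian_derivGram u) (isHermitian_valueGram y))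
    (⟨0, hn₁⟩, ⟨0, hn₂⟩)
  rw [Matrix.kroneckerMap_apply] at h1 h2
  have h3 := mul_le_mul_of_nonneg_left (derivGram_diag_le hy ⟨0, hn₂⟩)
    (valueGram_diag_nonneg u ⟨0, hn₁⟩)
  have h4 := mul_le_mul_of_nonneg_right (valueGram_diag_le hB hu ⟨0, hn₁⟩) (sq_nonneg B)
  have h5 := mul_le_mul_of_nonneg_right (derivGram_diag_le hu ⟨0, hn₁⟩)
    (valueGram_diag_nonneg y ⟨0, hn₂⟩)
  have h6 := mul_le_mul_of_nonneg_left (valueGram_diag_le hB hy ⟨0, hn₂⟩) (sq_nonneg B)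
  have h7 : lam u y ≤ 4 * B ^ 4 := by
    refine h1.trans (h3.trans (h4.trans_eq ?_))
    ring
  have h8 : lam' u y ≤ 4 * B ^ 4 := by
    refine h2.trans (h5.trans (h6.trans_eq ?_))
    ring
  linarith

theorem two_le_log_eight : 2 ≤ log 8 := by
  have h : log 8 = 3 * log 2 := by
    rw [show (8 : ℝ) = 2 ^ 3 by norm_num, log_pow]
    norm_num
  have := log_two_gt_d9
  rw [h]
  linarith

theorem one_le_log_eight_mul_div {x δ : ℝ} (hx : 1 ≤ x) (hδ : 0 < δ) (hδ1 : δ ≤ 1) :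
    1 ≤ log (8 * x / δ) := by
  have h8 : 8 ≤ 8 * x / δ := by
    rw [le_div_iff₀ hδ]
    linarith
  linarith [two_le_log_eight, log_le_log (by norm_num) h8]

/-- Absorbs the constant `8` of the union bounds. It needs `δ` bounded away from `1`: for `x = 1`
the logarithm on the right tends to zero as `δ` tends to `1`, and the factor depends on `δ₁` for
this reason. -/
theorem log_eight_mul_div_le {x δ δ₁ : ℝ} (hx : 1 ≤ x) (hδ : 0 < δ) (hδδ : δ ≤ δ₁) (hδ₁ : δ₁ < 1) :
    log (8 * x / δ) ≤ (1 + log 8 / log (1 / δ₁)) * log (x / δ) := by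
  have hδ₁0 : 0 < δ₁ := hδ.trans_le hδδ
  have hpos : 0 < log (1 / δ₁) := log_pos (by rw [lt_div_iff₀ hδ₁0]; linarith)
  have hle : log (1 / δ₁) ≤ log (x / δ) :=
    log_le_log (by positivity) (div_le_div₀ (by linarith) hx hδ hδδ)
  rw [mul_div_assoc, log_mul (by norm_num) (by positivity)]
  have h : log 8 ≤ log 8 / log (1 / δ₁) * log (x / δ) := by
    rw [div_mul_eq_mul_div, le_div_iff₀ hpos]
    exact mul_le_mul_of_nonneg_left hle (by linarith [two_le_log_eight])
  linarith

theorem exp_neg_log_eight_mul_div {x δ : ℝ} (hx : 0 < x) (hδ : 0 < δ) :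
    exp (-log (8 * x / δ)) = δ / (8 * x) := by
  rw [exp_neg, exp_log (by positivity), inv_div]

/-- The total failure probability, in terms of the number `N` of samples and the width `m`. -/
theorem failure_le {N m δ e₁ e₂ e₃ e₄ k : ℝ} (hN : 1 ≤ N) (hNm : N ≤ m) (hδ : 0 < δ) (hδ1 : δ ≤ 1)
    (hk : k ≤ 2 * N) (h₁ : 2 * log (8 * m / δ) ≤ e₁) (h₂ : log (8 * N / δ) ≤ e₂)
    (h₃ : 2 * log (8 * N / δ) ≤ e₃) (h₄ : log (8 * N / δ) ≤ e₄) :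
    2 * m * k * exp (-e₁) + 2 * k * exp (-e₂) + 4 * N ^ 2 * exp (-e₃) + 2 * N * exp (-e₄) ≤ δ := by
  have hm : 0 < m := by linarith
  have hN0 : 0 < N := by linarith
  have a₁ : exp (-e₁) ≤ (δ / (8 * m)) ^ 2 := by
    rw [← exp_neg_log_eight_mul_div hm hδ, ← exp_nat_mul, exp_le_exp]
    push_cast
    linarith
  have a₂ : exp (-e₂) ≤ δ / (8 * N) := by
    rw [← exp_neg_log_eight_mul_div hN0 hδ, exp_le_exp]
    linarith
  have a₃ : exp (-e₃) ≤ (δ / (8 * N)) ^ 2 := by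
    rw [← exp_neg_log_eight_mul_div hN0 hδ, ← exp_nat_mul, exp_le_exp]
    push_cast
    linarith
  have a₄ : exp (-e₄) ≤ δ / (8 * N) := by
    rw [← exp_neg_log_eight_mul_div hN0 hδ, exp_le_exp]
    linarith
  -- Here `k ≤ 2 * N ≤ 2 * m`, so a squared width must be beaten; the exponent `e₁` was given two
  -- logarithms for this.
  have b₁ : 2 * m * k * exp (-e₁) ≤ 2 * m * (2 * m) * (δ / (8 * m)) ^ 2 := by
    gcongr
    linarith
  have b₂ : 2 * k * exp (-e₂) ≤ 2 * (2 * N) * (δ / (8 * N)) := by gcongr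
  have b₃ : 4 * N ^ 2 * exp (-e₃) ≤ 4 * N ^ 2 * (δ / (8 * N)) ^ 2 := by gcongr
  have b₄ : 2 * N * exp (-e₄) ≤ 2 * N * (δ / (8 * N)) := by gcongr
  have c₁ : 2 * m * (2 * m) * (δ / (8 * m)) ^ 2 = δ ^ 2 / 16 := by field_simp; norm_num
  have c₂ : 2 * (2 * N) * (δ / (8 * N)) = δ / 2 := by field_simp; norm_num
  have c₃ : 4 * N ^ 2 * (δ / (8 * N)) ^ 2 = δ ^ 2 / 16 := by field_simp; norm_num
  have c₄ : 2 * N * (δ / (8 * N)) = δ / 4 := by field_simp; norm_num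
  have c₅ : δ ^ 2 ≤ δ := pow_le_of_le_one hδ.le hδ1 two_ne_zero
  -- The four shares are at most `1/16`, `1/2`, `1/16` and `1/4` of `δ`.
  linarith

/-- The arithmetic behind the choice of the parameters: `μ = √m`, `s` and `g` are the square roots
of the two logarithms, `N` is the number of samples. -/
theorem parameter_bounds {B N s g μ Λ : ℝ} (hB : 1 ≤ B) (hN : 1 ≤ N) (hs : 1 ≤ s) (hg : 1 ≤ g)
    (hμ : 0 < μ) (hΛ : 0 < Λ) (hΛB : Λ ≤ 8 * B ^ 4)
    (h : 2 ^ 17 * B ^ 8 * (N ^ 2 * s * g ^ 3) ≤ μ * Λ ^ 2) :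
    2 ^ 11 * (N ^ 2 * s * g ^ 3) ≤ μ ∧ 400 * B ^ 4 * N * s * g / (μ * Λ) ≤ 1 ∧
    1024 * s ^ 2 ≤ μ ^ 2 * (400 * B ^ 4 * N * s * g / (μ * Λ)) ^ 2 ∧
    2 * s ^ 2 ≤ μ ^ 2 * (Λ / (16 * N)) ^ 2 / (1024 * B ^ 8) ∧
    4 * N * (Λ / (16 * N) + 7 * B ^ 2 * (8 * B ^ 2 * g ^ 2) *
      (400 * B ^ 4 * N * s * g / (μ * Λ))) ≤ Λ := by
  have hB0 : 0 < B := by linarith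
  have hN0 : 0 < N := by linarith
  have hs0 : 0 < s := by linarith
  have hg0 : 0 < g := by linarith
  have hΛ2 : Λ ^ 2 ≤ 64 * B ^ 8 := by
    calc Λ ^ 2 ≤ (8 * B ^ 4) ^ 2 := by gcongr
      _ = 64 * B ^ 8 := by ring
  -- One factor `Λ ≤ 8 * B ^ 4` is given up, for those requirements that need `μ * Λ` instead of `μ
  -- * Λ ^ 2` to be large.
  have hlow : 2 ^ 14 * B ^ 4 * (N ^ 2 * s * g ^ 3) ≤ μ * Λ := by
    have h1 : μ * Λ ^ 2 ≤ μ * Λ * (8 * B ^ 4) := by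
      rw [sq, ← mul_assoc]
      gcongr
    have h2 : (2 ^ 14 * B ^ 4 * (N ^ 2 * s * g ^ 3)) * (8 * B ^ 4) ≤ μ * Λ * (8 * B ^ 4) := by
      refine le_trans (le_of_eq ?_) (h.trans h1)
      ring
    exact le_of_mul_le_mul_right h2 (by positivity)
  have hNN : N * s * g ≤ N ^ 2 * s * g ^ 3 := by
    have e1 : N ≤ N ^ 2 := le_self_pow₀ hN two_ne_zero
    have e2 : g ≤ g ^ 3 := le_self_pow₀ hg (by norm_num)
    gcongr
  have hNs : N * s ≤ N ^ 2 * s * g ^ 3 :=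
    le_trans (le_mul_of_one_le_right (by positivity) hg) hNN
  refine ⟨?_, ?_, ?_, ?_, ?_⟩
  · have h1 : 2 ^ 11 * (N ^ 2 * s * g ^ 3) * (64 * B ^ 8) ≤ μ * (64 * B ^ 8) := by
      refine le_trans (le_of_eq ?_) (h.trans (mul_le_mul_of_nonneg_left hΛ2 hμ.le))
      ring
    exact le_of_mul_le_mul_right h1 (by positivity)
  · rw [div_le_one (by positivity)]
    refine le_trans ?_ hlow
    rw [show 400 * B ^ 4 * N * s * g = 400 * B ^ 4 * (N * s * g) by ring]
    gcongr
    norm_num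
  · have h1 : μ ^ 2 * (400 * B ^ 4 * N * s * g / (μ * Λ)) ^ 2 =
        160000 * B ^ 8 * (s ^ 2 * (N ^ 2 * g ^ 2)) / Λ ^ 2 := by
      field_simp
      norm_num
    rw [h1, le_div_iff₀ (by positivity)]
    have h2 : 1 ≤ N ^ 2 * g ^ 2 := one_le_mul_of_one_le_of_one_le (one_le_pow₀ hN) (one_le_pow₀ hg)
    calc 1024 * s ^ 2 * Λ ^ 2 ≤ 1024 * s ^ 2 * (64 * B ^ 8) := by gcongr
      _ ≤ 160000 * B ^ 8 * (s ^ 2 * 1) := by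
          have : 0 ≤ B ^ 8 * s ^ 2 := by positivity
          linarith
      _ ≤ _ := by gcongr
  · have h1 : (2 ^ 10 * (N * s) * B ^ 4) ≤ μ * Λ := by
      refine le_trans ?_ hlow
      rw [mul_right_comm]
      gcongr <;> norm_num
    have h2 : (2 ^ 10 * (N * s) * B ^ 4) ^ 2 ≤ (μ * Λ) ^ 2 := by gcongr
    rw [le_div_iff₀ (by positivity), div_pow, ← mul_div_assoc, le_div_iff₀ (by positivity),
      ← mul_pow]
    refine le_trans ?_ h2
    have : 0 ≤ N ^ 2 * s ^ 2 * B ^ 8 := by positivity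
    linarith
  · have h1 : 4 * N * (Λ / (16 * N) + 7 * B ^ 2 * (8 * B ^ 2 * g ^ 2) *
        (400 * B ^ 4 * N * s * g / (μ * Λ))) =
        Λ / 4 + 89600 * B ^ 8 * (N ^ 2 * s * g ^ 3) / (μ * Λ) := by
      field_simp
      ring
    -- The deviation at initialization takes `Λ / 4` of the budget, and the movement of the weights
    -- may take the remaining `3 / 4 * Λ`: `89600 = 4 * 7 * 8 * 400` is below `3 / 4 * 2 ^ 17`.
    have h2 : 89600 * B ^ 8 * (N ^ 2 * s * g ^ 3) / (μ * Λ) ≤ 3 / 4 * Λ := by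
      rw [div_le_iff₀ (by positivity)]
      have : 0 ≤ B ^ 8 * (N ^ 2 * s * g ^ 3) := by positivity
      linarith
    rw [h1]
    linarith

/-- Convergence with high probability, for a width that satisfies an explicit bound. -/
theorem exists_measurableSet_sqResidual_le_exp {z : Fin n₁ → Fin n₂ → ℝ} {m p : ℕ} {B δ : ℝ}
    (hB : 1 ≤ B) (hn₁ : 0 < n₁) (hn₂ : 0 < n₂) (hm : 0 < m) (hp : 0 < p) (hu : ∀ i, ‖u i‖ ≤ B)
    (hy : ∀ j, ‖y j‖ ≤ B) (hz : ∀ i j, |z i j| ≤ B) (hu0 : ∀ i, u i ≠ 0) (hy0 : ∀ j, y j ≠ 0)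
    (hΛ : 0 < lam u y + lam' u y) (hδ : 0 < δ) (hδ1 : δ ≤ 1)
    (h : 2 ^ 17 * B ^ 8 * ((n₁ * n₂ : ℝ) ^ 2 * √(log (8 * (n₁ * n₂) / δ)) *
      √(log (8 * m / δ)) ^ 3) ≤ √(m : ℝ) * (lam u y + lam' u y) ^ 2) :
    ∃ S : Set ((Fin m → EuclideanSpace ℝ (Fin d)) ×
        (Fin m → Fin p → EuclideanSpace ℝ (Fin q)) × (Fin m → Fin p → ℝ)),
      MeasurableSet S ∧ ENNReal.ofReal (1 - δ) ≤ initLaw m p d q S ∧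
      ∀ w₀ w₀' a, (w₀, w₀', a) ∈ S →
        ∀ (T : ℝ) (w : ℝ → Fin m → EuclideanSpace ℝ (Fin d))
          (w' : ℝ → Fin m → Fin p → EuclideanSpace ℝ (Fin q)),
          IsGradientFlow u y z a T w w' → w 0 = w₀ → w' 0 = w₀' → ∀ t ∈ Set.Icc 0 T,
            sqResidual u y z (w t) (w' t) a ≤
              exp (-(lam u y + lam' u y) * t) * sqResidual u y z w₀ w₀' a := by
  have hΛB := lam_add_lam'_le (by linarith) hn₁ hn₂ hu hy
  set Λ := lam u y + lam' u y with hΛdef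
  set N : ℝ := n₁ * n₂ with hNdef
  have hn₁' : (1 : ℝ) ≤ n₁ := by exact_mod_cast hn₁
  have hn₂' : (1 : ℝ) ≤ n₂ := by exact_mod_cast hn₂
  have hN : 1 ≤ N := one_le_mul_of_one_le_of_one_le hn₁' hn₂'
  have hm1 : (1 : ℝ) ≤ m := by exact_mod_cast hm
  have hl₁ := one_le_log_eight_mul_div hN hδ hδ1
  have hl₂ := one_le_log_eight_mul_div hm1 hδ hδ1
  set s := √(log (8 * N / δ)) with hsdef
  set g := √(log (8 * m / δ)) with hgdef
  have hs2 : s ^ 2 = log (8 * N / δ) := sq_sqrt (by linarith)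
  have hg2 : g ^ 2 = log (8 * m / δ) := sq_sqrt (by linarith)
  have hs : 1 ≤ s := one_le_sqrt.2 hl₁
  have hg : 1 ≤ g := one_le_sqrt.2 hl₂
  have hμ : 0 < √(m : ℝ) := sqrt_pos.2 (by linarith)
  have hμ2 : √(m : ℝ) ^ 2 = m := sq_sqrt (by linarith)
  obtain ⟨k1, k2, k3, k4, k5⟩ := parameter_bounds hB hN hs hg hμ hΛ hΛB h
  have hB0 : 0 < B := by linarith
  have hNμ : N ≤ √(m : ℝ) ∧ s ≤ √(m : ℝ) := by
    have e1 : N ≤ N ^ 2 := le_self_pow₀ hN two_ne_zero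
    have e2 : 1 ≤ g ^ 3 := one_le_pow₀ hg
    have e3 : N ^ 2 * s ≤ N ^ 2 * s * g ^ 3 := le_mul_of_one_le_right (by positivity) e2
    have e4 : N ^ 2 ≤ N ^ 2 * s := le_mul_of_one_le_right (by positivity) hs
    have e5 : s ≤ N ^ 2 * s := le_mul_of_one_le_left (by positivity) (one_le_pow₀ hN)
    constructor <;> linarith
  have hNm : N ≤ m := by
    rw [← hμ2]
    exact hNμ.1.trans (le_self_pow₀ (hN.trans hNμ.1) two_ne_zero)
  set R := 400 * B ^ 4 * N * s * g / (√(m : ℝ) * Λ) with hRdef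
  have hR0 : 0 ≤ R := by positivity
  have h8 : √8 ≤ 3 := by
    rw [sqrt_le_left (by norm_num)]
    norm_num
  have h8' : 1 ≤ √8 := one_le_sqrt.2 (by norm_num)
  have hM2 : (B * √8 * g) ^ 2 = 8 * B ^ 2 * g ^ 2 := by
    rw [mul_pow, mul_pow, sq_sqrt (by norm_num)]
    ring
  -- Choice of parameters: `t = 2 * g ^ 2` doubles the logarithm in the first failure exponent and
  -- forces `M ^ 2 = 8 * B ^ 2 * g ^ 2`; `ε` takes a quarter of the spectral budget; `τ` makes the
  -- last failure exponent equal to `s ^ 2`.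
  have hprob := measure_pi_not_isGoodInit_le (p := p) (M := B * √8 * g) (t := 2 * g ^ 2) (R := R)
    (ε := Λ / (16 * N)) (τ := 32 * B ^ 2 * s) hm hp hB0 hu hy hu0 hy0 (by positivity)
    (by rw [hM2]; ring) hR0 k2 (by positivity)
    (by
      rw [div_le_iff₀ (by positivity)]
      have : B ^ 4 ≤ B ^ 4 * N := le_mul_of_one_le_right (by positivity) hN
      have : 0 < B ^ 4 := by positivity
      linarith)
    (by positivity)
    (by
      rw [div_le_iff₀ hμ]
      have : B ^ 2 * s ≤ B ^ 2 * √(m : ℝ) := by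
        gcongr
        exact hNμ.2
      have : 0 ≤ B ^ 2 * √(m : ℝ) := by positivity
      linarith)
  rw [hμ2] at k3 k4
  have hfail := failure_le (e₁ := 2 * g ^ 2) (e₂ := m * R ^ 2 / 1024)
    (e₃ := m * (Λ / (16 * N)) ^ 2 / (1024 * B ^ 8))
    (e₄ := (32 * B ^ 2 * s) ^ 2 / (1024 * B ^ 4)) (k := n₁ + n₂) hN hNm hδ hδ1
    (by linarith [mul_nonneg (sub_nonneg.2 hn₁') (sub_nonneg.2 hn₂')]) (by rw [hg2]) (by rw [← hs2]; linarith)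
    (by rw [← hs2]; exact k4)
    (by
      rw [← hs2, le_div_iff₀ (by positivity)]
      apply le_of_eq
      ring)
  obtain ⟨S, hS, hSP, hgood⟩ := exists_measurableSet_isGoodInit hδ.le
    (hprob.trans (ENNReal.ofReal_le_ofReal hfail))
  refine ⟨S, hS, hSP, fun w₀ w₀' a hmem T w w' hflow hw hw' t ht => ?_⟩
  refine (hgood w₀ w₀' a hmem).sqResidual_le_exp hm hp hB ?_ k2 (by positivity) hu hy hz hΛ ?_ ?_
    hflow hw hw' ht
  · rw [mul_assoc]
    exact le_mul_of_one_le_right hB0.le (one_le_mul_of_one_le_of_one_le h8' hg)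
  · rw [hM2]
    exact k5
  -- With `√8 ≤ 3` and `B + τ ≤ 33 * B ^ 2 * s`, the displacement has constant `4 * 3 * 33 = 396`.
  -- The constant `400` in `R` makes the inequality strict, as the continuation argument requires.
  · rw [hRdef]
    refine div_lt_div_of_pos_right ?_ (by positivity)
    have e1 : B + 32 * B ^ 2 * s ≤ 33 * B ^ 2 * s := by
      have : B ≤ B ^ 2 := le_self_pow₀ hB two_ne_zero
      have : B ^ 2 ≤ B ^ 2 * s := le_mul_of_one_le_right (by positivity) hs
      linarith
    calc 4 * (B * √8 * g) * B * N * (B + 32 * B ^ 2 * s)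
        ≤ 4 * (B * 3 * g) * B * N * (33 * B ^ 2 * s) := by gcongr
      _ = 396 * (B ^ 4 * N * s * g) := by ring
      _ < 400 * (B ^ 4 * N * s * g) := by
          have : 0 < B ^ 4 * N * s * g := by positivity
          linarith
      _ = 400 * B ^ 4 * N * s * g := by ring

/-- The width condition implies the bound on the square root of the width that the choice of the
parameters uses. -/
theorem sqrt_width_bound {B N m δ δ₁ l l' : ℝ} (hB : 1 ≤ B) (hN : 1 ≤ N) (hm : 1 ≤ m)
    (hδ : 0 < δ) (hδδ : δ ≤ δ₁) (hδ₁ : δ₁ < 1) (hl : 0 < l) (hl' : 0 < l')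
    (h : 2 ^ 34 * B ^ 16 * (1 + log 8 / log (1 / δ₁)) ^ 4 *
      (N ^ 4 * log (N / δ) * log (m / δ) ^ 3 / (min l l' ^ 2 * (l + l') ^ 2)) ≤ m) :
    2 ^ 17 * B ^ 8 * (N ^ 2 * √(log (8 * N / δ)) * √(log (8 * m / δ)) ^ 3) ≤
      √m * (l + l') ^ 2 := by
  have hδ1 : δ < 1 := hδδ.trans_lt hδ₁
  have hl₁ := one_le_log_eight_mul_div hN hδ hδ1.le
  have hl₂ := one_le_log_eight_mul_div hm hδ hδ1.le
  have hc₁ := log_eight_mul_div_le hN hδ hδδ hδ₁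
  have hc₂ := log_eight_mul_div_le hm hδ hδδ hδ₁
  have hL₁ : 0 < log (N / δ) := log_pos (by rw [lt_div_iff₀ hδ]; linarith)
  have hL₂ : 0 < log (m / δ) := log_pos (by rw [lt_div_iff₀ hδ]; linarith)
  set c := 1 + log 8 / log (1 / δ₁)
  have hmin : 0 < min l l' := lt_min hl hl'
  -- Only the fourth power of the sum of the eigenvalues is needed; the stated condition with the
  -- minimum is more demanding.
  have hminle : min l l' ^ 2 ≤ (l + l') ^ 2 := by
    have : min l l' ≤ l + l' := (min_le_left _ _).trans (by linarith)
    gcongr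
  have hmΛ : 2 ^ 34 * B ^ 16 * c ^ 4 * (N ^ 4 * log (N / δ) * log (m / δ) ^ 3) ≤
      m * (l + l') ^ 4 := by
    rw [← mul_div_assoc, div_le_iff₀ (by positivity)] at h
    calc _ ≤ m * (min l l' ^ 2 * (l + l') ^ 2) := h
      _ ≤ m * ((l + l') ^ 2 * (l + l') ^ 2) := by gcongr
      _ = m * (l + l') ^ 4 := by ring
  -- The inequality is compared after squaring. Removing the constant `8` costs one factor `c` for
  -- the sample logarithm and three for the cubed width logarithm, hence `c ^ 4`.
  have hsq : (2 ^ 17 * B ^ 8 * (N ^ 2 * √(log (8 * N / δ)) * √(log (8 * m / δ)) ^ 3)) ^ 2 ≤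
      (√m * (l + l') ^ 2) ^ 2 := by
    calc _ = 2 ^ 34 * B ^ 16 * (N ^ 4 * √(log (8 * N / δ)) ^ 2 *
          (√(log (8 * m / δ)) ^ 2) ^ 3) := by ring
      _ = 2 ^ 34 * B ^ 16 * (N ^ 4 * log (8 * N / δ) * log (8 * m / δ) ^ 3) := by
          rw [sq_sqrt (by linarith), sq_sqrt (by linarith)]
      _ ≤ 2 ^ 34 * B ^ 16 * (N ^ 4 * (c * log (N / δ)) * (c * log (m / δ)) ^ 3) := by
          have : 0 ≤ N ^ 4 * (c * log (N / δ)) := mul_nonneg (by positivity) (by linarith)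
          gcongr
      _ = 2 ^ 34 * B ^ 16 * c ^ 4 * (N ^ 4 * log (N / δ) * log (m / δ) ^ 3) := by ring
      _ ≤ m * (l + l') ^ 4 := hmΛ
      _ = (√m * (l + l') ^ 2) ^ 2 := by
          rw [mul_pow, sq_sqrt (by linarith)]
          ring
  exact (pow_le_pow_iff_left₀ (by positivity) (by positivity) two_ne_zero).1 hsq

end Convergence

end ShallowOperator

end

theorem theorem1 (B δ₀ : ℝ) (hδ₀ : δ₀ < 1) :
    ∃ C : ℝ, 0 < C ∧
      ∀ (n₁ n₂ d q : ℕ) (u : Fin n₁ → EuclideanSpace ℝ (Fin q))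
        (y : Fin n₂ → EuclideanSpace ℝ (Fin d)) (z : Fin n₁ → Fin n₂ → ℝ),
        0 < n₁ → 0 < n₂ →
        (∀ i, ‖u i‖ ≤ B) → (∀ j, ‖y j‖ ≤ B) → (∀ i j, |z i j| ≤ B) →
        (∀ i, u i ≠ 0) → (∀ j, y j ≠ 0) →
        (∀ i i', i ≠ i' → LinearIndependent ℝ ![u i, u i']) →
        (∀ j j', j ≠ j' → LinearIndependent ℝ ![y j, y j']) →
        0 < ShallowOperator.lam u y ∧ 0 < ShallowOperator.lam' u y ∧
        ∀ (m p : ℕ) (δ : ℝ), 0 < m → 0 < p → 0 < δ → δ ≤ δ₀ →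
          C * ((n₁ : ℝ) ^ 4 * (n₂ : ℝ) ^ 4 * Real.log (n₁ * n₂ / δ) * Real.log (m / δ) ^ 3 /
            ((min (ShallowOperator.lam u y) (ShallowOperator.lam' u y)) ^ 2 *
              (ShallowOperator.lam u y + ShallowOperator.lam' u y) ^ 2)) ≤ (m : ℝ) →
          ∃ S : Set ((Fin m → EuclideanSpace ℝ (Fin d)) ×
              (Fin m → Fin p → EuclideanSpace ℝ (Fin q)) × (Fin m → Fin p → ℝ)),
            MeasurableSet S ∧
            ENNReal.ofReal (1 - δ) ≤ ShallowOperator.initLaw m p d q S ∧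
            ∀ w₀ w₀' a, (w₀, w₀', a) ∈ S →
              ∀ (T : ℝ) (w : ℝ → Fin m → EuclideanSpace ℝ (Fin d))
                (w' : ℝ → Fin m → Fin p → EuclideanSpace ℝ (Fin q)),
                ShallowOperator.IsGradientFlow u y z a T w w' → w 0 = w₀ → w' 0 = w₀' →
                ∀ t ∈ Set.Icc 0 T,
                  ShallowOperator.sqResidual u y z (w t) (w' t) a ≤
                    Real.exp (-(ShallowOperator.lam u y + ShallowOperator.lam' u y) * t) *
                      ShallowOperator.sqResidual u y z w₀ w₀' a := by
  -- `B` and `δ₀` are replaced by `max B 1` and `max δ₀ (1 / 2)`, because `C` must exist even for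
  -- small or negative values, and the estimates use `1 ≤ B` and a level strictly between `0` and
  -- `1`.
  have hδ₁ : max δ₀ (1 / 2) < 1 := max_lt hδ₀ (by norm_num)
  have hδ₁0 : 0 < max δ₀ (1 / 2) := lt_max_of_lt_right (by norm_num)
  have hlog : 0 < Real.log (1 / max δ₀ (1 / 2)) :=
    Real.log_pos (by rw [lt_div_iff₀ hδ₁0]; linarith)
  have hlog8 : 0 < Real.log 8 := Real.log_pos (by norm_num)
  have hB : 1 ≤ max B 1 := le_max_right _ _
  refine ⟨2 ^ 34 * max B 1 ^ 16 * (1 + Real.log 8 / Real.log (1 / max δ₀ (1 / 2))) ^ 4,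
    by positivity, fun n₁ n₂ d q u y z hn₁ hn₂ hu hy hz hu0 hy0 huLI hyLI => ?_⟩
  have hl := ShallowOperator.lam_pos hn₁ hn₂ hu0 hy0 huLI hyLI
  have hl' := ShallowOperator.lam'_pos hn₁ hn₂ hu0 hy0 huLI hyLI
  refine ⟨hl, hl', fun m p δ hm hp hδ hδδ hmC => ?_⟩
  have hδδ' : δ ≤ max δ₀ (1 / 2) := hδδ.trans (le_max_left _ _)
  have hN : (1 : ℝ) ≤ n₁ * n₂ := by exact_mod_cast Nat.mul_pos hn₁ hn₂
  rw [← mul_pow] at hmC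
  exact ShallowOperator.exists_measurableSet_sqResidual_le_exp hB hn₁ hn₂ hm hp
    (fun i => (hu i).trans (le_max_left _ _)) (fun j => (hy j).trans (le_max_left _ _))
    (fun i j => (hz i j).trans (le_max_left _ _)) hu0 hy0 (add_pos hl hl') hδ (by linarith)
    (ShallowOperator.sqrt_width_bound hB hN (by exact_mod_cast hm) hδ hδδ' hδ₁ hl hl' hmC)
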